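/- Let $G$ be a triangulated disk with boundary (a finite oriented simplicial triangulation of the closed disk). Consider a circle packing in the plane with the combinatorics of $G$: circles with centres $c_u$ and radii $R_u>0$ ($u\in V(G)$), externally tangent along the edges of $G$, with positively oriented faces, such that different tangency points on one circle are distinct points (automatic if the open disks are disjoint). For an edge $uv$ let $z_{uv}$ be the point of tangency of the circles of $u$ and $v$. An infinitesimal deformation consists of $\dot c:V\to\mathbb C$, $\dot R:V\to\mathbb R$ with $\langle \dot c_v-\dot c_u,c_v-c_u\rangle=(\dot R_u+\dot R_v)(R_u+R_v)$ for every edge $uv$; it induces velocities $\dot z_{uv}$ of the tangency points. Infinitesimal deformations form a real vector space $\mathcal D$. Let $\mathcal M\subset\mathcal D$ be the deformations induced by a global infinitesimal Möbius transformation, i.e. those for which there are $a,b,c\in\mathbb C$ with $\dot z_e=a z_e^2+bz_e+c$ for all edges $e$, and let $\mathcal S\subset\mathcal D$ be those induced by translations and scalings, $\dot c_u=ac_u+b$, $\dot R_u=aR_u$ with $a\in\mathbb R$, $b\in\mathbb C$. The medial graph has the edges of $G$ as vertices and is realized by $z$. Its faces are a triangle $\{uv,vs,su\}$ for every face $uvs$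 of $G$ and, for every vertex $u$ of $G$, the polygon formed by the edges at $u$ in cyclic order (degenerate, hence no face, if $u$ has only two edges). Let $TMG$ be obtained by triangulating all these polygons without new vertices. Write $\operatorname{cr}(z_1,z_2,z_3,z_4)=\frac{(z_1-z_2)(z_3-z_4)}{(z_2-z_3)(z_4-z_1)}$. Then: 1. $\mathcal D/\mathcal M$ is in linear bijection with the holomorphic quadratic differentials of general type on $TMG$, i.e. the functions $q:E_{int}(TMG)\to\mathbb R$ with $\sum_j q_{ij}=0$ and $\sum_j q_{ij}/(z_j-z_i)=0$ for every interior vertex $i$ of $TMG$. The bijection is $q_{ij}=\dot{\operatorname{cr}}_{ij}/\operatorname{cr}_{ij}$, where $\operatorname{cr}_{ij}=\operatorname{cr}(z_j,z_k,z_i,z_l)$ for the faces $ijk$ and $jil$ of $TMG$ at $ij$. 2. $\mathcal D/\mathcal M$ is in linear bijection with the holomorphic quadratic differentials of Koebe type on $G$, i.e. the functions $\lambda:E_{int}(G)\to\mathbb R$ with $\sum_v \frac{\lambda_{uv}}{\omega(e_{uv})}z_{uv}^p=0$ for $p=0,1,2$ and every interior vertex $u$ of $G$, where, for the faces $uvs$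 and $vut$ at $uv$, $\omega(e_{uv})=\frac{(z_{su}-z_{uv})(z_{ut}-z_{uv})}{z_{ut}-z_{su}}$. The bijection is $\lambda_{uv}=\dot{\operatorname{cr}}^\dagger_{uv}/\operatorname{cr}^\dagger_{uv}$, where $\operatorname{cr}^\dagger_{uv}=\operatorname{cr}(z_{uv},z_{vs},z_{su},z_{ut})$. 3. $\mathcal D/\mathcal S$ is in linear bijection with the functions $\alpha:E(G)=V(TMG)\to\mathbb R$ that are harmonic for the cotangent Laplacian, i.e. $\sum_j(\cot\angle jki+\cot\angle ilj)(\alpha_j-\alpha_i)=0$ for every interior vertex $i$ of $TMG$, the sum being over the edges $ij$ of $TMG$, with adjacent faces $ijk$ and $jil$ and oriented angles. The bijection sends a deformation to its infinitesimal vertex rotation, the function $\alpha$ with $\operatorname{Im}\frac{\dot z_j-\dot z_i}{z_j-z_i}=\alpha_i+\alpha_j$ for any two vertices $i\ne j$ in a common face of the medial graph (more generally, for any two different edges $i,j$ of $G$ with a common end). -/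

import Mathlib

open scoped BigOperators ComplexConjugate

noncomputable section

/-! ## Oriented triangle meshes -/

/-- An oriented triangle mesh with vertex set `W` (a simplicial complex of oriented triangles in
which every directed edge belongs to at most one triangle). `tri a b c` says that `{a, b, c}` is a
face and that `a, b, c` is its positive (counterclockwise) cyclic order. -/
structure TriMesh (W : Type*) where
  tri : W → W → W → Prop
  rotate : ∀ a b c, tri a b c → tri b c a
  ne : ∀ a b c, tri a b c → a ≠ b
  unique : ∀ a b c d, tri a b c → tri a b d → c = d
  simplicial : ∀ a b c, tri a b c → ¬ tri b a c

namespace TriMesh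

variable {W : Type*} (T : TriMesh W)

/-- Unoriented edges are the sides of the faces. -/
def IsEdge (e : Sym2 W) : Prop := ∃ a b c, e = s(a, b) ∧ T.tri a b c

/-- An interior edge is shared by two faces, one on each side. -/
def IsInteriorEdge (e : Sym2 W) : Prop :=
  ∃ a b c d, e = s(a, b) ∧ T.tri a b c ∧ T.tri b a d

/-- An interior vertex: all the edges at it are interior. -/
def IsInteriorVertex (a : W) : Prop := ∀ b, T.IsEdge s(a, b) → T.IsInteriorEdge s(a, b)

/-- The set of edges, as a type. -/
abbrev Edge : Type _ := {e : Sym2 W // T.IsEdge e}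

/-- The set of interior edges, as a type. -/
abbrev InteriorEdge : Type _ := {e : Sym2 W // T.IsInteriorEdge e}

instance [Fintype W] : Fintype T.Edge := Fintype.ofFinite _

open Classical in
/-- The third vertex of the face lying to the left of the directed edge from `a` to `b`
(the value is irrelevant if there is no such face). -/
def apex (a b : W) : W := if h : ∃ c, T.tri a b c then h.choose else a

theorem apex_eq {a b c : W} (h : T.tri a b c) : T.apex a b = c := by
  have h' : ∃ c, T.tri a b c := ⟨c, h⟩
  rw [apex, dif_pos h']
  exact T.unique a b _ _ h'.choose_spec h

open Classical in
/-- Extension by zero of a function on the interior edges to all pairs of vertices. -/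
def extend (q : T.InteriorEdge → ℝ) (e : Sym2 W) : ℝ :=
  if h : T.IsInteriorEdge e then q ⟨e, h⟩ else 0

theorem extend_add (q q' : T.InteriorEdge → ℝ) (e : Sym2 W) :
    T.extend (q + q') e = T.extend q e + T.extend q' e := by
  by_cases h : T.IsInteriorEdge e <;> simp [extend, h]

theorem extend_smul (r : ℝ) (q : T.InteriorEdge → ℝ) (e : Sym2 W) :
    T.extend (r • q) e = r * T.extend q e := by
  by_cases h : T.IsInteriorEdge e <;> simp [extend, h]

theorem extend_zero (e : Sym2 W) : T.extend 0 e = 0 := by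
  by_cases h : T.IsInteriorEdge e <;> simp [extend, h]

/-- `l` lists the neighbours of the vertex `a`, each once, in counterclockwise order: consecutive
ones span a face together with `a`. -/
def IsStar (a : W) (l : List W) : Prop :=
  l.Nodup ∧ (∀ b, b ∈ l ↔ T.IsEdge s(a, b)) ∧ l.IsChain (T.tri a)

end TriMesh

/-- A triangulated disk: a finite connected oriented triangle mesh in which the link of every
vertex is a path or a cycle (so that it is a surface), with nonempty boundary and with Euler
characteristic `1`. By the classification of surfaces these are the (oriented) simplicial
triangulations of the closed disk. -/
structure TriangulatedDisk (V : Type*) [Finite V] extends TriMesh V where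
  star : ∀ u, ∃ l : List V, l ≠ [] ∧ toTriMesh.IsStar u l
  connected : ∀ u v, Relation.ReflTransGen (fun a b => toTriMesh.IsEdge s(a, b)) u v
  boundary : ∃ e, toTriMesh.IsEdge e ∧ ¬ toTriMesh.IsInteriorEdge e
  euler : Nat.card V + {t : Set V | ∃ a b c, tri a b c ∧ t = {a, b, c}}.ncard
    = {e : Sym2 V | toTriMesh.IsEdge e}.ncard + 1

/-! ## Cross ratios -/

/-- The cross ratio `(z₁ - z₂)(z₃ - z₄) / ((z₂ - z₃)(z₄ - z₁))`. -/
def crossRatio (z₁ z₂ z₃ z₄ : ℂ) : ℂ := ((z₁ - z₂) * (z₃ - z₄)) / ((z₂ - z₃) * (z₄ - z₁))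

/-- The relative change of the cross ratio (its derivative divided by its value) when the four
points move with velocities `d₁, …, d₄`. -/
def crossRatioRate (z₁ z₂ z₃ z₄ d₁ d₂ d₃ d₄ : ℂ) : ℂ :=
  (d₁ - d₂) / (z₁ - z₂) - (d₂ - d₃) / (z₂ - z₃) + (d₃ - d₄) / (z₃ - z₄) - (d₄ - d₁) / (z₄ - z₁)

theorem hasDerivAt_crossRatio {z₁ z₂ z₃ z₄ : ℂ} (d₁ d₂ d₃ d₄ : ℂ) (h₁₂ : z₁ ≠ z₂)
    (h₂₃ : z₂ ≠ z₃) (h₃₄ : z₃ ≠ z₄) (h₄₁ : z₄ ≠ z₁) :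
    HasDerivAt (fun t : ℂ => crossRatio (z₁ + t * d₁) (z₂ + t * d₂) (z₃ + t * d₃) (z₄ + t * d₄))
      (crossRatio z₁ z₂ z₃ z₄ * crossRatioRate z₁ z₂ z₃ z₄ d₁ d₂ d₃ d₄) 0 := by
  have hp : ∀ z d : ℂ, HasDerivAt (fun t : ℂ => z + t * d) d 0 := fun z d => by
    simpa using ((hasDerivAt_id (0 : ℂ)).mul_const d).const_add z
  have a := sub_ne_zero.2 h₁₂
  have b := sub_ne_zero.2 h₂₃
  have c := sub_ne_zero.2 h₃₄
  have d := sub_ne_zero.2 h₄₁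
  have key := (((hp z₁ d₁).sub (hp z₂ d₂)).mul ((hp z₃ d₃).sub (hp z₄ d₄))).div
    (((hp z₂ d₂).sub (hp z₃ d₃)).mul ((hp z₄ d₄).sub (hp z₁ d₁)))
    (by simpa using mul_ne_zero b d)
  refine key.congr_deriv ?_
  simp only [crossRatio, crossRatioRate, Pi.mul_apply, Pi.sub_apply, zero_mul, add_zero]
  field_simp
  ring

/-! ## Function spaces on a realized triangle mesh -/

namespace TriMesh

variable {W : Type*} [Fintype W] (T : TriMesh W) (z : W → ℂ)

/-- Holomorphic quadratic differentials of general type on the realization `z` of the mesh. -/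
def generalHQD : Submodule ℝ (T.InteriorEdge → ℝ) where
  carrier := {q | ∀ i, T.IsInteriorVertex i →
    ∑ j, T.extend q s(i, j) = 0 ∧ ∑ j, (T.extend q s(i, j) : ℂ) / (z j - z i) = 0}
  add_mem' := by
    intro q q' hq hq' i hi
    simp only [extend_add, Complex.ofReal_add, add_div, Finset.sum_add_distrib, (hq i hi).1,
      (hq i hi).2, (hq' i hi).1, (hq' i hi).2, add_zero, and_self]
  zero_mem' := by
    intro i _
    simp [extend_zero]
  smul_mem' := by
    intro r q hq i hi
    simp only [extend_smul, Complex.ofReal_mul, mul_div_assoc, ← Finset.mul_sum, (hq i hi).1,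
      (hq i hi).2, mul_zero, and_self]

/-- The cotangent of the oriented angle at `c` from the direction of `a` to that of `b`; in a
counterclockwise triangle `a, b, c` this is the interior angle at `c`. -/
def cotAngle (a c b : ℂ) : ℝ := Real.cot (Complex.arg ((b - c) / (a - c)))

theorem cotAngle_eq_cot_angle {a b c : ℂ} (h : 0 < ((b - c) / (a - c)).im) :
    cotAngle a c b = Real.cot (EuclideanGeometry.angle a c b) := by
  have hac : a - c ≠ 0 := by rintro h0; simp [h0] at h
  have hbc : b - c ≠ 0 := by rintro h0; simp [h0] at h
  rw [cotAngle, EuclideanGeometry.angle, InnerProductGeometry.angle_comm]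
  simp only [vsub_eq_sub]
  rw [Complex.angle_eq_abs_arg hbc hac, abs_of_nonneg (Complex.arg_nonneg_iff.2 h.le)]

/-- The cotangent weight of the interior edge `{i, j}`: the sum of the cotangents of the two angles
opposite to it, in the faces `i, j, k` and `j, i, l`. -/
def cotWeight (i j : W) : ℝ :=
  cotAngle (z i) (z (T.apex i j)) (z j) + cotAngle (z j) (z (T.apex j i)) (z i)

open Classical in
/-- Functions on the vertices that are harmonic for the cotangent Laplacian (at all interior
vertices). -/
def cotHarmonic : Submodule ℝ (W → ℝ) where
  carrier := {α | ∀ i, T.IsInteriorVertex i →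
    ∑ j, (if T.IsInteriorEdge s(i, j) then T.cotWeight z i j * (α j - α i) else 0) = 0}
  add_mem' := by
    intro α β hα hβ i hi
    have h : ∑ j, (if T.IsInteriorEdge s(i, j) then T.cotWeight z i j * (α j - α i) else 0) +
        ∑ j, (if T.IsInteriorEdge s(i, j) then T.cotWeight z i j * (β j - β i) else 0) = 0 := by
      rw [hα i hi, hβ i hi, add_zero]
    rw [← Finset.sum_add_distrib] at h
    refine Eq.trans (Finset.sum_congr rfl fun j _ => ?_) h
    split_ifs
    · simp only [Pi.add_apply]; ring
    · simp
  zero_mem' := by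
    intro i _
    simp
  smul_mem' := by
    intro r α hα i hi
    have h : r * ∑ j, (if T.IsInteriorEdge s(i, j) then T.cotWeight z i j * (α j - α i) else 0)
        = 0 := by
      rw [hα i hi, mul_zero]
    rw [Finset.mul_sum] at h
    refine Eq.trans (Finset.sum_congr rfl fun j _ => ?_) h
    split_ifs
    · simp only [Pi.smul_apply, smul_eq_mul]; ring
    · simp

end TriMesh

/-! ## Triangulations of the medial graph -/

/-- `PolygonTriangulation l P`: the set `P` of triangles is a triangulation, without new vertices,
of the polygon with the vertices `l` (in cyclic order). A polygon with two vertices is degenerate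
and has no triangle; otherwise the triangle at the side from the last to the first vertex cuts the
polygon into two smaller ones. -/
inductive PolygonTriangulation {α : Type*} : List α → Set (α × α × α) → Prop
  | degenerate (a b : α) : PolygonTriangulation [a, b] ∅
  | split (a b c : α) (l₁ l₂ : List α) (P₁ P₂ : Set (α × α × α)) :
      PolygonTriangulation (a :: (l₁ ++ [b])) P₁ →
      PolygonTriangulation (b :: (l₂ ++ [c])) P₂ →
      PolygonTriangulation (a :: (l₁ ++ b :: (l₂ ++ [c]))) (insert (a, b, c) (P₁ ∪ P₂))

/-- `T` is a triangulation of the medial graph of `G`, without new vertices. The vertices of the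
medial graph are the edges of `G`. Its faces are the triangles `uv, vs, su` for the faces `u, v, s`
of `G`, and for every vertex `u` the polygon formed by the edges at `u` in cyclic order; each such
polygon is triangulated. -/
def IsMedialTriangulation {V : Type*} (G : TriMesh V) (T : TriMesh G.Edge) : Prop :=
  ∃ P : V → Set (G.Edge × G.Edge × G.Edge),
    (∀ u, ∃ (l : List V) (m : List G.Edge), G.IsStar u l ∧
      m.map Subtype.val = l.map (fun v => s(u, v)) ∧ PolygonTriangulation m (P u)) ∧
    ∀ e f g : G.Edge, T.tri e f g ↔
      (∃ u v w, G.tri u v w ∧ e.1 = s(u, v) ∧ f.1 = s(v, w) ∧ g.1 = s(w, u)) ∨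
      ∃ u, (e, f, g) ∈ P u ∨ (f, g, e) ∈ P u ∨ (g, e, f) ∈ P u

/-! ## Circle packings and their infinitesimal deformations -/

/-- The point where the circles of the two ends of an edge touch, for circles with centres `c` and
radii `R`. -/
def tangencyPoint {V : Type*} (c : V → ℂ) (R : V → ℝ) (e : Sym2 V) : ℂ :=
  Sym2.lift ⟨fun u v => (R v * c u + R u * c v) / (R u + R v), fun u v => by ring⟩ e

/-- The velocity of the point of tangency when the centres move with velocities `c'` and the radii
change with velocities `R'`. -/
def tangencyVelocity {V : Type*} (c : V → ℂ) (R : V → ℝ) (c' : V → ℂ) (R' : V → ℝ) (e : Sym2 V) :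
    ℂ :=
  Sym2.lift ⟨fun u v => (R' v * c u + R v * c' u + R' u * c v + R u * c' v) / (R u + R v)
    - (R v * c u + R u * c v) * (R' u + R' v) / (R u + R v) ^ 2, fun u v => by ring⟩ e

theorem hasDerivAt_tangencyPoint {V : Type*} (c c' : V → ℂ) (R R' : V → ℝ) (u v : V)
    (h : R u + R v ≠ 0) :
    HasDerivAt (fun t : ℝ => tangencyPoint (fun w => c w + t * c' w) (fun w => R w + t * R' w)
      s(u, v)) (tangencyVelocity c R c' R' s(u, v)) 0 := by
  have hc : ∀ w, HasDerivAt (fun t : ℝ => c w + t * c' w) (c' w) 0 := fun w => by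
    simpa using ((Complex.ofRealCLM.hasDerivAt (x := (0 : ℝ))).mul_const (c' w)).const_add (c w)
  have hR : ∀ w, HasDerivAt (fun t : ℝ => ((R w + t * R' w : ℝ) : ℂ)) (R' w : ℂ) 0 := fun w => by
    have : HasDerivAt (fun t : ℝ => R w + t * R' w) (R' w) 0 := by
      simpa using ((hasDerivAt_id (0 : ℝ)).mul_const (R' w)).const_add (R w)
    exact this.ofReal_comp
  have h' : (R u + R v : ℂ) ≠ 0 := by exact_mod_cast h
  have key := (((hR v).mul (hc u)).add ((hR u).mul (hc v))).div ((hR u).add (hR v))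
    (by simpa using h')
  refine key.congr_deriv ?_
  simp only [tangencyVelocity, Sym2.lift_mk, Pi.mul_apply, Pi.add_apply, zero_mul, add_zero,
    Complex.ofReal_zero]
  field_simp
  ring

/-- A circle packing in the plane with the combinatorics of the mesh `G`: circles with centres
`center u` and radii `radius u`, externally tangent along the edges of `G`, with positively oriented
faces. Distinct tangency points on the same circle are required to be distinct points, as is the
case whenever the open disks of the packing are disjoint. -/
structure CirclePacking {V : Type*} (G : TriMesh V) where
  center : V → ℂ
  radius : V → ℝ
  radius_pos : ∀ u, 0 < radius u
  tangent : ∀ u v, G.IsEdge s(u, v) → dist (center u) (center v) = radius u + radius v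
  oriented : ∀ u v w, G.tri u v w → 0 < ((center w - center u) / (center v - center u)).im
  tangency_ne : ∀ u v w, G.IsEdge s(u, v) → G.IsEdge s(u, w) → v ≠ w →
    tangencyPoint center radius s(u, v) ≠ tangencyPoint center radius s(u, w)

namespace CirclePacking

variable {V : Type*} {G : TriMesh V} (C : CirclePacking G)

/-- The point of tangency of an edge. -/
def pt (e : Sym2 V) : ℂ := tangencyPoint C.center C.radius e

/-- The realization of the medial graph by the points of tangency. -/
def z (e : G.Edge) : ℂ := C.pt e.1

/-- Infinitesimal deformations of the circle packing: first order changes of the centres and of the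
radii that preserve the tangency relation `|c_v - c_u|² = (R_u + R_v)²` along all edges. -/
def deformations : Submodule ℝ ((V → ℂ) × (V → ℝ)) where
  carrier := {δ | ∀ u v, G.IsEdge s(u, v) →
    ((δ.1 v - δ.1 u) * conj (C.center v - C.center u)).re
      = (δ.2 u + δ.2 v) * (C.radius u + C.radius v)}
  add_mem' := by
    intro δ ε hδ hε u v h
    have h₁ := hδ u v h
    have h₂ := hε u v h
    simp only [Prod.fst_add, Prod.snd_add, Pi.add_apply]
    rw [add_sub_add_comm, add_mul, Complex.add_re, h₁, h₂]
    ring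
  zero_mem' := by
    intro u v _
    simp
  smul_mem' := by
    intro r δ hδ u v h
    have h₁ := hδ u v h
    simp only [Prod.smul_fst, Prod.smul_snd, Pi.smul_apply, smul_eq_mul]
    rw [← smul_sub, smul_mul_assoc, Complex.smul_re, h₁, smul_eq_mul]
    ring

/-- The velocity of the point of tangency of an edge under an infinitesimal deformation. -/
def dpt (δ : C.deformations) (e : Sym2 V) : ℂ :=
  tangencyVelocity C.center C.radius δ.1.1 δ.1.2 e

/-- The velocities of the vertices of the medial graph. -/
def dz (δ : C.deformations) (e : G.Edge) : ℂ := C.dpt δ e.1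

theorem dpt_add (δ ε : C.deformations) (e : Sym2 V) : C.dpt (δ + ε) e = C.dpt δ e + C.dpt ε e := by
  induction e with
  | _ u v =>
    simp only [dpt, tangencyVelocity, Sym2.lift_mk, Submodule.coe_add, Prod.fst_add, Prod.snd_add,
      Pi.add_apply, Complex.ofReal_add]
    ring

theorem dpt_smul (r : ℝ) (δ : C.deformations) (e : Sym2 V) : C.dpt (r • δ) e = r * C.dpt δ e := by
  induction e with
  | _ u v =>
    simp only [dpt, tangencyVelocity, Sym2.lift_mk, Submodule.coe_smul, Prod.smul_fst,
      Prod.smul_snd, Pi.smul_apply, smul_eq_mul, Complex.ofReal_mul, Complex.real_smul]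
    ring

end CirclePacking

/-- The vector field on the plane of the infinitesimal Möbius transformation given by the matrix
`Φ ∈ sl(2, ℂ)`: its value at `w` is the determinant with the columns `Φ (w, 1)` and `(w, 1)`. -/
def mobiusField (Φ : Matrix (Fin 2) (Fin 2) ℂ) (w : ℂ) : ℂ :=
  Matrix.det !![Φ 0 0 * w + Φ 0 1, w; Φ 1 0 * w + Φ 1 1, 1]

namespace CirclePacking

variable {V : Type*} {G : TriMesh V} (C : CirclePacking G)

/-- The deformations induced by a global infinitesimal Möbius transformation. -/
def mobiusTrivial : Submodule ℝ C.deformations where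
  carrier := {δ | ∃ Φ : Matrix (Fin 2) (Fin 2) ℂ, Φ.trace = 0 ∧
    ∀ e : G.Edge, C.dz δ e = mobiusField Φ (C.z e)}
  add_mem' := by
    rintro δ ε ⟨Φ, hΦ, h⟩ ⟨Ψ, hΨ, k⟩
    refine ⟨Φ + Ψ, by simp [hΦ, hΨ], fun e => ?_⟩
    have h₁ := h e
    have h₂ := k e
    simp only [dz, mobiusField, Matrix.det_fin_two_of, dpt_add, Matrix.add_apply] at *
    rw [h₁, h₂]
    ring
  zero_mem' := by
    refine ⟨0, by simp, fun e => ?_⟩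
    have h : C.dpt 0 e.1 = 0 := by simpa using C.dpt_smul 0 0 e.1
    simp only [dz, h, mobiusField, Matrix.det_fin_two_of, Matrix.zero_apply]
    ring
  smul_mem' := by
    rintro r δ ⟨Φ, hΦ, h⟩
    refine ⟨(r : ℂ) • Φ, by simp [hΦ], fun e => ?_⟩
    have h₁ := h e
    simp only [dz, mobiusField, Matrix.det_fin_two_of, dpt_smul, Matrix.smul_apply,
      smul_eq_mul] at *
    rw [h₁]
    ring

/-- The deformations induced by infinitesimal translations and scalings. -/
def similarityTrivial : Submodule ℝ C.deformations where
  carrier := {δ | ∃ (a : ℝ) (b : ℂ), ∀ u,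
    δ.1.1 u = a * C.center u + b ∧ δ.1.2 u = a * C.radius u}
  add_mem' := by
    rintro δ ε ⟨a, b, h⟩ ⟨a', b', k⟩
    refine ⟨a + a', b + b', fun u => ?_⟩
    simp only [Submodule.coe_add, Prod.fst_add, Prod.snd_add, Pi.add_apply, (h u).1, (h u).2,
      (k u).1, (k u).2, Complex.ofReal_add]
    constructor <;> ring
  zero_mem' := ⟨0, 0, fun u => by simp⟩
  smul_mem' := by
    rintro r δ ⟨a, b, h⟩
    refine ⟨r * a, r * b, fun u => ?_⟩
    simp only [Submodule.coe_smul, Prod.smul_fst, Prod.smul_snd, Pi.smul_apply, smul_eq_mul,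
      (h u).1, (h u).2, Complex.ofReal_mul, Complex.real_smul]
    constructor <;> ring

/-- The discrete 1-form `ω(e_uv) = (z_k - z_i)(z_m - z_i) / (z_m - z_k)` of an interior edge, where
`z_i, z_k, z_m` are the points of tangency of `u` with `v`, with the third vertex to the left and
with the third vertex to the right of the edge directed from `u` to `v`. -/
def omega (u v : V) : ℂ :=
  (C.pt s(G.apex u v, u) - C.pt s(u, v)) * (C.pt s(u, G.apex v u) - C.pt s(u, v)) /
    (C.pt s(u, G.apex v u) - C.pt s(G.apex u v, u))

/-- Holomorphic quadratic differentials of Koebe type. -/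
def koebeHQD [Fintype V] : Submodule ℝ (G.InteriorEdge → ℝ) where
  carrier := {q | ∀ u, G.IsInteriorVertex u →
    ∑ v, G.extend q s(u, v) / C.omega u v = 0 ∧
    ∑ v, G.extend q s(u, v) / C.omega u v * C.pt s(u, v) = 0 ∧
    ∑ v, G.extend q s(u, v) / C.omega u v * C.pt s(u, v) ^ 2 = 0}
  add_mem' := by
    intro q q' hq hq' u hu
    obtain ⟨h₁, h₂, h₃⟩ := hq u hu
    obtain ⟨k₁, k₂, k₃⟩ := hq' u hu
    simp only [TriMesh.extend_add, Complex.ofReal_add, add_div, add_mul, Finset.sum_add_distrib,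
      h₁, h₂, h₃, k₁, k₂, k₃, add_zero, and_self]
  zero_mem' := by
    intro u _
    simp [TriMesh.extend_zero]
  smul_mem' := by
    intro r q hq u hu
    obtain ⟨h₁, h₂, h₃⟩ := hq u hu
    simp only [TriMesh.extend_smul, Complex.ofReal_mul, mul_div_assoc, mul_assoc,
      ← Finset.mul_sum] at *
    simp only [h₁, h₂, h₃, mul_zero, and_self]

end CirclePacking

end

/-! Each of the three maps is defined on the space of deformations, its kernel is identified, and
its target is shown to be no larger than the quotient. The induced injection is then onto by
dimension (`exists_quotient_equiv`), so no deformation is ever built from a differential or a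
harmonic function. On the source side, tangency is one real equation per edge on three unknowns per
vertex, hence `dim 𝒟 ≥ 3|V| - |E|` (`three_mul_card_le`), while the trivial motions have dimension
at most 3 or 6. Euler's formula gives `2|E| + 3 ≤ 3|V| + |E_int|`.

Harmonic functions. Let `α` be half the angular velocity of each edge (`spin`). A face must remain a
closed triangle, which expresses the difference of the growth rates of two of its circles through
`α` (`growth_sub`). Equating the two faces at an edge gives a Laplace equation with weights `R/r +
r/R`, where `r` is the inradius. These are the cotangent weights of any triangulation of the medial
graph: an inscribed angle contributes `R/r`, a medial triangle `r/R`, and diagonals cancel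
(`sum_cotWeight`). The weights are positive, so the maximum principle bounds the harmonic functions
by the boundary edges. Zero rotation means a similarity.

Quadratic differentials. The velocities of the three tangency points of a face are interpolated by a
quadratic vector field. Its derivative at `z_uv` depends on the edge only (`fieldDeriv_eq`), so the
fields of adjacent faces differ by `A (z - z_uv)²`, and the cross ratio changes at the relative rate
`ω A` (`koebeRate_eq`). Zero rates thus mean one global field, and the equations at an interior
vertex say that the differences sum to zero around it. For the general type the same `A` is the sum
of `q_ij / (z_j - z_i)` over the edges from `i = uv` to other edges at `u` (`fan_eq_quadCoeff_sub`).

For the upper bound, both kinds of differentials embed into the equilibrium stresses. By virtual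
work these annihilate the tensions of all displacements supported at interior vertices; such a
displacement is determined by its tensions, again by the maximum principle. Hence the dimension is
at most `|E_int| - 3|V_int|`. -/

noncomputable section

/-! ### Combinatorics of oriented triangle meshes. -/

namespace TriMesh

section Basic

variable {W : Type*} {T : TriMesh W} {a b c d : W}

theorem ne₁₂ (h : T.tri a b c) : a ≠ b := T.ne _ _ _ h
theorem ne₂₃ (h : T.tri a b c) : b ≠ c := T.ne _ _ _ (T.rotate _ _ _ h)
theorem ne₃₁ (h : T.tri a b c) : c ≠ a := T.ne _ _ _ (T.rotate _ _ _ (T.rotate _ _ _ h))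

theorem rotate' (h : T.tri a b c) : T.tri c a b := T.rotate _ _ _ (T.rotate _ _ _ h)

theorem unique_middle (h : T.tri a b c) (h' : T.tri a d c) : b = d :=
  T.unique _ _ _ _ (rotate' h) (rotate' h')

theorem isEdge_iff : T.IsEdge s(a, b) ↔ (∃ c, T.tri a b c) ∨ ∃ c, T.tri b a c := by
  constructor
  · rintro ⟨x, y, c, h, ht⟩
    rcases Sym2.eq_iff.1 h with ⟨rfl, rfl⟩ | ⟨rfl, rfl⟩
    · exact Or.inl ⟨c, ht⟩
    · exact Or.inr ⟨c, ht⟩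
  · rintro (⟨c, h⟩ | ⟨c, h⟩)
    · exact ⟨a, b, c, rfl, h⟩
    · exact ⟨b, a, c, Sym2.eq_swap, h⟩

theorem isInteriorEdge_iff :
    T.IsInteriorEdge s(a, b) ↔ (∃ c, T.tri a b c) ∧ ∃ c, T.tri b a c := by
  constructor
  · rintro ⟨x, y, c, d, h, ht, ht'⟩
    rcases Sym2.eq_iff.1 h with ⟨rfl, rfl⟩ | ⟨rfl, rfl⟩
    · exact ⟨⟨c, ht⟩, ⟨d, ht'⟩⟩
    · exact ⟨⟨d, ht'⟩, ⟨c, ht⟩⟩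
  · rintro ⟨⟨c, h⟩, ⟨d, h'⟩⟩
    exact ⟨a, b, c, d, rfl, h, h'⟩

theorem IsInteriorEdge.isEdge {e : Sym2 W} (h : T.IsInteriorEdge e) : T.IsEdge e := by
  obtain ⟨a, b, c, d, he, h, -⟩ := h
  exact ⟨a, b, c, he, h⟩

theorem isEdge₁₂ (h : T.tri a b c) : T.IsEdge s(a, b) := ⟨a, b, c, rfl, h⟩
theorem isEdge₂₃ (h : T.tri a b c) : T.IsEdge s(b, c) := isEdge₁₂ (T.rotate _ _ _ h)
theorem isEdge₃₁ (h : T.tri a b c) : T.IsEdge s(c, a) := isEdge₁₂ (rotate' h)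

theorem IsEdge.symm (h : T.IsEdge s(a, b)) : T.IsEdge s(b, a) := by rwa [Sym2.eq_swap]

theorem IsInteriorEdge.symm (h : T.IsInteriorEdge s(a, b)) : T.IsInteriorEdge s(b, a) := by
  rwa [Sym2.eq_swap]

theorem IsEdge.ne (h : T.IsEdge s(a, b)) : a ≠ b := by
  rcases isEdge_iff.1 h with ⟨c, h⟩ | ⟨c, h⟩
  · exact ne₁₂ h
  · exact (ne₁₂ h).symm

theorem apex_ne (h : T.tri a b c) (h' : T.tri b a d) : c ≠ d := by
  rintro rfl
  exact T.simplicial _ _ _ h h'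

theorem extend_apply (q : T.InteriorEdge → ℝ) {e : Sym2 W} (h : T.IsInteriorEdge e) :
    T.extend q e = q ⟨e, h⟩ := dif_pos h

theorem extend_eq_zero (q : T.InteriorEdge → ℝ) {e : Sym2 W} (h : ¬ T.IsInteriorEdge e) :
    T.extend q e = 0 := dif_neg h

/-- A vertex that is not interior is the origin of a boundary edge with its face on the left. -/
theorem exists_boundary_tri [Finite W] {u : W} (hu : ¬ T.IsInteriorVertex u) :
    ∃ v, (∃ w, T.tri u v w) ∧ ¬ ∃ w, T.tri v u w := by
  by_contra! hcon
  apply hu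
  have hsub : {v | ∃ w, T.tri u v w} ⊆ {v | ∃ w, T.tri v u w} := fun v hv => hcon v hv
  -- Crossing a face from one of its edges at `u` to the other maps incoming directed edges
  -- injectively to outgoing ones, so an inclusion in the other direction is an equality.
  have hcard : {v | ∃ w, T.tri v u w}.ncard ≤ {v | ∃ w, T.tri u v w}.ncard := by
    refine Set.ncard_le_ncard_of_injOn (fun v => T.apex v u) ?_ ?_ (Set.toFinite _)
    · rintro v ⟨w, h⟩
      simp only [T.apex_eq h]
      exact ⟨v, T.rotate _ _ _ h⟩
    · rintro v ⟨w, h⟩ v' ⟨w', h'⟩ heq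
      simp only [T.apex_eq h, T.apex_eq h'] at heq
      subst heq
      exact T.unique _ _ _ _ (T.rotate _ _ _ h) (T.rotate _ _ _ h')
  have heq := Set.eq_of_subset_of_ncard_le hsub hcard (Set.toFinite _)
  intro v hv
  rw [isInteriorEdge_iff]
  rcases isEdge_iff.1 hv with h | h
  · exact ⟨h, hsub h⟩
  · exact ⟨heq.symm.subset h, h⟩

theorem IsInteriorVertex.tri_left {u v : W} (hu : T.IsInteriorVertex u) (h : T.IsEdge s(u, v)) :
    ∃ w, T.tri u v w := (isInteriorEdge_iff.1 (hu v h)).1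

theorem IsInteriorVertex.tri_right {u v : W} (hu : T.IsInteriorVertex u) (h : T.IsEdge s(u, v)) :
    ∃ w, T.tri v u w := (isInteriorEdge_iff.1 (hu v h)).2

end Basic

/-! ### Counting boundary vertices, edges and faces. -/

section Counting

variable {W : Type*} [Finite W] (T : TriMesh W)

/-- A boundary vertex is charged to a boundary edge that leaves it with its face on the left. The
orientation recovers the vertex from the edge. -/
theorem card_boundary_add_card_interiorEdge_le :
    Nat.card {u // ¬ T.IsInteriorVertex u} + Nat.card T.InteriorEdge ≤ Nat.card T.Edge := by
  choose f hf hf' using fun u : {u // ¬ T.IsInteriorVertex u} => exists_boundary_tri u.2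
  rw [← Nat.card_sum]
  refine Nat.card_le_card_of_injective
    (Sum.elim (fun u => ⟨s(u.1, f u), isEdge_iff.2 (Or.inl (hf u))⟩)
      (fun e => ⟨e.1, e.2.isEdge⟩)) ?_
  rintro (u | e) (u' | e') h
  · simp only [Sum.elim_inl, Subtype.mk.injEq] at h
    rcases Sym2.eq_iff.1 h with ⟨h, -⟩ | ⟨h₁, h₂⟩
    · rw [Subtype.ext h]
    · exact absurd (h₁ ▸ h₂ ▸ hf u) (hf' u')
  · simp only [Sum.elim_inl, Sum.elim_inr, Subtype.mk.injEq] at h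
    exact absurd (isInteriorEdge_iff.1 (h ▸ e'.2)).2 (hf' u)
  · simp only [Sum.elim_inl, Sum.elim_inr, Subtype.mk.injEq] at h
    exact absurd (isInteriorEdge_iff.1 (h ▸ e.2)).2 (hf' u')
  · simp only [Sum.elim_inr, Subtype.mk.injEq] at h
    rw [Subtype.ext h]

/-- The directed edges with a face on the left are counted twice: three for each face; one for each
edge and a further one for each interior edge. -/
theorem three_mul_faces_le :
    3 * {t : Set W | ∃ a b c, T.tri a b c ∧ t = {a, b, c}}.ncard
      ≤ Nat.card T.Edge + Nat.card T.InteriorEdge := by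
  let D := {p : W × W // ∃ c, T.tri p.1 p.2 c}
  let F := {t : Set W // ∃ a b c, T.tri a b c ∧ t = {a, b, c}}
  have h₁ : Nat.card F * 3 ≤ Nat.card D := by
    choose a b c h using fun t : F => t.2
    have ht : ∀ t t' : F, ∀ x y z, T.tri x y z → t.1 = {x, y, z} → ∀ z', T.tri x y z' →
        t'.1 = {x, y, z'} → t = t' := by
      intro t t' x y z hz e z' hz' e'
      rw [← T.unique _ _ _ _ hz hz'] at e'
      exact Subtype.ext (e.trans e'.symm)
    have hrot : ∀ x y z : W, ({x, y, z} : Set W) = {y, z, x} := by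
      intro x y z
      ext w
      simp only [Set.mem_insert_iff, Set.mem_singleton_iff]
      tauto
    rw [← Nat.card_fin 3, ← Nat.card_prod]
    let g : F → Fin 3 → D := fun t => ![⟨(a t, b t), c t, (h t).1⟩,
      ⟨(b t, c t), a t, T.rotate _ _ _ (h t).1⟩, ⟨(c t, a t), b t, rotate' (h t).1⟩]
    refine Nat.card_le_card_of_injective (fun p : F × Fin 3 => g p.1 p.2) ?_
    have key : ∀ t : F, ∀ i : Fin 3, ∃ z, T.tri (g t i).1.1 (g t i).1.2 z ∧
        t.1 = {(g t i).1.1, (g t i).1.2, z} := by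
      intro t i
      fin_cases i
      · exact ⟨c t, (h t).1, (h t).2⟩
      · exact ⟨a t, T.rotate _ _ _ (h t).1, (h t).2.trans (hrot _ _ _)⟩
      · exact ⟨b t, rotate' (h t).1, (h t).2.trans ((hrot _ _ _).trans (hrot _ _ _))⟩
    rintro ⟨t, i⟩ ⟨t', i'⟩ heq
    obtain ⟨z, hz, e⟩ := key t i
    obtain ⟨z', hz', e'⟩ := key t' i'
    simp only at heq
    rw [← heq] at hz' e'
    obtain rfl := ht t t' _ _ _ hz e _ hz' e'
    have n₁ := ne₁₂ (h t).1
    have n₂ := ne₂₃ (h t).1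
    have n₃ := ne₃₁ (h t).1
    congr 1
    have hg : ∀ i, (g t i).1.1 = ![a t, b t, c t] i := by
      intro i
      fin_cases i <;> rfl
    have h1 : ![a t, b t, c t] i = ![a t, b t, c t] i' := by rw [← hg, ← hg, heq]
    clear hz' e' hz e heq hg key ht
    fin_cases i <;> fin_cases i'
    exacts [rfl, absurd h1 n₁, absurd h1 n₃.symm, absurd h1 n₁.symm, rfl, absurd h1 n₂,
      absurd h1 n₃, absurd h1 n₂.symm, rfl]
  have h₂ : Nat.card D ≤ Nat.card T.Edge + Nat.card T.InteriorEdge := by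
    rw [← Nat.card_sum]
    choose a b c h using fun e : T.Edge => e.2
    have hr : ∀ e : T.InteriorEdge, ∃ d, T.tri (b ⟨e.1, e.2.isEdge⟩) (a ⟨e.1, e.2.isEdge⟩) d := by
      intro e
      have := e.2
      have h' := (h ⟨e.1, e.2.isEdge⟩).1
      simp only at h'
      rw [h', isInteriorEdge_iff] at this
      exact this.2
    refine Nat.card_le_card_of_surjective (Sum.elim (fun e => ⟨(a e, b e), c e, (h e).2⟩)
      (fun e => ⟨(b ⟨e.1, e.2.isEdge⟩, a ⟨e.1, e.2.isEdge⟩), hr e⟩) : T.Edge ⊕ T.InteriorEdge → D) ?_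
    rintro ⟨⟨x, y⟩, z, hz⟩
    simp only at hz
    have he := (h ⟨s(x, y), isEdge₁₂ hz⟩)
    rcases Sym2.eq_iff.1 he.1 with ⟨h₁, h₂⟩ | ⟨h₁, h₂⟩
    · exact ⟨Sum.inl ⟨s(x, y), isEdge₁₂ hz⟩, Subtype.ext (Prod.ext h₁.symm h₂.symm)⟩
    · have hi : T.IsInteriorEdge s(x, y) := by
        rw [isInteriorEdge_iff]
        refine ⟨⟨z, hz⟩, ⟨c ⟨s(x, y), isEdge₁₂ hz⟩, ?_⟩⟩
        have := he.2
        rwa [← h₁, ← h₂] at this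
      exact ⟨Sum.inr ⟨s(x, y), hi⟩, Subtype.ext (Prod.ext h₁.symm h₂.symm)⟩
  have h₃ : Nat.card F = {t : Set W | ∃ a b c, T.tri a b c ∧ t = {a, b, c}}.ncard := rfl
  omega

end Counting

end TriMesh

/-! ### The Euler characteristic and connectedness of the disk. -/

namespace TriangulatedDisk

variable {V : Type*} [Finite V] (G : TriangulatedDisk V)

theorem two_mul_card_edge_le :
    2 * Nat.card G.toTriMesh.Edge + 3 ≤ 3 * Nat.card V + Nat.card G.toTriMesh.InteriorEdge := by
  have h₁ := G.euler
  have h₂ := G.toTriMesh.three_mul_faces_le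
  have h₃ : Nat.card G.toTriMesh.Edge = {e : Sym2 V | G.toTriMesh.IsEdge e}.ncard := rfl
  omega

theorem exists_tri : ∃ u v w, G.tri u v w := by
  obtain ⟨e, ⟨a, b, c, -, h⟩, -⟩ := G.boundary
  exact ⟨a, b, c, h⟩

theorem eq_of_isEdge {X : Type*} (f : V → X) (hf : ∀ u v, G.IsEdge s(u, v) → f u = f v)
    (u v : V) :
    f u = f v := by
  induction G.connected u v with
  | refl => rfl
  | tail _ h ih => exact ih.trans (hf _ _ h)

/-- A function on the faces that takes the same value on adjacent faces is constant. -/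
theorem face_eq_of_adjacent {X : Type*} (F : V → V → V → X)
    (hrot : ∀ u v w, G.tri u v w → F u v w = F v w u)
    (hadj : ∀ u v s t, G.tri u v s → G.tri v u t → F u v s = F v u t)
    {u v w u' v' w' : V} (h : G.tri u v w) (h' : G.tri u' v' w') : F u v w = F u' v' w' := by
  have hstar : ∀ u, ∃ x, ∀ v w, G.tri u v w → F u v w = x := by
    intro u
    obtain ⟨l, -, -, hmem, hch⟩ := G.star u
    -- Consecutive faces in the star share an edge, so the value is passed along the chain. The last
    -- neighbour has a face on its left only if the star is a cycle; `apex` handles both cases of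
    -- the singleton.
    have key : ∀ l : List V, l.IsChain (G.tri u) →
        ∃ x, ∀ v ∈ l, ∀ w, G.tri u v w → F u v w = x := by
      intro l
      induction l with
      | nil => exact fun _ => ⟨F u u u, by simp⟩
      | cons a l ih =>
        cases l with
        | nil =>
          refine fun _ => ⟨F u a (G.apex u a), fun v hv w hw => ?_⟩
          obtain rfl := List.mem_singleton.1 hv
          rw [G.apex_eq hw]
        | cons b l =>
          intro hc
          rw [List.isChain_cons_cons] at hc
          obtain ⟨x, hx⟩ := ih hc.2
          by_cases hb : ∃ w, G.tri u b w
          · obtain ⟨w, hw⟩ := hb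
            refine ⟨x, fun v hv w' hw' => ?_⟩
            rcases List.mem_cons.1 hv with rfl | hv
            · obtain rfl := G.unique _ _ _ _ hc.1 hw'
              rw [← hx b (by simp) w hw, hadj u b w v hw (TriMesh.rotate' hc.1),
                hrot _ _ _ (TriMesh.rotate' hc.1)]
            · exact hx v hv w' hw'
          · refine ⟨F u a b, fun v hv w' hw' => ?_⟩
            rcases List.mem_cons.1 hv with rfl | hv
            · rw [G.unique _ _ _ _ hc.1 hw']
            · exfalso
              rcases List.mem_cons.1 hv with rfl | hv
              · exact hb ⟨_, hw'⟩
              · cases l with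
                | nil => simp at hv
                | cons d l => exact hb ⟨_, (List.isChain_cons_cons.1 hc.2).1⟩
    obtain ⟨x, hx⟩ := key l hch
    exact ⟨x, fun v w hw => hx v ((hmem v).2 (TriMesh.isEdge₁₂ hw)) w hw⟩
  choose x hx using hstar
  -- A face at both `u` and `v` identifies the common values at these vertices, and connectedness of
  -- the edge graph does the rest.
  have hx' : ∀ u v w, G.tri u v w → x u = x v := fun u v w ht => by
    rw [← hx u v w ht, hrot _ _ _ ht, hx v w u (G.rotate _ _ _ ht)]
  have hedge : ∀ u v, G.IsEdge s(u, v) → x u = x v := by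
    intro u v he
    rcases TriMesh.isEdge_iff.1 he with ⟨c, hc⟩ | ⟨c, hc⟩
    · exact hx' _ _ _ hc
    · exact (hx' _ _ _ hc).symm
  rw [hx _ _ _ h, hx _ _ _ h']
  exact G.eq_of_isEdge x hedge _ _

end TriangulatedDisk

/-! ### Euclidean geometry of tangent circles: half angles, incircles, inversions. -/

open Complex in
theorem cotAngle_eq_re_div_im (a c b : ℂ) :
    TriMesh.cotAngle a c b = ((b - c) / (a - c)).re / ((b - c) / (a - c)).im := by
  rw [TriMesh.cotAngle]
  generalize (b - c) / (a - c) = w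
  by_cases hw : w = 0
  · simp [hw, Real.cot_eq_cos_div_sin]
  · have : ‖w‖ ≠ 0 := norm_ne_zero_iff.2 hw
    rw [Real.cot_eq_cos_div_sin, Complex.cos_arg hw, Complex.sin_arg]
    field_simp

namespace CirclePacking

open Complex TriMesh

variable {V : Type*} {G : TriMesh V} (C : CirclePacking G)

/-- The unit vector from the centre of `u` towards the centre of `v`. -/
def dir (u v : V) : ℂ := (C.center v - C.center u) / (C.radius u + C.radius v)

theorem radius_ne (u : V) : C.radius u ≠ 0 := (C.radius_pos u).ne'

theorem radius_ne' (u : V) : (C.radius u : ℂ) ≠ 0 := by exact_mod_cast C.radius_ne u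

theorem radius_add_ne (u v : V) : (C.radius u + C.radius v : ℂ) ≠ 0 := by
  exact_mod_cast (add_pos (C.radius_pos u) (C.radius_pos v)).ne'

theorem center_sub (u v : V) :
    C.center v - C.center u = (C.radius u + C.radius v) * C.dir u v := by
  rw [dir, mul_div_cancel₀ _ (C.radius_add_ne u v)]

theorem dir_swap (u v : V) : C.dir v u = -C.dir u v := by
  rw [dir, dir, add_comm, ← neg_div, neg_sub]

theorem pt_eq (u v : V) : C.pt s(u, v) = C.center u + C.radius u * C.dir u v := by
  have h := C.radius_add_ne u v
  rw [pt, tangencyPoint, Sym2.lift_mk, dir]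
  field_simp
  ring

theorem pt_sub (u v w : V) :
    C.pt s(u, w) - C.pt s(u, v) = C.radius u * (C.dir u w - C.dir u v) := by
  rw [pt_eq, pt_eq]
  ring

variable {u v w s t : V}

theorem norm_dir (h : G.IsEdge s(u, v)) : ‖C.dir u v‖ = 1 := by
  have h₁ := C.tangent u v h
  have h₂ := add_pos (C.radius_pos u) (C.radius_pos v)
  rw [dir, norm_div, ← dist_eq_norm, dist_comm, h₁, ← ofReal_add, norm_real, Real.norm_eq_abs,
    abs_of_pos h₂, div_self h₂.ne']

theorem dir_ne_zero (h : G.IsEdge s(u, v)) : C.dir u v ≠ 0 := by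
  rw [← norm_ne_zero_iff, C.norm_dir h]
  exact one_ne_zero

theorem dir_mul_conj (h : G.IsEdge s(u, v)) : C.dir u v * conj (C.dir u v) = 1 := by
  rw [mul_conj, normSq_eq_norm_sq, C.norm_dir h]
  norm_num

theorem conj_dir (h : G.IsEdge s(u, v)) : conj (C.dir u v) = (C.dir u v)⁻¹ :=
  eq_inv_of_mul_eq_one_right (C.dir_mul_conj h)

theorem dir_sub_ne (h : G.IsEdge s(u, v)) (h' : G.IsEdge s(u, w)) (hne : v ≠ w) :
    C.dir u w - C.dir u v ≠ 0 := by
  have h₁ := C.tangency_ne u v w h h' hne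
  intro h₂
  exact h₁ (sub_eq_zero.1 (by rw [← pt, ← pt, pt_sub, ← neg_sub, h₂, neg_zero, mul_zero]))

theorem pt_sub_ne (h : G.IsEdge s(u, v)) (h' : G.IsEdge s(u, w)) (hne : v ≠ w) :
    C.pt s(u, w) - C.pt s(u, v) ≠ 0 := by
  rw [pt_sub]
  exact mul_ne_zero (C.radius_ne' u) (C.dir_sub_ne h h' hne)

/-- The cotangent of half the angle at the centre of `u` from the direction of `v` to that
of `w`. -/
def halfCot (u v w : V) : ℝ := (I * (C.dir u w + C.dir u v) / (C.dir u w - C.dir u v)).re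

theorem halfCot_swap (u v w : V) : C.halfCot u w v = -C.halfCot u v w := by
  rw [halfCot, halfCot, ← neg_re, ← neg_sub (C.dir u w), div_neg, add_comm]

/-- The expression is real: conjugation inverts unit vectors, and this leaves it unchanged. -/
theorem halfCot_eq (h : G.IsEdge s(u, v)) (h' : G.IsEdge s(u, w)) :
    (C.halfCot u v w : ℂ) = I * (C.dir u w + C.dir u v) / (C.dir u w - C.dir u v) := by
  rw [halfCot, ← conj_eq_iff_re]
  simp only [map_div₀, map_mul, map_sub, map_add, conj_I, C.conj_dir h, C.conj_dir h']
  have h₁ := C.dir_ne_zero h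
  have h₂ := C.dir_ne_zero h'
  have h₃ : (C.dir u w)⁻¹ - (C.dir u v)⁻¹ = -(C.dir u w - C.dir u v) / (C.dir u w * C.dir u v) := by
    field_simp
    ring
  rw [h₃]
  by_cases h₄ : C.dir u w - C.dir u v = 0
  · simp [h₄]
  · field_simp
    ring

theorem dir_div_sub (h : G.IsEdge s(u, v)) (h' : G.IsEdge s(u, w)) (hne : v ≠ w) :
    C.dir u v / (C.dir u w - C.dir u v) = (-1 - I * C.halfCot u v w) / 2 := by
  have := C.dir_sub_ne h h' hne
  rw [C.halfCot_eq h h']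
  field_simp
  ring_nf
  rw [I_sq]
  ring

/-- Inversion at `z_uv` turns the circle of `u` into a line, so in the frame of the edge the real
part `-1/(2R_u)` is the same for all `w`. The later separations into real and imaginary parts rest
on this. -/
theorem inv_pt_sub (h : G.IsEdge s(u, v)) (h' : G.IsEdge s(u, w)) (hne : v ≠ w) :
    (C.pt s(u, w) - C.pt s(u, v))⁻¹ =
      conj (C.dir u v) * ((-1 - I * C.halfCot u v w) / (2 * C.radius u)) := by
  have h₁ := C.dir_sub_ne h h' hne
  have h₂ := C.dir_ne_zero h
  have h₃ := C.radius_ne' u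
  have h₄ := C.dir_div_sub h h' hne
  rw [pt_sub, conj_dir _ h]
  rw [div_eq_iff h₁] at h₄
  field_simp
  linear_combination 2 * h₄

/-- The inscribed angle theorem. As the cotangent has period `π`, the arc on which the apex lies
does not matter. -/
theorem halfCot_eq_cotAngle (h : G.IsEdge s(u, v)) (h' : G.IsEdge s(u, w)) (h'' : G.IsEdge s(u, s))
    (hvw : v ≠ w) (hvs : v ≠ s) (hws : w ≠ s) :
    cotAngle (C.pt s(u, v)) (C.pt s(u, s)) (C.pt s(u, w)) = C.halfCot u v w := by
  rw [cotAngle_eq_re_div_im]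
  set x := (C.pt s(u, w) - C.pt s(u, s)) / (C.pt s(u, v) - C.pt s(u, s)) with hx
  have h₁ := C.dir_ne_zero h
  have h₂ := C.dir_ne_zero h'
  have h₃ := C.dir_ne_zero h''
  have h₄ := C.dir_sub_ne h h' hvw
  have h₅ := C.dir_sub_ne h'' h hvs.symm
  have h₆ := C.dir_sub_ne h'' h' hws.symm
  have hx' : x = (C.dir u w - C.dir u s) / (C.dir u v - C.dir u s) := by
    rw [hx, pt_sub, pt_sub, mul_div_mul_left _ _ (C.radius_ne' u)]
  -- The factor between `x` and its conjugate is free of the apex `s`, hence so is the quotient of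
  -- the real and imaginary parts.
  have hc : conj x = x * (C.dir u v / C.dir u w) := by
    rw [hx']
    simp only [map_div₀, map_sub, C.conj_dir h, C.conj_dir h', C.conj_dir h'']
    have : (C.dir u v)⁻¹ - (C.dir u s)⁻¹ = -(C.dir u v - C.dir u s) / (C.dir u v * C.dir u s) := by
      field_simp
      ring
    rw [this]
    field_simp
    ring
  have hx0 : x ≠ 0 := by
    rw [hx']
    exact div_ne_zero h₆ h₅
  have hre : (x.re : ℂ) = x * (1 + C.dir u v / C.dir u w) / 2 := by
    rw [re_eq_add_conj, hc]
    ring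
  have him : (x.im : ℂ) = x * (1 - C.dir u v / C.dir u w) / (2 * I) := by
    rw [im_eq_sub_conj, hc]
    ring
  have h₇ : 1 - C.dir u v / C.dir u w ≠ 0 := by
    have : 1 - C.dir u v / C.dir u w = (C.dir u w - C.dir u v) / C.dir u w := by field_simp
    rw [this]
    exact div_ne_zero h₄ h₂
  apply ofReal_injective
  rw [ofReal_div, hre, him, C.halfCot_eq h h']
  field_simp

/-- The radius of the incircle of the triangle of the centres of three mutually tangent circles. -/
def inradius (u v w : V) : ℝ :=
  √(C.radius u * C.radius v * C.radius w / (C.radius u + C.radius v + C.radius w))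

theorem inradius_rotate (u v w : V) : C.inradius v w u = C.inradius u v w := by
  rw [inradius, inradius]
  congr 1
  ring

theorem inradius_pos (u v w : V) : 0 < C.inradius u v w := by
  have h₁ := C.radius_pos u
  have h₂ := C.radius_pos v
  have h₃ := C.radius_pos w
  exact Real.sqrt_pos.2 (by positivity)

theorem inradius_sq (u v w : V) :
    C.inradius u v w ^ 2 * (C.radius u + C.radius v + C.radius w) =
      C.radius u * C.radius v * C.radius w := by
  have h₁ := C.radius_pos u
  have h₂ := C.radius_pos v
  have h₃ := C.radius_pos w
  rw [inradius, Real.sq_sqrt (by positivity)]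
  field_simp

theorem radius_sub_inradius_ne (u v w x : V) :
    (C.radius x : ℂ) - C.inradius u v w * I ≠ 0 := by
  intro h
  have := congrArg re h
  simp at this
  exact C.radius_ne x this

theorem radius_add_inradius_ne (u v w x : V) :
    (C.radius x : ℂ) + C.inradius u v w * I ≠ 0 := by
  intro h
  have := congrArg re h
  simp at this
  exact C.radius_ne x this

/-- The incircle touches the sides at `u` at distance `R_u` from the centre of `u`, so half the
angle there is the argument of `R_u + i r`. The law of cosines gives the real part of the rotation,
its modulus the square of the imaginary part, and the orientation the sign. -/
theorem dir_of_tri (h : G.tri u v w) :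
    C.dir u w = C.dir u v * ((C.radius u + C.inradius u v w * I) /
      (C.radius u - C.inradius u v w * I)) := by
  have e₁ := isEdge₁₂ h
  have e₂ := (isEdge₃₁ h).symm
  have e₃ := isEdge₂₃ h
  have hne := C.radius_sub_inradius_ne u v w u
  have p₁ := C.radius_pos u
  have p₂ := C.radius_pos v
  have p₃ := C.radius_pos w
  have pr := C.inradius_pos u v w
  have hr := C.inradius_sq u v w
  set r := C.inradius u v w
  set y := C.dir u w / C.dir u v with hy
  have hd : C.dir u w = C.dir u v * y := by rw [hy, mul_div_cancel₀ _ (C.dir_ne_zero e₁)]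
  have hn : y.re ^ 2 + y.im ^ 2 = 1 := by
    have : ‖y‖ ^ 2 = 1 := by rw [hy, norm_div, C.norm_dir e₁, C.norm_dir e₂]; norm_num
    rw [← normSq_eq_norm_sq, normSq_apply] at this
    linarith
  have him : 0 < y.im := by
    have ho := C.oriented u v w h
    rw [C.center_sub u w, C.center_sub u v, hd] at ho
    have : (↑(C.radius u) + ↑(C.radius w)) * (C.dir u v * y) /
        ((↑(C.radius u) + ↑(C.radius v)) * C.dir u v) =
        (((C.radius u + C.radius w) / (C.radius u + C.radius v) : ℝ) : ℂ) * y := by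
      have := C.dir_ne_zero e₁
      have := C.radius_add_ne u v
      push_cast
      field_simp
    rw [this, im_ofReal_mul] at ho
    exact pos_of_mul_pos_right ho (by positivity)
  have hcos : y.re * (2 * (C.radius u + C.radius v) * (C.radius u + C.radius w)) =
      (C.radius u + C.radius v) ^ 2 + (C.radius u + C.radius w) ^ 2
        - (C.radius v + C.radius w) ^ 2 := by
    have ht := C.tangent v w e₃
    have hs : C.center v - C.center w = C.dir u v *
        ((C.radius u + C.radius v) - (C.radius u + C.radius w) * y) := by
      have a := C.center_sub u v
      have b := C.center_sub u w
      rw [hd] at b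
      linear_combination a - b
    rw [dist_eq_norm, hs, norm_mul, C.norm_dir e₁, one_mul] at ht
    have := congrArg (· ^ 2) ht
    simp only [← normSq_eq_norm_sq, normSq_apply] at this
    simp at this
    linear_combination (-1 : ℝ) * this + (C.radius u + C.radius w) ^ 2 * hn
  have hre : y.re * (C.radius u ^ 2 + r ^ 2) = C.radius u ^ 2 - r ^ 2 := by
    have hN : C.radius u + C.radius v + C.radius w ≠ 0 := by positivity
    refine mul_right_cancel₀ hN ?_
    linear_combination (y.re + 1) * hr + C.radius u / 2 * hcos
  have him' : y.im * (C.radius u ^ 2 + r ^ 2) = 2 * C.radius u * r := by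
    refine (pow_left_inj₀ (by positivity) (by positivity) two_ne_zero).1 ?_
    linear_combination (C.radius u ^ 2 + r ^ 2) ^ 2 * hn
      - (y.re * (C.radius u ^ 2 + r ^ 2) + (C.radius u ^ 2 - r ^ 2)) * hre
  have hM : C.radius u ^ 2 + r ^ 2 ≠ 0 := by positivity
  rw [hd, eq_div_of_mul_eq hne (_ : y * _ = C.radius u + r * I)]
  apply Complex.ext
  · simp
    refine mul_right_cancel₀ hM ?_
    linear_combination C.radius u * hre + r * him'
  · simp
    refine mul_right_cancel₀ hM ?_
    linear_combination C.radius u * him' - r * hre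

theorem halfCot_of_tri (h : G.tri u v w) : C.halfCot u v w = C.radius u / C.inradius u v w := by
  apply ofReal_injective
  have h₁ := C.dir_ne_zero (isEdge₁₂ h)
  have h₂ := C.dir_sub_ne (isEdge₁₂ h) (isEdge₃₁ h).symm (ne₂₃ h)
  have h₃ := C.radius_sub_inradius_ne u v w u
  have h₄ : (C.inradius u v w : ℂ) ≠ 0 := by exact_mod_cast (C.inradius_pos u v w).ne'
  have h₅ := C.dir_of_tri h
  set E := ((C.radius u : ℂ) + C.inradius u v w * I) / (C.radius u - C.inradius u v w * I) with hE
  have h₆ : E * (C.radius u - C.inradius u v w * I) = C.radius u + C.inradius u v w * I :=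
    div_mul_cancel₀ _ h₃
  rw [C.halfCot_eq (isEdge₁₂ h) (isEdge₃₁ h).symm, ofReal_div, div_eq_div_iff h₂ h₄, h₅]
  linear_combination -C.dir u v * h₆

/-- The inverse of the vector between two points of tangency in a face. -/
theorem inv_pt_sub_of_tri (h : G.tri u v w) :
    (C.pt s(u, w) - C.pt s(u, v))⁻¹ = conj (C.dir u v) *
      (-(1 / (2 * C.radius u)) - I / (2 * C.inradius u v w)) := by
  have h₄ : (C.inradius u v w : ℂ) ≠ 0 := by exact_mod_cast (C.inradius_pos u v w).ne'
  have := C.radius_ne' u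
  rw [C.inv_pt_sub (isEdge₁₂ h) (isEdge₃₁ h).symm (ne₂₃ h), C.halfCot_of_tri h, ofReal_div]
  congr 1
  field_simp

/-- The imaginary part agrees with that in `inv_pt_sub_of_tri`: inversion at `z_uv` makes the
circles of `u` and `v` parallel lines and the incircle, which is orthogonal to both, a line
perpendicular to them. -/
theorem inv_pt_sub_of_tri' (h : G.tri u v w) :
    (C.pt s(v, w) - C.pt s(u, v))⁻¹ = conj (C.dir u v) *
      (1 / (2 * C.radius v) - I / (2 * C.inradius u v w)) := by
  have h₄ : (C.inradius u v w : ℂ) ≠ 0 := by exact_mod_cast (C.inradius_pos u v w).ne'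
  have := C.radius_ne' v
  have h' := G.rotate _ _ _ h
  rw [Sym2.eq_swap (a := u), C.inv_pt_sub (isEdge₁₂ h).symm (isEdge₂₃ h) (ne₃₁ h).symm,
    halfCot_swap, C.halfCot_of_tri h', inradius_rotate, ofReal_neg, ofReal_div, dir_swap C u v,
    map_neg, neg_mul, ← mul_neg]
  congr 1
  field_simp
  ring

/-- Up to a rotation by a right angle and by the direction of the edge, `ω` is the inverse of the
sum of the inverse diameters of the two adjacent incircles. -/
theorem inv_omega (h : G.tri u v s) (h' : G.tri v u t) :
    (C.omega u v)⁻¹ = -I * conj (C.dir u v) *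
      ((1 / (2 * C.inradius u v s) + 1 / (2 * C.inradius v u t) : ℝ) : ℂ) := by
  have h₁ := C.pt_sub_ne (isEdge₁₂ h) (isEdge₃₁ h).symm (ne₂₃ h)
  have h₂ := C.pt_sub_ne (isEdge₁₂ h) (isEdge₂₃ h') (ne₃₁ h').symm
  have h₃ := C.inv_pt_sub_of_tri h
  have h₄ := C.inv_pt_sub_of_tri' h'
  rw [dir_swap C u v, Sym2.eq_swap (a := v), map_neg] at h₄
  -- Partial fractions. Both points lie on the circle of `u`, so the real parts of the two inverses
  -- cancel in the frame of the edge.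
  have : (C.omega u v)⁻¹ = (C.pt s(u, s) - C.pt s(u, v))⁻¹ - (C.pt s(u, t) - C.pt s(u, v))⁻¹ := by
    rw [omega, G.apex_eq h, G.apex_eq h', Sym2.eq_swap (a := s)]
    field_simp
    ring
  rw [this, h₃, h₄]
  push_cast
  ring

theorem omega_ne_zero (h : G.tri u v s) (h' : G.tri v u t) : C.omega u v ≠ 0 := by
  have h₁ := C.inradius_pos u v s
  have h₂ := C.inradius_pos v u t
  have h₃ := C.dir_ne_zero (isEdge₁₂ h)
  intro h₀
  have h₄ := C.inv_omega h h'
  rw [h₀, inv_zero] at h₄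
  refine absurd h₄.symm ?_
  refine mul_ne_zero (mul_ne_zero (neg_ne_zero.2 I_ne_zero) ((map_ne_zero _).2 h₃)) ?_
  exact_mod_cast (by positivity : 1 / (2 * C.inradius u v s) + 1 / (2 * C.inradius v u t) ≠ 0)

theorem omega_swap (h : G.tri u v s) (h' : G.tri v u t) : C.omega v u = -C.omega u v := by
  rw [← inv_inj, inv_neg, C.inv_omega h h', C.inv_omega h' h, dir_swap C u v, map_neg]
  push_cast
  ring

/-- The medial triangle is inscribed in the incircle, and its angle at `z_vw` is complementary to
half the angle at the centre of `u`. The computation inverts at `z_uv`. -/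
theorem cotAngle_medial (h : G.tri u v w) :
    cotAngle (C.pt s(w, u)) (C.pt s(v, w)) (C.pt s(u, v)) =
      C.inradius u v w / C.radius u := by
  have h₁ := C.inv_pt_sub_of_tri h
  have h₂ := C.inv_pt_sub_of_tri' h
  have hr : (C.inradius u v w : ℂ) ≠ 0 := by exact_mod_cast (C.inradius_pos u v w).ne'
  have hu := C.radius_ne' u
  have hv := C.radius_ne' v
  have huv := C.radius_add_ne u v
  have n₁ := C.pt_sub_ne (isEdge₁₂ h) (isEdge₃₁ h).symm (ne₂₃ h)
  have n₂ := C.pt_sub_ne (isEdge₁₂ h).symm (isEdge₂₃ h) (ne₃₁ h).symm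
  have n₃ := C.pt_sub_ne (isEdge₂₃ h).symm (isEdge₃₁ h) (ne₁₂ h).symm
  rw [Sym2.eq_swap (a := v) (b := u)] at n₂
  rw [Sym2.eq_swap (a := w) (b := v)] at n₃
  rw [Sym2.eq_swap (a := u) (b := w)] at n₁ h₁
  have hd := (map_ne_zero (starRingEnd ℂ)).2 (C.dir_ne_zero (isEdge₁₂ h))
  have key : (C.pt s(u, v) - C.pt s(v, w)) / (C.pt s(w, u) - C.pt s(v, w)) =
      (C.pt s(w, u) - C.pt s(u, v))⁻¹ /
        ((C.pt s(w, u) - C.pt s(u, v))⁻¹ - (C.pt s(v, w) - C.pt s(u, v))⁻¹) := by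
    rw [inv_sub_inv n₁ n₂]
    have : C.pt s(v, w) - C.pt s(u, v) - (C.pt s(w, u) - C.pt s(u, v)) =
      -(C.pt s(w, u) - C.pt s(v, w)) := by ring
    rw [this]
    field_simp
    ring
  have key' : (C.pt s(u, v) - C.pt s(v, w)) / (C.pt s(w, u) - C.pt s(v, w)) =
      ((C.radius v / (C.radius u + C.radius v) : ℝ) : ℂ) +
      ((C.radius u * C.radius v / (C.inradius u v w * (C.radius u + C.radius v)) : ℝ) : ℂ) * I := by
    rw [key, h₁, h₂, ← mul_sub, mul_div_mul_left _ _ hd]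
    have : -(1 / (2 * (C.radius u : ℂ))) - I / (2 * C.inradius u v w) -
        (1 / (2 * C.radius v) - I / (2 * C.inradius u v w)) =
        -(C.radius u + C.radius v) / (2 * C.radius u * C.radius v) := by
      field_simp
      ring
    rw [this]
    push_cast
    field_simp
    ring
  have pu := C.radius_pos u
  have pv := C.radius_pos v
  have pr := C.inradius_pos u v w
  rw [cotAngle_eq_re_div_im, key', ← mk_eq_add_mul_I]
  field_simp

end CirclePacking

/-! ### Infinitesimal deformations: rotation of edges and growth of circles. -/

namespace CirclePacking

open Complex TriMesh

variable {V : Type*} {G : TriMesh V} (C : CirclePacking G) (δ : C.deformations)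
variable {u v w s t : V}

/-- Half the angular velocity of the vector from the centre of `u` to that of `v`. -/
def spin (u v : V) : ℝ := ((δ.1.1 v - δ.1.1 u) / (C.center v - C.center u)).im / 2

theorem spin_swap (u v : V) : C.spin δ v u = C.spin δ u v := by
  rw [spin, spin, ← neg_sub (δ.1.1 v), ← neg_sub (C.center v), neg_div_neg_eq]

/-- The relative rate of change of a radius. -/
def growth (u : V) : ℝ := δ.1.2 u / C.radius u

/-- In the frame of the edge, the real part of the relative velocity is prescribed by tangency and
the imaginary part is the rotation. -/
theorem center_velocity_sub (h : G.IsEdge s(u, v)) :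
    δ.1.1 v - δ.1.1 u = (δ.1.2 u + δ.1.2 v + 2 * C.spin δ u v * (C.radius u + C.radius v) * I) *
      C.dir u v := by
  have hd := C.dir_ne_zero h
  have hl : C.radius u + C.radius v ≠ 0 := (add_pos (C.radius_pos u) (C.radius_pos v)).ne'
  have hl' := C.radius_add_ne u v
  set y := (δ.1.1 v - δ.1.1 u) / C.dir u v with hy
  have h₁ : δ.1.1 v - δ.1.1 u = y * C.dir u v := (div_mul_cancel₀ _ hd).symm
  have hre : y.re = δ.1.2 u + δ.1.2 v := by
    have h₂ := δ.2 u v h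
    rw [h₁, C.center_sub, map_mul, ← ofReal_add, conj_ofReal] at h₂
    have h₃ : y * C.dir u v * (((C.radius u + C.radius v : ℝ) : ℂ) * conj (C.dir u v)) =
        ((C.radius u + C.radius v : ℝ) : ℂ) * y := by
      linear_combination y * ((C.radius u + C.radius v : ℝ) : ℂ) * C.dir_mul_conj h
    rw [h₃, re_ofReal_mul] at h₂
    exact mul_left_cancel₀ hl (h₂.trans (mul_comm _ _))
  have him : y.im = 2 * C.spin δ u v * (C.radius u + C.radius v) := by
    rw [spin, h₁, C.center_sub, mul_div_mul_right _ _ hd, ← ofReal_add, div_ofReal_im]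
    field_simp
  rw [h₁]
  congr 1
  rw [← re_add_im y, hre, him]
  push_cast
  ring

theorem dpt_eq (h : G.IsEdge s(u, v)) :
    C.dpt δ s(u, v) = δ.1.1 u + (δ.1.2 u + 2 * C.spin δ u v * C.radius u * I) * C.dir u v := by
  have h₁ := C.center_velocity_sub δ h
  have h₂ := C.center_sub u v
  have hl := C.radius_add_ne u v
  rw [sub_eq_iff_eq_add] at h₁ h₂
  simp only [dpt, tangencyVelocity, Sym2.lift_mk]
  rw [h₁, h₂]
  field_simp
  ring

/-- The difference quotient of the velocities along the segment between two points of tangency. -/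
def quot (e f : Sym2 V) : ℂ := (C.dpt δ e - C.dpt δ f) / (C.pt e - C.pt f)

theorem quot_swap (e f : Sym2 V) : C.quot δ e f = C.quot δ f e := by
  rw [quot, quot, ← neg_sub (C.dpt δ f), ← neg_sub (C.pt f), neg_div_neg_eq]

/-- The imaginary part is the sum of the vertex rotations at the two tangency points; the factor
`1/2` in `spin` is chosen for this. -/
theorem quot_eq (h : G.IsEdge s(u, v)) (h' : G.IsEdge s(u, w)) (hne : v ≠ w) :
    C.quot δ s(u, w) s(u, v) =
      ((C.growth δ u + C.halfCot u v w * (C.spin δ u w - C.spin δ u v) : ℝ) : ℂ) +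
        ((C.spin δ u v + C.spin δ u w : ℝ) : ℂ) * I := by
  have h₁ := C.dir_sub_ne h h' hne
  have hr := C.radius_ne' u
  have hk := C.halfCot_eq h h'
  rw [eq_div_iff h₁] at hk
  rw [quot, pt_sub, div_eq_iff (mul_ne_zero hr h₁), C.dpt_eq δ h, C.dpt_eq δ h', growth]
  push_cast
  have h₂ : (δ.1.2 u : ℂ) / C.radius u * C.radius u = δ.1.2 u := div_mul_cancel₀ _ hr
  linear_combination (C.radius u * (C.spin δ u v - C.spin δ u w) : ℂ) * hk
    - (C.dir u w - C.dir u v) * h₂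

theorem quot_im {e f : Sym2 V} (he : G.IsEdge e) (hf : G.IsEdge f) (hue : u ∈ e) (huf : u ∈ f)
    (hne : e ≠ f) :
    (C.quot δ e f).im = Sym2.lift ⟨C.spin δ, fun a b => C.spin_swap δ b a⟩ e
      + Sym2.lift ⟨C.spin δ, fun a b => C.spin_swap δ b a⟩ f := by
  obtain ⟨v, rfl⟩ := Sym2.mem_iff_exists.1 hue
  obtain ⟨w, rfl⟩ := Sym2.mem_iff_exists.1 huf
  have hvw : w ≠ v := by rintro rfl; exact hne rfl
  rw [C.quot_eq δ hf he hvw, Sym2.lift_mk, Sym2.lift_mk]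
  simp
  ring

/-- The difference of the growth rates of two circles of a face in terms of the rotations. -/
theorem growth_sub (h : G.tri u v w) :
    C.growth δ v - C.growth δ u =
      (C.spin δ w u - C.spin δ u v) *
        (C.radius u / C.inradius u v w + C.inradius u v w / C.radius u) +
      (C.spin δ v w - C.spin δ u v) *
        (C.radius v / C.inradius u v w + C.inradius u v w / C.radius v) := by
  have h₁ := C.center_velocity_sub δ (isEdge₁₂ h)
  have h₂ := C.center_velocity_sub δ (isEdge₂₃ h)
  have h₃ := C.center_velocity_sub δ (isEdge₃₁ h).symm
  have d₁ := C.dir_of_tri h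
  have d₂ := C.dir_of_tri (G.rotate _ _ _ h)
  rw [dir_swap C u v, inradius_rotate] at d₂
  have hp := C.radius_sub_inradius_ne u v w u
  have hq := C.radius_add_inradius_ne u v w v
  have hq' := C.radius_sub_inradius_ne u v w v
  have hd := C.dir_ne_zero (isEdge₁₂ h)
  have d₂' : C.dir v w = -(C.dir u v * ((C.radius v - C.inradius u v w * I) /
      (C.radius v + C.inradius u v w * I))) := by
    have := C.dir_ne_zero (isEdge₂₃ h)
    field_simp at d₂ ⊢
    linear_combination -d₂
  rw [d₁] at h₃
  rw [d₂'] at h₂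
  rw [spin_swap C δ u w]
  have hr := C.inradius_sq u v w
  have pr := (C.inradius_pos u v w).ne'
  have pu := C.radius_ne u
  have pv := C.radius_ne v
  rw [growth, growth]
  generalize C.inradius u v w = r at *
  generalize C.radius u = p at *
  generalize C.radius v = q at *
  generalize C.radius w = m at *
  generalize C.spin δ u v = x at *
  generalize C.spin δ v w = y at *
  generalize C.spin δ u w = z at *
  generalize C.dir u v = e at *
  generalize δ.1.2 u = p' at *
  generalize δ.1.2 v = q' at *
  generalize δ.1.2 w = m' at *
  -- The relative velocities of the centres add up to zero around the triangle; this is that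
  -- equation with all directions expressed through `e` and denominators cleared.
  have key : ((p' + m' + 2 * z * (p + m) * I) * ((p + r * I) * (q + r * I)) : ℂ) =
      (p' + q' + 2 * x * (p + q) * I) * ((p - r * I) * (q + r * I)) -
      (q' + m' + 2 * y * (q + m) * I) * ((q - r * I) * (p - r * I)) := by
    have h₄ := h₃.symm.trans ((sub_add_sub_cancel' _ _ _).symm.trans (congrArg₂ (· + ·) h₁ h₂))
    have hE : ((p + r * I) / (p - r * I) : ℂ) * (p - r * I) = p + r * I := div_mul_cancel₀ _ hp
    have hF : ((q - r * I) / (q + r * I) : ℂ) * (q + r * I) = q - r * I := div_mul_cancel₀ _ hq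
    refine mul_left_cancel₀ hd ?_
    linear_combination ((p - r * I) * (q + r * I) : ℂ) * h₄
      - e * (p' + m' + 2 * z * (p + m) * I) * (q + r * I) * hE
      - e * (q' + m' + 2 * y * (q + m) * I) * (p - r * I) * hF
  -- The factors of `m'` on the two sides combine to a sum of conjugates, so the rate of the third
  -- radius drops out of the imaginary part; `hr` then removes the third radius itself.
  have him := congrArg im key
  simp at him
  have hfin : r * (p * q' - q * p') =
      (z - x) * q * (p ^ 2 + r ^ 2) + (y - x) * p * (q ^ 2 + r ^ 2) := by
    linear_combination (-1 / 2 : ℝ) * him - (z + y) * hr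
  field_simp
  linear_combination hfin

/-- The derivative at the point of tangency of `u` and `v` of the quadratic vector field that
induces the given velocities at the points of tangency of a face at this edge. -/
def fieldDeriv (u v : V) : ℂ :=
  ((C.growth δ u * C.radius v + C.growth δ v * C.radius u) / (C.radius u + C.radius v) : ℝ) +
    (2 * C.spin δ u v : ℝ) * I

theorem fieldDeriv_swap (u v : V) : C.fieldDeriv δ v u = C.fieldDeriv δ u v := by
  rw [fieldDeriv, fieldDeriv, spin_swap C δ u v, add_comm (C.radius u), add_comm (_ * C.radius u)]

/-- The left side is the derivative at `z_uv` of the quadratic field through the three velocities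
(compare `newton_interpolation`). `growth_sub` eliminates everything that depends on `w`, so the
fields of the two faces at an edge agree there to first order. -/
theorem fieldDeriv_eq (h : G.tri u v w) :
    C.quot δ s(w, u) s(u, v) + C.quot δ s(v, w) s(u, v) - C.quot δ s(v, w) s(w, u) =
      C.fieldDeriv δ u v := by
  have h₁ := C.quot_eq δ (isEdge₁₂ h) (isEdge₃₁ h).symm (ne₂₃ h)
  have h₂ := C.quot_eq δ (isEdge₁₂ h).symm (isEdge₂₃ h) (ne₃₁ h).symm
  have h₃ := C.quot_eq δ (isEdge₃₁ h) (isEdge₂₃ h).symm (ne₁₂ h)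
  rw [Sym2.eq_swap (a := w) (b := v)] at h₃
  rw [Sym2.eq_swap (a := u) (b := w)] at h₁
  rw [Sym2.eq_swap (a := v) (b := u)] at h₂
  have hr' := G.rotate _ _ _ h
  rw [h₁, h₂, h₃, fieldDeriv, halfCot_swap C v w u, C.halfCot_of_tri h, C.halfCot_of_tri hr',
    C.halfCot_of_tri (G.rotate _ _ _ hr'), C.inradius_rotate v w u,
    C.inradius_rotate u v w, C.spin_swap δ u v, C.spin_swap δ w u, C.spin_swap δ v w]
  have g₁ := C.growth_sub δ h
  have g₂ := C.growth_sub δ (rotate' h)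
  rw [C.inradius_rotate v w u, C.inradius_rotate u v w] at g₂
  have hr := C.inradius_sq u v w
  have pr := (C.inradius_pos u v w).ne'
  have pu := C.radius_pos u
  have pv := C.radius_pos v
  have pw := C.radius_pos w
  simp only [← mk_eq_add_mul_I]
  apply Complex.ext
  · simp only [add_re, sub_re]
    rw [sub_eq_iff_eq_add] at g₁
    rw [sub_eq_iff_eq_add', ← sub_eq_iff_eq_add] at g₂
    rw [g₁, ← g₂]
    field_simp
    linear_combination (C.spin δ v w - C.spin δ w u) * C.radius u * C.radius v * hr
  · simp only [add_im, sub_im]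
    ring

end CirclePacking

/-! ### Summation around an interior vertex. -/

namespace TriMesh

variable {W : Type*} [Fintype W] {T : TriMesh W}

open Classical in
/-- A sum over the neighbours of an interior vertex, each term of which splits into contributions
of the faces on both sides, is a sum over the faces at this vertex. -/
theorem IsInteriorVertex.sum_eq_sum_faces {M : Type*} [AddCommMonoid M] {u : W}
    (hu : T.IsInteriorVertex u) (f : W → M) (P N : W → W → M)
    (h : ∀ v s t, T.tri u v s → T.tri v u t → f v = P v s + N t v)
    (h₀ : ∀ v, ¬ T.IsEdge s(u, v) → f v = 0) :
    ∑ v, f v = ∑ v, ∑ w, if T.tri u v w then P v w + N v w else 0 := by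
  -- `P` belongs to the face on the left of `uv` and `N` to the face on the right. After exchanging
  -- sums, the face `u v w` receives `P v w` from `uv` and `N v w` from `uw`.
  have key : ∀ v, f v = (∑ w, if T.tri u v w then P v w else 0) +
      ∑ w, if T.tri u w v then N w v else 0 := by
    intro v
    by_cases hv : T.IsEdge s(u, v)
    · obtain ⟨s, hs⟩ := hu.tri_left hv
      obtain ⟨t, ht⟩ := hu.tri_right hv
      rw [h v s t hs ht, Finset.sum_eq_single s, Finset.sum_eq_single t, if_pos hs,
        if_pos (rotate' (rotate' ht))]
      · intro w _ hw
        exact if_neg fun hw' => hw (T.unique _ _ _ _ (rotate' hw') ht)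
      · simp
      · intro w _ hw
        exact if_neg fun hw' => hw (T.unique _ _ _ _ hw' hs)
      · simp
    · rw [h₀ v hv, Finset.sum_eq_zero, Finset.sum_eq_zero, add_zero]
      · exact fun w _ => if_neg fun hw => hv (isEdge₃₁ hw).symm
      · exact fun w _ => if_neg fun hw => hv (isEdge₁₂ hw)
  simp_rw [key]
  rw [Finset.sum_add_distrib, Finset.sum_comm (f := fun v w => if T.tri u w v then N w v else 0),
    ← Finset.sum_add_distrib]
  refine Finset.sum_congr rfl fun v _ => ?_
  rw [← Finset.sum_add_distrib]
  refine Finset.sum_congr rfl fun w _ => ?_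
  split_ifs <;> simp

/-- Telescoping: every face at `u` occurs once with each sign. -/
theorem IsInteriorVertex.sum_sub_eq_zero {M : Type*} [AddCommGroup M] {u : W}
    (hu : T.IsInteriorVertex u) (f : W → M) (F : W → W → M)
    (h : ∀ v s t, T.tri u v s → T.tri v u t → f v = F t v - F v s)
    (h₀ : ∀ v, ¬ T.IsEdge s(u, v) → f v = 0) : ∑ v, f v = 0 := by
  classical
  rw [hu.sum_eq_sum_faces f (fun v s => -F v s) F (fun v s t hs ht => ?_) h₀]
  · simp
  · rw [h v s t hs ht, sub_eq_neg_add]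

end TriMesh

/-! ### Quadratic interpolation and cross ratios. -/

section Interpolation

variable {z₁ z₂ z₃ d₁ d₂ d₃ : ℂ}

/-- The quadratic polynomial with three given values, expanded at `z₁`: the linear coefficient is
its derivative there and the last one the second divided difference. -/
theorem newton_interpolation (h₁₂ : z₂ - z₁ ≠ 0) (h₁₃ : z₃ - z₁ ≠ 0) (h₂₃ : z₃ - z₂ ≠ 0) :
    d₂ = d₁ + ((d₂ - d₁) / (z₂ - z₁) + (d₃ - d₁) / (z₃ - z₁) - (d₃ - d₂) / (z₃ - z₂)) * (z₂ - z₁) +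
      ((d₃ - d₁) / (z₃ - z₁) - (d₂ - d₁) / (z₂ - z₁)) / (z₃ - z₂) * (z₂ - z₁) ^ 2 := by
  field_simp
  ring

theorem newton_interpolation' (h₁₂ : z₂ - z₁ ≠ 0) (h₁₃ : z₃ - z₁ ≠ 0) (h₂₃ : z₃ - z₂ ≠ 0) :
    d₃ = d₁ + ((d₂ - d₁) / (z₂ - z₁) + (d₃ - d₁) / (z₃ - z₁) - (d₃ - d₂) / (z₃ - z₂)) * (z₃ - z₁) +
      ((d₃ - d₁) / (z₃ - z₁) - (d₂ - d₁) / (z₂ - z₁)) / (z₃ - z₂) * (z₃ - z₁) ^ 2 := by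
  field_simp
  ring

theorem divided_difference_rotate (h₁₂ : z₂ - z₁ ≠ 0) (h₁₃ : z₃ - z₁ ≠ 0) (h₂₃ : z₃ - z₂ ≠ 0) :
    ((d₃ - d₁) / (z₃ - z₁) - (d₂ - d₁) / (z₂ - z₁)) / (z₃ - z₂) =
      ((d₁ - d₂) / (z₁ - z₂) - (d₃ - d₂) / (z₃ - z₂)) / (z₁ - z₃) := by
  rw [← neg_sub z₂ z₁, ← neg_sub z₃ z₁]
  field_simp
  ring

/-- A single quadratic field preserves cross ratios. The two fields share value and derivative at
`z`, so only the discrepancy `(A' - A) (z₄ - z)²` at the fourth point counts. -/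
theorem crossRatioRate_of_quadratic {z z₂ z₃ z₄ d D A A' : ℂ} (h₂ : z₂ - z ≠ 0)
    (h₄ : z₄ - z ≠ 0) (h₂₃ : z₂ - z₃ ≠ 0) (h₃₄ : z₃ - z₄ ≠ 0) :
    crossRatioRate z z₂ z₃ z₄ d (d + D * (z₂ - z) + A * (z₂ - z) ^ 2)
      (d + D * (z₃ - z) + A * (z₃ - z) ^ 2) (d + D * (z₄ - z) + A' * (z₄ - z) ^ 2) =
      (z₃ - z) * (z₄ - z) / (z₄ - z₃) * (A' - A) := by
  have h₁ : (d - (d + D * (z₂ - z) + A * (z₂ - z) ^ 2)) / (z - z₂) = D + A * (z₂ - z) := by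
    rw [← neg_sub z₂, div_eq_iff (neg_ne_zero.2 h₂)]
    ring
  have h₅ : (d + D * (z₂ - z) + A * (z₂ - z) ^ 2 - (d + D * (z₃ - z) + A * (z₃ - z) ^ 2)) /
      (z₂ - z₃) = D + A * ((z₂ - z) + (z₃ - z)) := by
    rw [div_eq_iff h₂₃]
    ring
  have h₆ : (d + D * (z₄ - z) + A' * (z₄ - z) ^ 2 - d) / (z₄ - z) = D + A' * (z₄ - z) := by
    rw [div_eq_iff h₄]
    ring
  rw [crossRatioRate, h₁, h₅, h₆, ← neg_sub z₃ z₄]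
  field_simp
  ring

theorem crossRatioRate_mobiusField {z₁ z₂ z₃ z₄ : ℂ} (Φ : Matrix (Fin 2) (Fin 2) ℂ)
    (h₁₂ : z₁ ≠ z₂) (h₂₃ : z₂ ≠ z₃) (h₃₄ : z₃ ≠ z₄) (h₄₁ : z₄ ≠ z₁) :
    crossRatioRate z₁ z₂ z₃ z₄ (mobiusField Φ z₁) (mobiusField Φ z₂) (mobiusField Φ z₃)
      (mobiusField Φ z₄) = 0 := by
  have h : ∀ x y : ℂ, x ≠ y → (mobiusField Φ x - mobiusField Φ y) / (x - y) =
      Φ 0 0 - Φ 1 1 - Φ 1 0 * (x + y) := by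
    intro x y hxy
    rw [div_eq_iff (sub_ne_zero.2 hxy)]
    simp only [mobiusField, Matrix.det_fin_two_of]
    ring
  rw [crossRatioRate, h _ _ h₁₂, h _ _ h₂₃, h _ _ h₃₄, h _ _ h₄₁]
  ring

end Interpolation

/-! ### The quadratic vector field of a face and the Koebe cross ratios. -/

namespace CirclePacking

open Complex TriMesh

variable {V : Type*} {G : TriMesh V} (C : CirclePacking G) (δ : C.deformations)
variable {u v w s t : V}

/-- The quadratic coefficient of the quadratic vector field that induces the given velocities at
the three points of tangency of a face. -/
def quadCoeff (u v w : V) : ℂ :=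
  (C.quot δ s(w, u) s(u, v) - C.quot δ s(v, w) s(u, v)) / (C.pt s(w, u) - C.pt s(v, w))

/-- The linear coefficient of the quadratic vector field of a face. -/
def linCoeff (u v w : V) : ℂ := C.fieldDeriv δ u v - 2 * C.quadCoeff δ u v w * C.pt s(u, v)

/-- The constant coefficient of the quadratic vector field of a face. -/
def constCoeff (u v w : V) : ℂ :=
  C.dpt δ s(u, v) - C.fieldDeriv δ u v * C.pt s(u, v) + C.quadCoeff δ u v w * C.pt s(u, v) ^ 2

theorem pt_ne_of_tri (h : G.tri u v w) : C.pt s(v, w) - C.pt s(u, v) ≠ 0 := by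
  have := C.pt_sub_ne (isEdge₁₂ h).symm (isEdge₂₃ h) (ne₃₁ h).symm
  rwa [Sym2.eq_swap (a := v) (b := u)] at this

theorem dpt_eq_quadratic (h : G.tri u v w) :
    C.dpt δ s(v, w) = C.dpt δ s(u, v) + C.fieldDeriv δ u v * (C.pt s(v, w) - C.pt s(u, v)) +
      C.quadCoeff δ u v w * (C.pt s(v, w) - C.pt s(u, v)) ^ 2 := by
  have h₁ := C.pt_ne_of_tri h
  have h₂ := C.pt_ne_of_tri (G.rotate _ _ _ h)
  have h₃ := C.pt_ne_of_tri (rotate' h)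
  rw [← fieldDeriv_eq C δ h, quadCoeff, quot_swap C δ s(v, w) s(w, u), add_comm (C.quot δ _ _)]
  refine newton_interpolation h₁ ?_ h₂
  rwa [← neg_ne_zero, neg_sub]

theorem dpt_eq_quadratic' (h : G.tri u v w) :
    C.dpt δ s(w, u) = C.dpt δ s(u, v) + C.fieldDeriv δ u v * (C.pt s(w, u) - C.pt s(u, v)) +
      C.quadCoeff δ u v w * (C.pt s(w, u) - C.pt s(u, v)) ^ 2 := by
  have h₁ := C.pt_ne_of_tri h
  have h₂ := C.pt_ne_of_tri (G.rotate _ _ _ h)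
  have h₃ := C.pt_ne_of_tri (rotate' h)
  rw [← fieldDeriv_eq C δ h, quadCoeff, quot_swap C δ s(v, w) s(w, u), add_comm (C.quot δ _ _)]
  refine newton_interpolation' h₁ ?_ h₂
  rwa [← neg_ne_zero, neg_sub]

theorem quadCoeff_rotate (h : G.tri u v w) : C.quadCoeff δ v w u = C.quadCoeff δ u v w := by
  have h₁ := C.pt_ne_of_tri h
  have h₂ := C.pt_ne_of_tri (G.rotate _ _ _ h)
  have h₃ := C.pt_ne_of_tri (rotate' h)
  symm
  refine divided_difference_rotate h₁ ?_ h₂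
  rwa [← neg_ne_zero, neg_sub]

theorem fieldDeriv_sub (h : G.tri u v w) : C.fieldDeriv δ v w - C.fieldDeriv δ u v =
    2 * C.quadCoeff δ u v w * (C.pt s(v, w) - C.pt s(u, v)) := by
  have h₁ := C.pt_ne_of_tri h
  have h₂ := C.pt_ne_of_tri (G.rotate _ _ _ h)
  have e₁ := C.dpt_eq_quadratic δ h
  have e₂ := C.dpt_eq_quadratic' δ (G.rotate _ _ _ h)
  rw [C.quadCoeff_rotate δ h] at e₂
  refine mul_right_cancel₀ h₁ ?_
  linear_combination e₁ + e₂

theorem linCoeff_rotate (h : G.tri u v w) : C.linCoeff δ v w u = C.linCoeff δ u v w := by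
  rw [linCoeff, linCoeff, C.quadCoeff_rotate δ h]
  linear_combination C.fieldDeriv_sub δ h

theorem constCoeff_rotate (h : G.tri u v w) : C.constCoeff δ v w u = C.constCoeff δ u v w := by
  rw [constCoeff, constCoeff, C.quadCoeff_rotate δ h]
  linear_combination C.dpt_eq_quadratic δ h - C.pt s(v, w) * C.fieldDeriv_sub δ h

/-- The relative change of the cross ratio of an interior edge `uv`, where `s` and `t` are the
third vertices of the faces to the left and to the right. -/
def koebeRate (u v s t : V) : ℂ :=
  crossRatioRate (C.pt s(u, v)) (C.pt s(v, s)) (C.pt s(s, u)) (C.pt s(u, t))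
    (C.dpt δ s(u, v)) (C.dpt δ s(v, s)) (C.dpt δ s(s, u)) (C.dpt δ s(u, t))

/-- By `fieldDeriv_swap` the fields of the two faces agree at `z_uv` to first order, and the
prefactor in `crossRatioRate_of_quadratic` is then exactly `ω`. -/
theorem koebeRate_eq (h : G.tri u v s) (h' : G.tri v u t) :
    C.koebeRate δ u v s t = C.omega u v * (C.quadCoeff δ v u t - C.quadCoeff δ u v s) := by
  have h₁ := C.pt_ne_of_tri h
  have h₂ := C.pt_ne_of_tri (G.rotate _ _ _ h)
  have h₄ := C.pt_ne_of_tri h'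
  have h₅ := C.pt_sub_ne (isEdge₂₃ h') (isEdge₃₁ h).symm (apex_ne h h').symm
  have e := C.dpt_eq_quadratic δ h'
  rw [fieldDeriv_swap, Sym2.eq_swap (a := v) (b := u)] at e
  rw [Sym2.eq_swap (a := v) (b := u)] at h₄
  rw [Sym2.eq_swap (a := u) (b := s)] at h₅
  rw [koebeRate, C.dpt_eq_quadratic δ h, C.dpt_eq_quadratic' δ h, e,
    crossRatioRate_of_quadratic h₁ h₄ _ h₅, omega, G.apex_eq h, G.apex_eq h']
  rwa [← neg_ne_zero, neg_sub]

theorem koebeRate_swap (h : G.tri u v s) (h' : G.tri v u t) :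
    C.koebeRate δ v u t s = C.koebeRate δ u v s t := by
  rw [C.koebeRate_eq δ h h', C.koebeRate_eq δ h' h, C.omega_swap h h']
  ring

/-- Each of the four points enters two consecutive difference quotients with opposite signs, so the
vertex rotations cancel. -/
theorem koebeRate_im (h : G.tri u v s) (h' : G.tri v u t) : (C.koebeRate δ u v s t).im = 0 := by
  have hne := apex_ne h h'
  have n₁ := ne₁₂ h
  have n₂ := ne₂₃ h
  have n₃ := ne₃₁ h
  have n₄ := ne₂₃ h'
  have n₅ := ne₃₁ h'
  have h₁ := C.quot_im δ (isEdge₁₂ h) (isEdge₂₃ h) (u := v) (by simp) (by simp)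
    (by simp [n₁, n₃.symm])
  have h₂ := C.quot_im δ (isEdge₂₃ h) (isEdge₃₁ h) (u := s) (by simp) (by simp)
    (by simp [n₂, n₁.symm])
  have h₃ := C.quot_im δ (isEdge₃₁ h) (isEdge₂₃ h') (u := u) (by simp) (by simp)
    (by simp [n₃, hne])
  have h₄ := C.quot_im δ (isEdge₂₃ h') (isEdge₁₂ h) (u := u) (by simp) (by simp)
    (by simp [n₅, n₁])
  have : C.koebeRate δ u v s t = C.quot δ s(u, v) s(v, s) - C.quot δ s(v, s) s(s, u) +
    C.quot δ s(s, u) s(u, t) - C.quot δ s(u, t) s(u, v) := rfl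
  rw [this, sub_im, add_im, sub_im, h₁, h₂, h₃, h₄]
  ring

end CirclePacking

/-! ### Functions on interior edges and linear algebra. -/

namespace TriMesh

/-- A symmetric function of the two faces at an interior edge is a function of the edge. -/
theorem exists_interiorEdge_function {W X : Type*} (T : TriMesh W) (F : W → W → W → W → X)
    (hF : ∀ a b c d, T.tri a b c → T.tri b a d → F b a d c = F a b c d) :
    ∃ f : T.InteriorEdge → X, ∀ (e : T.InteriorEdge) (a b c d : W), e.1 = s(a, b) →
      T.tri a b c → T.tri b a d → f e = F a b c d := by
  choose a b c d h₁ h₂ h₃ using fun e : T.InteriorEdge => e.2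
  refine ⟨fun e => F (a e) (b e) (c e) (d e), fun e a' b' c' d' he hc hd => ?_⟩
  rcases Sym2.eq_iff.1 ((h₁ e).symm.trans he) with ⟨rfl, rfl⟩ | ⟨rfl, rfl⟩
  · rw [T.unique _ _ _ _ hc (h₂ e), T.unique _ _ _ _ hd (h₃ e)]
  · rw [T.unique _ _ _ _ hc (h₃ e), T.unique _ _ _ _ hd (h₂ e), hF _ _ _ _ (h₂ e) (h₃ e)]

theorem sum_sum_extend {W : Type*} [Fintype W] (T : TriMesh W) [Fintype T.InteriorEdge]
    (g : T.InteriorEdge → ℝ) : ∑ u, ∑ v, T.extend g s(u, v) = 2 * ∑ e, g e := by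
  classical
  have h₁ : ∀ e, T.extend g e = ∑ f : T.InteriorEdge, if f.1 = e then g f else 0 := by
    intro e
    by_cases he : T.IsInteriorEdge e
    · rw [extend_apply g he, Finset.sum_eq_single ⟨e, he⟩]
      · simp
      · exact fun f _ hf => if_neg fun h => hf (Subtype.ext h)
      · simp
    · rw [extend_eq_zero g he, Finset.sum_eq_zero]
      exact fun f _ => if_neg fun h : f.1 = e => he (h ▸ f.2)
  simp_rw [h₁]
  rw [← Fintype.sum_prod_type' (f := fun u v => ∑ f : T.InteriorEdge,
    if f.1 = s(u, v) then g f else 0), Finset.sum_comm, Finset.mul_sum]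
  refine Finset.sum_congr rfl fun e _ => ?_
  obtain ⟨a, b, c, d, he, h, -⟩ := e.2
  have hab := ne₁₂ h
  rw [← Finset.sum_filter, Finset.sum_const]
  have : (Finset.univ.filter fun p : W × W => e.1 = s(p.1, p.2)) = {(a, b), (b, a)} := by
    ext ⟨x, y⟩
    rw [he]
    simp only [Finset.mem_filter, Finset.mem_univ, true_and, Finset.mem_insert,
      Finset.mem_singleton, Prod.mk.injEq, Sym2.eq_iff]
    constructor
    · rintro (⟨rfl, rfl⟩ | ⟨rfl, rfl⟩) <;> simp
    · rintro (⟨rfl, rfl⟩ | ⟨rfl, rfl⟩) <;> simp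
  rw [this, Finset.card_pair (by simp [hab])]
  simp

end TriMesh

/-- The linear map underlying a linear equivalence from a quotient, by counting dimensions. -/
theorem exists_quotient_equiv {E F : Type*} [AddCommGroup E] [Module ℝ E] [AddCommGroup F]
    [Module ℝ F] [FiniteDimensional ℝ E] [FiniteDimensional ℝ F] (f : E →ₗ[ℝ] F)
    (S : Submodule ℝ E) (hS : LinearMap.ker f = S)
    (hdim : Module.finrank ℝ F + Module.finrank ℝ S ≤ Module.finrank ℝ E) :
    ∃ e : (E ⧸ S) ≃ₗ[ℝ] F, ∀ x, e (Submodule.Quotient.mk x) = f x := by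
  subst hS
  have hinj : Function.Injective ((LinearMap.ker f).liftQ f le_rfl) :=
    LinearMap.ker_eq_bot.1 (Submodule.ker_liftQ_eq_bot _ _ _ le_rfl)
  have h₁ := Submodule.finrank_quotient_add_finrank (LinearMap.ker f)
  have h₂ := LinearMap.finrank_le_finrank_of_injective hinj
  exact ⟨LinearEquiv.ofInjectiveOfFinrankEq ((LinearMap.ker f).liftQ f le_rfl) hinj (by omega),
    fun x => rfl⟩

theorem eq_zero_of_quadratic_eq_zero {a b c z₁ z₂ z₃ : ℂ} (h₁₂ : z₂ - z₁ ≠ 0) (h₁₃ : z₃ - z₁ ≠ 0)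
    (h₂₃ : z₃ - z₂ ≠ 0) (h₁ : a * z₁ ^ 2 + b * z₁ + c = 0) (h₂ : a * z₂ ^ 2 + b * z₂ + c = 0)
    (h₃ : a * z₃ ^ 2 + b * z₃ + c = 0) : a = 0 ∧ b = 0 ∧ c = 0 := by
  have e₁ : a * (z₂ + z₁) + b = 0 := by
    refine mul_right_cancel₀ h₁₂ ?_
    linear_combination h₂ - h₁
  have e₂ : a * (z₃ + z₁) + b = 0 := by
    refine mul_right_cancel₀ h₁₃ ?_
    linear_combination h₃ - h₁
  have ha : a = 0 := by
    refine mul_right_cancel₀ h₂₃ ?_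
    linear_combination e₂ - e₁
  subst ha
  have hb : b = 0 := by linear_combination e₁
  subst hb
  exact ⟨rfl, rfl, by linear_combination h₁⟩

/-! ### Trivial motions, the dimension of the deformation space, the maximum principle. -/

namespace CirclePacking

open Complex TriMesh

section Mesh

variable {V : Type*} {G : TriMesh V} (C : CirclePacking G)

/-- The relative rate of change of the cross ratio of four points of tangency. -/
def crossRate (e₁ e₂ e₃ e₄ : Sym2 V) : C.deformations →ₗ[ℝ] ℂ where
  toFun δ := crossRatioRate (C.pt e₁) (C.pt e₂) (C.pt e₃) (C.pt e₄)
    (C.dpt δ e₁) (C.dpt δ e₂) (C.dpt δ e₃) (C.dpt δ e₄)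
  map_add' δ ε := by
    simp only [crossRatioRate, dpt_add]
    ring
  map_smul' r δ := by
    simp only [crossRatioRate, dpt_smul, RingHom.id_apply, real_smul]
    ring

/-- The angular velocities of the edges, halved. -/
def spinMap : C.deformations →ₗ[ℝ] (Sym2 V → ℝ) where
  toFun δ := Sym2.lift ⟨C.spin δ, fun a b => C.spin_swap δ b a⟩
  map_add' δ ε := by
    funext e
    induction e with
    | _ u v =>
      simp only [Sym2.lift_mk, spin, Pi.add_apply, Submodule.coe_add, Prod.fst_add]
      rw [add_sub_add_comm, add_div, add_im, add_div]
  map_smul' r δ := by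
    funext e
    induction e with
    | _ u v =>
      simp only [Sym2.lift_mk, spin, Pi.smul_apply, Submodule.coe_smul, Prod.smul_fst,
        RingHom.id_apply, smul_eq_mul]
      rw [← smul_sub, smul_div_assoc, smul_im, smul_eq_mul, mul_div_assoc]

@[simp]
theorem spinMap_mk (δ : C.deformations) (u v : V) : C.spinMap δ s(u, v) = C.spin δ u v := rfl

/-- The first order violation of the tangency relation. -/
def tension : ((V → ℂ) × (V → ℝ)) →ₗ[ℝ] (Sym2 V → ℝ) where
  toFun x := Sym2.lift ⟨fun u v => ((x.1 v - x.1 u) * conj (C.dir u v)).re - (x.2 u + x.2 v),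
    fun u v => by
      beta_reduce
      rw [C.dir_swap u v, map_neg, ← neg_sub (x.1 v), neg_mul_neg, add_comm (x.2 u)]⟩
  map_add' x y := by
    funext e
    induction e with
    | _ u v =>
      simp only [Sym2.lift_mk, Pi.add_apply, Prod.fst_add, Prod.snd_add]
      rw [add_sub_add_comm, add_mul, add_re]
      ring
  map_smul' r x := by
    funext e
    induction e with
    | _ u v =>
      simp only [Sym2.lift_mk, Pi.smul_apply, Prod.smul_fst, Prod.smul_snd, RingHom.id_apply,
        smul_eq_mul]
      rw [← smul_sub, smul_mul_assoc, smul_re, smul_eq_mul]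
      ring

theorem tension_mk (x : (V → ℂ) × (V → ℝ)) (u v : V) : C.tension x s(u, v) =
    ((x.1 v - x.1 u) * conj (C.dir u v)).re - (x.2 u + x.2 v) := rfl

theorem mem_deformations_of_tension {x : (V → ℂ) × (V → ℝ)}
    (h : ∀ e, G.IsEdge e → C.tension x e = 0) : x ∈ C.deformations := by
  intro u v he
  have h₁ := h _ he
  rw [tension_mk, sub_eq_zero] at h₁
  rw [C.center_sub, map_mul, ← ofReal_add, conj_ofReal, ← h₁, mul_left_comm, re_ofReal_mul,
    mul_comm]

variable (δ : C.deformations)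

/-- The four-point Laplacian on the medial graph. -/
def MedialHarmonic (α : Sym2 V → ℝ) : Prop :=
  ∀ u v s t, G.tri u v s → G.tri v u t →
    (α s(s, u) - α s(u, v)) *
      (C.radius u / C.inradius u v s + C.inradius u v s / C.radius u) +
    (α s(v, s) - α s(u, v)) *
      (C.radius v / C.inradius u v s + C.inradius u v s / C.radius v) +
    ((α s(t, v) - α s(u, v)) *
      (C.radius v / C.inradius v u t + C.inradius v u t / C.radius v) +
    (α s(u, t) - α s(u, v)) *
      (C.radius u / C.inradius v u t + C.inradius v u t / C.radius u)) = 0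

/-- The two faces at `uv` compute the same difference of growth rates, with opposite signs. -/
theorem medialHarmonic_spinMap : C.MedialHarmonic (C.spinMap δ) := by
  intro u v s t h h'
  have h₁ := C.growth_sub δ h
  have h₂ := C.growth_sub δ h'
  rw [C.spin_swap δ u v] at h₂
  simp only [spinMap_mk]
  linarith

variable {δ}

theorem spin_eq_zero_of_dpt_eq_zero (h : ∀ e, G.IsEdge e → C.dpt δ e = 0) {e : Sym2 V}
    (he : G.IsEdge e) : C.spinMap δ e = 0 := by
  obtain ⟨u, v, w, rfl, ht⟩ := he
  have h₁ := C.fieldDeriv_eq δ ht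
  rw [quot, quot, quot, h _ (isEdge₁₂ ht), h _ (isEdge₂₃ ht), h _ (isEdge₃₁ ht)] at h₁
  have h₂ := congrArg im h₁
  rw [fieldDeriv, ← mk_eq_add_mul_I] at h₂
  simp only [sub_self, zero_div, add_zero, zero_im] at h₂
  rw [spinMap_mk]
  linarith

theorem spin_eq_zero_of_mem_similarityTrivial (h : δ ∈ C.similarityTrivial) {e : Sym2 V}
    (he : G.IsEdge e) : C.spinMap δ e = 0 := by
  obtain ⟨a, b, h⟩ := h
  induction e with
  | _ u v =>
    have h₁ : C.center v - C.center u ≠ 0 := by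
      rw [center_sub]
      exact mul_ne_zero (C.radius_add_ne u v) (C.dir_ne_zero he)
    rw [spinMap_mk, spin, (h u).1, (h v).1, add_sub_add_right_eq_sub, ← mul_sub,
      mul_div_cancel_right₀ _ h₁, ofReal_im, zero_div]

end Mesh

section Disk

variable {V : Type*} [Finite V] {G : TriangulatedDisk V} (C : CirclePacking G.toTriMesh)

/-- Without rotation `growth_sub` makes all circles grow at one rate, and after subtraction of this
scaling the centres of adjacent circles move with equal velocity. -/
theorem mem_similarityTrivial_iff {δ : C.deformations} :
    δ ∈ C.similarityTrivial ↔ ∀ e, G.IsEdge e → C.spinMap δ e = 0 := by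
  refine ⟨fun h e he => C.spin_eq_zero_of_mem_similarityTrivial h he, fun h => ?_⟩
  have hg : ∀ u v w, G.tri u v w → C.growth δ u = C.growth δ v := by
    intro u v w ht
    have h₁ := C.growth_sub δ ht
    have h₂ := h _ (isEdge₁₂ ht)
    have h₃ := h _ (isEdge₂₃ ht)
    have h₄ := h _ (isEdge₃₁ ht)
    rw [spinMap_mk] at h₂ h₃ h₄
    rw [h₂, h₃, h₄] at h₁
    linarith
  have hg' : ∀ u v, C.growth δ u = C.growth δ v := G.eq_of_isEdge _ fun u v he => by
    rcases isEdge_iff.1 he with ⟨w, hw⟩ | ⟨w, hw⟩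
    · exact hg _ _ _ hw
    · exact (hg _ _ _ hw).symm
  obtain ⟨u₀, -⟩ := G.exists_tri
  have hR : ∀ u, δ.1.2 u = C.growth δ u₀ * C.radius u := fun u => by
    rw [hg' u₀ u, growth, div_mul_cancel₀ _ (C.radius_ne u)]
  have hc := G.eq_of_isEdge (fun u => δ.1.1 u - C.growth δ u₀ * C.center u) fun u v he => by
    have h₁ := C.center_velocity_sub δ he
    have h₂ := C.center_sub u v
    have h₃ := h _ he
    rw [spinMap_mk] at h₃
    rw [h₃, hR, hR] at h₁
    push_cast at h₁
    linear_combination C.growth δ u₀ * h₂ - h₁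
  refine ⟨C.growth δ u₀, δ.1.1 u₀ - C.growth δ u₀ * C.center u₀, fun u => ⟨?_, hR u⟩⟩
  linear_combination hc u u₀

theorem finrank_similarityTrivial_le : Module.finrank ℝ C.similarityTrivial ≤ 3 := by
  obtain ⟨u, -⟩ := G.exists_tri
  let f : C.similarityTrivial →ₗ[ℝ] ℂ × ℝ :=
    { toFun := fun δ => (δ.1.1.1 u, δ.1.1.2 u)
      map_add' := fun _ _ => rfl
      map_smul' := fun _ _ => rfl }
  have hf : Function.Injective f := by
    rw [injective_iff_map_eq_zero]
    rintro ⟨δ, a, b, h⟩ h0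
    have h₁ : δ.1.1 u = 0 := congrArg Prod.fst h0
    have h₂ : δ.1.2 u = 0 := congrArg Prod.snd h0
    rw [(h u).2] at h₂
    have ha : a = 0 := (mul_eq_zero.1 h₂).resolve_right (C.radius_ne u)
    subst ha
    rw [(h u).1] at h₁
    have hb : b = 0 := by simpa using h₁
    subst hb
    apply Subtype.ext
    apply Subtype.ext
    refine Prod.ext (funext fun v => ?_) (funext fun v => ?_)
    · simpa using (h v).1
    · simpa using (h v).2
  have := LinearMap.finrank_le_finrank_of_injective hf
  simpa using this

theorem mobiusField_eq (Φ : Matrix (Fin 2) (Fin 2) ℂ) (w : ℂ) :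
    mobiusField Φ w = -Φ 1 0 * w ^ 2 + (Φ 0 0 - Φ 1 1) * w + Φ 0 1 := by
  simp only [mobiusField, Matrix.det_fin_two_of]
  ring

theorem eq_zero_of_dpt_eq_zero {δ : C.deformations} (h : ∀ e, G.IsEdge e → C.dpt δ e = 0) :
    δ = 0 := by
  have hs : ∀ e, G.IsEdge e → C.spinMap δ e = 0 := fun e he => C.spin_eq_zero_of_dpt_eq_zero h he
  obtain ⟨a, b, hab⟩ := C.mem_similarityTrivial_iff.2 hs
  have hz : ∀ u v, G.IsEdge s(u, v) → a * C.pt s(u, v) + b = 0 := by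
    intro u v he
    have h₁ := C.dpt_eq δ he
    have h₂ := hs _ he
    rw [spinMap_mk] at h₂
    rw [h _ he, h₂, (hab u).1, (hab u).2] at h₁
    rw [C.pt_eq]
    push_cast at h₁
    linear_combination -h₁
  obtain ⟨u, v, w, ht⟩ := G.exists_tri
  have h₁ := hz _ _ (isEdge₁₂ ht)
  have h₂ := hz _ _ (isEdge₂₃ ht)
  have ha : (a : ℂ) = 0 := by
    refine mul_right_cancel₀ (C.pt_ne_of_tri ht) ?_
    linear_combination h₂ - h₁
  rw [ha] at h₁
  have hb : b = 0 := by linear_combination h₁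
  have ha' : a = 0 := by exact_mod_cast ha
  apply Subtype.ext
  refine Prod.ext (funext fun v => ?_) (funext fun v => ?_)
  · simp [(hab v).1, ha', hb]
  · simp [(hab v).2, ha']

/-- A quadratic field is determined by its values at the three tangency points of one face. -/
theorem finrank_mobiusTrivial_le : Module.finrank ℝ C.mobiusTrivial ≤ 6 := by
  obtain ⟨u, v, w, ht⟩ := G.exists_tri
  let f : C.mobiusTrivial →ₗ[ℝ] ℂ × ℂ × ℂ :=
    { toFun := fun δ => (C.dpt δ.1 s(u, v), C.dpt δ.1 s(v, w), C.dpt δ.1 s(w, u))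
      map_add' := fun δ ε => by simp [dpt_add]
      map_smul' := fun r δ => by simp [dpt_smul] }
  have hf : Function.Injective f := by
    rw [injective_iff_map_eq_zero]
    rintro ⟨δ, Φ, hΦ, h⟩ h0
    have h' : ∀ e, G.IsEdge e → C.dpt δ e = mobiusField Φ (C.pt e) := fun e he => h ⟨e, he⟩
    have h₁ : C.dpt δ s(u, v) = 0 := congrArg Prod.fst h0
    have h₂ : C.dpt δ s(v, w) = 0 := congrArg (fun x => x.2.1) h0
    have h₃ : C.dpt δ s(w, u) = 0 := congrArg (fun x => x.2.2) h0
    rw [h' _ (isEdge₁₂ ht), mobiusField_eq] at h₁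
    rw [h' _ (isEdge₂₃ ht), mobiusField_eq] at h₂
    rw [h' _ (isEdge₃₁ ht), mobiusField_eq] at h₃
    have h₄ := C.pt_ne_of_tri (rotate' ht)
    obtain ⟨ha, hb, hc⟩ := eq_zero_of_quadratic_eq_zero (C.pt_ne_of_tri ht)
      (by rwa [← neg_ne_zero, neg_sub]) (C.pt_ne_of_tri (G.rotate _ _ _ ht)) h₁ h₂ h₃
    refine Subtype.ext (C.eq_zero_of_dpt_eq_zero fun e he => ?_)
    rw [h' e he, mobiusField_eq, ha, hb, hc]
    simp
  have := LinearMap.finrank_le_finrank_of_injective hf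
  simpa using this

/-- Rank and nullity of `tension` on the edges. -/
theorem three_mul_card_le [Fintype V] :
    3 * Nat.card V ≤ Module.finrank ℝ C.deformations + Nat.card G.toTriMesh.Edge := by
  let f : ((V → ℂ) × (V → ℝ)) →ₗ[ℝ] (G.toTriMesh.Edge → ℝ) :=
    LinearMap.funLeft ℝ ℝ Subtype.val ∘ₗ C.tension
  have h₁ := LinearMap.finrank_range_add_finrank_ker f
  have h₂ : LinearMap.ker f ≤ C.deformations := fun x hx =>
    C.mem_deformations_of_tension fun e he => congrFun (LinearMap.mem_ker.1 hx) ⟨e, he⟩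
  have h₃ := Submodule.finrank_mono h₂
  have h₄ := Submodule.finrank_le (LinearMap.range f)
  have h₅ : Module.finrank ℝ ((V → ℂ) × (V → ℝ)) = 3 * Nat.card V := by
    rw [Module.finrank_prod, Module.finrank_pi, Module.finrank_pi_fintype]
    simp
    ring
  rw [Module.finrank_pi, ← Nat.card_eq_fintype_card] at h₄
  omega

theorem MedialHarmonic.le_zero {α : Sym2 V → ℝ} (hα : C.MedialHarmonic α)
    (h₀ : ∀ e, G.IsEdge e → ¬ G.IsInteriorEdge e → α e = 0) {e : Sym2 V} (he : G.IsEdge e) :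
    α e ≤ 0 := by
  by_contra! hpos
  have : Nonempty G.toTriMesh.Edge := ⟨⟨e, he⟩⟩
  obtain ⟨⟨e₁, he₁⟩, hmax⟩ := Finite.exists_max fun e : G.toTriMesh.Edge => α e.1
  have hmax' : ∀ e, G.IsEdge e → α e ≤ α e₁ := fun e he => hmax ⟨e, he⟩
  have hm : 0 < α e₁ := hpos.trans_le (hmax' e he)
  -- At a positive maximum all four terms of the Laplace equation are nonpositive and so vanish. The
  -- maximum spreads to the other sides of the face, hence over all faces to a boundary edge, where
  -- `α` is zero.
  have key : ∀ u v s, G.tri u v s → α s(u, v) = α e₁ → α s(s, u) = α e₁ ∧ α s(v, s) = α e₁ := by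
    intro u v s h huv
    have hi : G.IsInteriorEdge s(u, v) := by
      by_contra hi
      rw [h₀ _ (isEdge₁₂ h) hi] at huv
      exact hm.ne huv
    obtain ⟨t, h'⟩ := (isInteriorEdge_iff.1 hi).2
    have h₁ := hα u v s t h h'
    have pu := C.radius_pos u
    have pv := C.radius_pos v
    have pr := C.inradius_pos u v s
    have pr' := C.inradius_pos v u t
    have m₁ := hmax' _ (isEdge₃₁ h)
    have m₂ := hmax' _ (isEdge₂₃ h)
    have m₃ := hmax' _ (isEdge₃₁ h')
    have m₄ := hmax' _ (isEdge₂₃ h')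
    rw [huv] at h₁
    have p₁ : 0 < C.radius u / C.inradius u v s + C.inradius u v s / C.radius u := by positivity
    have p₂ : 0 < C.radius v / C.inradius u v s + C.inradius u v s / C.radius v := by positivity
    have p₃ : 0 < C.radius v / C.inradius v u t + C.inradius v u t / C.radius v := by positivity
    have p₄ : 0 < C.radius u / C.inradius v u t + C.inradius v u t / C.radius u := by positivity
    have q₁ := mul_nonpos_of_nonpos_of_nonneg (sub_nonpos.2 m₁) p₁.le
    have q₂ := mul_nonpos_of_nonpos_of_nonneg (sub_nonpos.2 m₂) p₂.le
    have q₃ := mul_nonpos_of_nonpos_of_nonneg (sub_nonpos.2 m₃) p₃.le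
    have q₄ := mul_nonpos_of_nonpos_of_nonneg (sub_nonpos.2 m₄) p₄.le
    have r₁ : (α s(s, u) - α e₁) *
      (C.radius u / C.inradius u v s + C.inradius u v s / C.radius u) = 0 := by linarith
    have r₂ : (α s(v, s) - α e₁) *
      (C.radius v / C.inradius u v s + C.inradius u v s / C.radius v) = 0 := by linarith
    exact ⟨sub_eq_zero.1 ((mul_eq_zero.1 r₁).resolve_right p₁.ne'),
      sub_eq_zero.1 ((mul_eq_zero.1 r₂).resolve_right p₂.ne')⟩
  have hconst : ∀ {u v w u' v' w' : V}, G.tri u v w → G.tri u' v' w' →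
      (α s(u, v) = α e₁) = (α s(u', v') = α e₁) :=
    G.face_eq_of_adjacent (fun u v _ => α s(u, v) = α e₁)
      (fun u v w h => propext ⟨fun h' => (key _ _ _ h h').2,
        fun h' => (key _ _ _ (G.rotate _ _ _ h) h').1⟩)
      (fun u v s t _ _ => by rw [Sym2.eq_swap])
  obtain ⟨e₂, ⟨a, b, c, rfl, h₂⟩, hb⟩ := G.boundary
  obtain ⟨a', b', c', rfl, h₁⟩ := he₁
  have := (hconst h₁ h₂).mp rfl
  rw [h₀ _ (isEdge₁₂ h₂) hb] at this
  exact hm.ne this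

theorem MedialHarmonic.eq_zero {α : Sym2 V → ℝ} (hα : C.MedialHarmonic α)
    (h₀ : ∀ e, G.IsEdge e → ¬ G.IsInteriorEdge e → α e = 0) {e : Sym2 V} (he : G.IsEdge e) :
    α e = 0 := by
  refine le_antisymm (hα.le_zero C h₀ he) ?_
  have hneg : C.MedialHarmonic (-α) := by
    intro u v s t h h'
    have := hα u v s t h h'
    simp only [Pi.neg_apply]
    linarith
  have := hneg.le_zero C (fun e he hi => by simp [h₀ e he hi]) he
  simpa using this

end Disk

end CirclePacking

/-! ### Equilibrium stresses and differentials of Koebe type. -/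

namespace CirclePacking

open Complex TriMesh

section Mesh

variable {V : Type*} {G : TriMesh V} (C : CirclePacking G)

/-- The relative rates of change of the Koebe cross ratios of the interior edges. -/
theorem exists_koebeMap : ∃ L : C.deformations →ₗ[ℝ] (G.InteriorEdge → ℝ),
    ∀ (δ : C.deformations) (e : G.InteriorEdge) (u v s t : V),
      e.1 = s(u, v) → G.tri u v s → G.tri v u t → (L δ e : ℂ) = C.koebeRate δ u v s t := by
  -- The values are linear functionals of the deformation, which makes the resulting map linear at
  -- once.
  obtain ⟨f, hf⟩ := G.exists_interiorEdge_function
    (fun u v s t => reLm ∘ₗ C.crossRate s(u, v) s(v, s) s(s, u) s(u, t)) (by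
      intro u v s t h h'
      ext δ
      exact congrArg re (C.koebeRate_swap δ h h'))
  refine ⟨LinearMap.pi f, fun δ e u v s t he h h' => ?_⟩
  rw [LinearMap.pi_apply, hf e u v s t he h h']
  exact Complex.ext rfl (C.koebeRate_im δ h h').symm

end Mesh

section FiniteMesh

variable {V : Type*} [Fintype V] {G : TriMesh V} (C : CirclePacking G)

/-- Equilibrium stresses: the forces along the interior edges, together with the pressures on the
radii, balance at all interior vertices. -/
def stress : Submodule ℝ (G.InteriorEdge → ℝ) where
  carrier := {q | ∀ u, G.IsInteriorVertex u →
    ∑ v, G.extend q s(u, v) = 0 ∧ ∑ v, (G.extend q s(u, v) : ℂ) * C.dir u v = 0}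
  add_mem' := by
    intro q q' hq hq' u hu
    simp only [extend_add, ofReal_add, add_mul, Finset.sum_add_distrib, (hq u hu).1,
      (hq u hu).2, (hq' u hu).1, (hq' u hu).2, add_zero, and_self]
  zero_mem' := by
    intro u _
    simp [extend_zero]
  smul_mem' := by
    intro r q hq u hu
    simp only [extend_smul, ofReal_mul, mul_assoc, ← Finset.mul_sum, (hq u hu).1,
      (hq u hu).2, mul_zero, and_self]

/-- Virtual work: the sum is regrouped by vertices. The forces balance at interior vertices and the
displacement vanishes at the others. -/
theorem sum_stress_mul_tension [Fintype G.InteriorEdge] {q : G.InteriorEdge → ℝ}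
    (hq : q ∈ C.stress) {x : (V → ℂ) × (V → ℝ)}
    (hx : ∀ u, ¬ G.IsInteriorVertex u → x.1 u = 0 ∧ x.2 u = 0) :
    ∑ e : G.InteriorEdge, q e * C.tension x e.1 = 0 := by
  set g : V → V → ℝ := fun u v => G.extend q s(u, v) * ((x.1 u * conj (C.dir u v)).re + x.2 u)
    with hg
  have h₁ : ∀ u v, G.extend (fun e => q e * C.tension x e.1) s(u, v) = -(g u v + g v u) := by
    intro u v
    by_cases h : G.IsInteriorEdge s(u, v)
    · simp only [hg]
      rw [Sym2.eq_swap (a := v), extend_apply _ h, extend_apply _ h, tension_mk, C.dir_swap u v,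
        map_neg, mul_neg, neg_re, sub_mul, sub_re]
      ring
    · simp only [hg]
      rw [Sym2.eq_swap (a := v), extend_eq_zero _ h, extend_eq_zero _ h]
      ring
  have h₂ : ∀ u, ∑ v, g u v = 0 := by
    intro u
    by_cases hu : G.IsInteriorVertex u
    · obtain ⟨hs, hd⟩ := hq u hu
      have hd' := congrArg (fun w : ℂ => (x.1 u * conj w).re) hd
      simp only [map_sum, map_mul, conj_ofReal, map_zero, mul_zero, zero_re, Finset.mul_sum,
        re_sum] at hd'
      simp only [hg, mul_add, Finset.sum_add_distrib]
      rw [← Finset.sum_mul, hs, zero_mul, add_zero, ← hd']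
      refine Finset.sum_congr rfl fun v _ => ?_
      rw [mul_left_comm, re_ofReal_mul]
    · refine Finset.sum_eq_zero fun v _ => ?_
      simp [hg, (hx u hu).1, (hx u hu).2]
  have h₃ := G.sum_sum_extend fun e => q e * C.tension x e.1
  simp only [h₁, Finset.sum_neg_distrib, Finset.sum_add_distrib] at h₃
  rw [Finset.sum_comm (f := fun u v => g v u)] at h₃
  simp only [h₂, Finset.sum_const_zero, add_zero, neg_zero] at h₃
  linarith

/-- By `inv_omega`, `1/ω` is `-i` times the conjugate direction times a positive factor `k`, and `q
k` is the stress. The condition for `p = 0` balances the forces; with `z_uv = c_u + R_u dir` the one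
for `p = 1` balances the pressures. -/
theorem exists_stress_of_koebeHQD : ∃ f : C.koebeHQD →ₗ[ℝ] C.stress, Function.Injective f := by
  obtain ⟨k, hk⟩ := G.exists_interiorEdge_function
    (fun a b c d => 1 / (2 * C.inradius a b c) + 1 / (2 * C.inradius b a d))
    (fun a b c d _ _ => add_comm _ _)
  have hk0 : ∀ e, k e ≠ 0 := by
    intro e
    obtain ⟨a, b, c, d, he, h, h'⟩ := e.2
    have p₁ := C.inradius_pos a b c
    have p₂ := C.inradius_pos b a d
    rw [hk e a b c d he h h']
    positivity
  have hmem : ∀ q ∈ C.koebeHQD, (fun e => q e * k e) ∈ C.stress := by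
    intro q hq u hu
    obtain ⟨h₁, h₂, -⟩ := hq u hu
    have hterm : ∀ v, (G.extend q s(u, v) : ℂ) / C.omega u v =
        -I * ((G.extend (fun e => q e * k e) s(u, v) : ℂ) * conj (C.dir u v)) := by
      intro v
      by_cases hi : G.IsInteriorEdge s(u, v)
      · obtain ⟨⟨s, hs⟩, ⟨t, ht⟩⟩ := isInteriorEdge_iff.1 hi
        rw [extend_apply _ hi, extend_apply _ hi, div_eq_mul_inv, C.inv_omega hs ht,
          hk _ u v s t rfl hs ht]
        push_cast
        ring
      · rw [extend_eq_zero _ hi, extend_eq_zero _ hi]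
        simp
    simp only [hterm] at h₁ h₂
    rw [← Finset.mul_sum] at h₁
    have hd : ∑ v, (G.extend (fun e => q e * k e) s(u, v) : ℂ) * conj (C.dir u v) = 0 :=
      (mul_eq_zero.1 h₁).resolve_left (neg_ne_zero.2 I_ne_zero)
    have hs : ∑ v, (G.extend (fun e => q e * k e) s(u, v) : ℂ) = 0 := by
      have h₃ : ∀ v, -I * ((G.extend (fun e => q e * k e) s(u, v) : ℂ) * conj (C.dir u v)) *
          C.pt s(u, v) = -I * C.center u *
            ((G.extend (fun e => q e * k e) s(u, v) : ℂ) * conj (C.dir u v)) +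
          -I * C.radius u * (G.extend (fun e => q e * k e) s(u, v) : ℂ) := by
        intro v
        by_cases hi : G.IsInteriorEdge s(u, v)
        · rw [C.pt_eq]
          linear_combination -I * (G.extend (fun e => q e * k e) s(u, v) : ℂ) * C.radius u *
            C.dir_mul_conj hi.isEdge
        · rw [extend_eq_zero _ hi]
          simp
      simp only [h₃, Finset.sum_add_distrib, ← Finset.mul_sum, hd, mul_zero, zero_add] at h₂
      exact (mul_eq_zero.1 h₂).resolve_left
        (mul_ne_zero (neg_ne_zero.2 I_ne_zero) (C.radius_ne' u))
    refine ⟨by exact_mod_cast hs, ?_⟩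
    have := congrArg conj hd
    simpa only [map_sum, map_mul, conj_ofReal, conj_conj, map_zero] using this
  let f : C.koebeHQD →ₗ[ℝ] C.stress :=
    { toFun := fun q => ⟨fun e => q.1 e * k e, hmem q.1 q.2⟩
      map_add' := fun q q' => by
        ext e
        exact add_mul _ _ _
      map_smul' := fun r q => by
        ext e
        exact mul_assoc _ _ _ }
  refine ⟨f, fun q q' h => ?_⟩
  ext e
  exact mul_right_cancel₀ (hk0 e) (congrFun (congrArg Subtype.val h) e)

/-- The difference of adjacent fields is `(λ/ω) (z - z_uv)²`. Its three coefficients telescope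
around `u` and give the conditions for `p = 0, 1, 2`. -/
theorem koebe_mem {q : G.InteriorEdge → ℝ} {δ : C.deformations}
    (hq : ∀ (e : G.InteriorEdge) (u v s t : V),
      e.1 = s(u, v) → G.tri u v s → G.tri v u t → (q e : ℂ) = C.koebeRate δ u v s t) :
    q ∈ C.koebeHQD := by
  intro u hu
  have hterm : ∀ v s t, G.tri u v s → G.tri v u t → (G.extend q s(u, v) : ℂ) / C.omega u v =
      C.quadCoeff δ v u t - C.quadCoeff δ u v s := by
    intro v s t hs ht
    have hi : G.IsInteriorEdge s(u, v) := ⟨u, v, s, t, rfl, hs, ht⟩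
    rw [extend_apply _ hi, hq ⟨_, hi⟩ u v s t rfl hs ht, C.koebeRate_eq δ hs ht,
      mul_div_cancel_left₀ _ (C.omega_ne_zero hs ht)]
  have hzero : ∀ v, ¬ G.IsEdge s(u, v) → (G.extend q s(u, v) : ℂ) / C.omega u v = 0 := by
    intro v hv
    rw [extend_eq_zero _ fun hi => hv hi.isEdge]
    simp
  refine ⟨?_, ?_, ?_⟩
  · refine hu.sum_sub_eq_zero _ (C.quadCoeff δ u) (fun v s t hs ht => ?_) fun v hv => hzero v hv
    rw [hterm v s t hs ht, C.quadCoeff_rotate δ ht]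
  -- The linear coefficient of `(z - z_uv)²` is `-2 z_uv`, whence the factor `-1/2`.
  · refine hu.sum_sub_eq_zero _ (fun v s => -(C.linCoeff δ u v s) / 2) (fun v s t hs ht => ?_)
      fun v hv => by rw [hzero v hv, zero_mul]
    rw [hterm v s t hs ht, C.linCoeff_rotate δ ht, linCoeff, linCoeff,
      C.fieldDeriv_swap, Sym2.eq_swap (a := v)]
    ring
  · refine hu.sum_sub_eq_zero _ (C.constCoeff δ u) (fun v s t hs ht => ?_)
      fun v hv => by rw [hzero v hv, zero_mul]
    rw [hterm v s t hs ht, C.constCoeff_rotate δ ht, constCoeff, constCoeff,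
      C.fieldDeriv_swap, Sym2.eq_swap (a := v)]
    ring

end FiniteMesh

section Disk

variable {V : Type*} [Fintype V] {G : TriangulatedDisk V} (C : CirclePacking G.toTriMesh)

/-- Rigidity with fixed boundary circles. Both ends of a boundary edge are boundary vertices, so the
displacement is a deformation without rotation on the boundary. By the maximum principle it is a
similarity, and a fixed boundary circle makes it zero. -/
theorem eq_zero_of_tension_eq_zero {x : (V → ℂ) × (V → ℝ)}
    (hx : ∀ u, ¬ G.IsInteriorVertex u → x.1 u = 0 ∧ x.2 u = 0)
    (h : ∀ e, G.IsInteriorEdge e → C.tension x e = 0) : x = 0 := by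
  have hb : ∀ u v, G.IsEdge s(u, v) → ¬ G.IsInteriorEdge s(u, v) → ¬ G.IsInteriorVertex u :=
    fun u v he hi hu => hi (hu v he)
  have hb' : ∀ u v, G.IsEdge s(u, v) → ¬ G.IsInteriorEdge s(u, v) → ¬ G.IsInteriorVertex v :=
    fun u v he hi => hb v u he.symm fun hi' => hi hi'.symm
  have hmem : x ∈ C.deformations := C.mem_deformations_of_tension fun e he => by
    by_cases hi : G.IsInteriorEdge e
    · exact h e hi
    · induction e with
      | _ u v =>
        obtain ⟨h₁, h₂⟩ := hx u (hb u v he hi)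
        obtain ⟨h₃, h₄⟩ := hx v (hb' u v he hi)
        simp [tension_mk, h₁, h₂, h₃, h₄]
  have hs : ∀ e, G.IsEdge e → C.spinMap ⟨x, hmem⟩ e = 0 := fun e he =>
    (C.medialHarmonic_spinMap ⟨x, hmem⟩).eq_zero C (fun e he hi => by
      induction e with
      | _ u v =>
        obtain ⟨h₁, -⟩ := hx u (hb u v he hi)
        obtain ⟨h₃, -⟩ := hx v (hb' u v he hi)
        simp [spin, h₁, h₃]) he
  obtain ⟨a, b, hab⟩ := C.mem_similarityTrivial_iff.2 hs
  simp only at hab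
  obtain ⟨e, he, hi⟩ := G.boundary
  induction e with
  | _ u v =>
    obtain ⟨h₁, h₂⟩ := hx u (hb u v he hi)
    rw [(hab u).2] at h₂
    obtain rfl : a = 0 := (mul_eq_zero.1 h₂).resolve_right (C.radius_ne u)
    rw [(hab u).1] at h₁
    obtain rfl : b = 0 := by simpa using h₁
    refine Prod.ext (funext fun w => ?_) (funext fun w => ?_)
    · simpa using (hab w).1
    · simpa using (hab w).2

/-- Stresses embed into the annihilator of the tensions of displacements at interior vertices, and
these tensions form a space of dimension `3|V_int|` by rigidity. -/
theorem finrank_stress_le : Module.finrank ℝ C.stress +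
    3 * Nat.card {u // G.IsInteriorVertex u} ≤ Nat.card G.toTriMesh.InteriorEdge := by
  classical
  let _ : Fintype G.toTriMesh.InteriorEdge := Fintype.ofFinite _
  let emb : (({u // G.IsInteriorVertex u} → ℂ) × ({u // G.IsInteriorVertex u} → ℝ)) →ₗ[ℝ]
      ((V → ℂ) × (V → ℝ)) :=
    { toFun := fun y => (fun u => if h : G.IsInteriorVertex u then y.1 ⟨u, h⟩ else 0,
        fun u => if h : G.IsInteriorVertex u then y.2 ⟨u, h⟩ else 0)
      map_add' := fun y y' => by
        refine Prod.ext (funext fun u => ?_) (funext fun u => ?_) <;>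
        by_cases h : G.IsInteriorVertex u <;> simp [h]
      map_smul' := fun r y => by
        refine Prod.ext (funext fun u => ?_) (funext fun u => ?_) <;>
        by_cases h : G.IsInteriorVertex u <;> simp [h] }
  have hemb : ∀ y u, ¬ G.IsInteriorVertex u → (emb y).1 u = 0 ∧ (emb y).2 u = 0 :=
    fun y u hu => ⟨dif_neg hu, dif_neg hu⟩
  let f : (({u // G.IsInteriorVertex u} → ℂ) × ({u // G.IsInteriorVertex u} → ℝ)) →ₗ[ℝ]
      (G.toTriMesh.InteriorEdge → ℝ) := LinearMap.funLeft ℝ ℝ Subtype.val ∘ₗ C.tension ∘ₗ emb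
  have hf : Function.Injective f := by
    rw [injective_iff_map_eq_zero]
    intro y hy
    have h0 := C.eq_zero_of_tension_eq_zero (hemb y) fun e he => congrFun hy ⟨e, he⟩
    refine Prod.ext (funext fun u => ?_) (funext fun u => ?_)
    · have := congrFun (congrArg Prod.fst h0) u.1
      rwa [show (emb y).1 u.1 = y.1 u from dif_pos u.2] at this
    · have := congrFun (congrArg Prod.snd h0) u.1
      rwa [show (emb y).2 u.1 = y.2 u from dif_pos u.2] at this
  let g : C.stress →ₗ[ℝ] (LinearMap.range f).dualAnnihilator :=
    LinearMap.codRestrict _ ((Fintype.linearCombination ℝ (fun e : G.toTriMesh.InteriorEdge =>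
      (LinearMap.proj e : (G.toTriMesh.InteriorEdge → ℝ) →ₗ[ℝ] ℝ))) ∘ₗ C.stress.subtype) (by
        intro q
        rw [Submodule.mem_dualAnnihilator]
        rintro _ ⟨y, rfl⟩
        have := C.sum_stress_mul_tension q.2 (hemb y)
        simp only [LinearMap.comp_apply, Submodule.subtype_apply, Fintype.linearCombination_apply,
          LinearMap.sum_apply, LinearMap.smul_apply, LinearMap.proj_apply, smul_eq_mul]
        exact this)
  have hg : Function.Injective g := by
    rw [injective_iff_map_eq_zero]
    intro q hq
    ext e
    have := LinearMap.congr_fun (congrArg Subtype.val hq) (Pi.single e 1)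
    simpa [g, Fintype.linearCombination_apply, LinearMap.sum_apply, Pi.single_apply] using this
  have h₁ := LinearMap.finrank_le_finrank_of_injective hg
  have h₂ := Subspace.finrank_add_finrank_dualAnnihilator_eq (LinearMap.range f)
  have h₃ := LinearMap.finrank_range_of_inj hf
  have h₄ : Module.finrank ℝ
      (({u // G.IsInteriorVertex u} → ℂ) × ({u // G.IsInteriorVertex u} → ℝ)) =
      3 * Nat.card {u // G.IsInteriorVertex u} := by
    rw [Module.finrank_prod, Module.finrank_pi, Module.finrank_pi_fintype]
    simp
    ring
  rw [Module.finrank_pi, ← Nat.card_eq_fintype_card] at h₂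
  omega

/-- The counts `|V| - |V_int| ≤ |E| - |E_int|` and `2|E| + 3 ≤ 3|V| + |E_int|` give `|E_int| -
3|V_int| + 6 ≤ 3|V| - |E|`. -/
theorem finrank_stress_add_finrank_mobiusTrivial_le :
    Module.finrank ℝ C.stress + Module.finrank ℝ C.mobiusTrivial ≤
      Module.finrank ℝ C.deformations := by
  classical
  have h₁ := C.finrank_stress_le
  have h₂ := C.finrank_mobiusTrivial_le
  have h₃ := C.three_mul_card_le
  have h₄ := G.two_mul_card_edge_le
  have h₅ := G.toTriMesh.card_boundary_add_card_interiorEdge_le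
  have h₆ : Nat.card {u // G.IsInteriorVertex u} + Nat.card {u // ¬ G.IsInteriorVertex u} =
      Nat.card V := by
    rw [← Nat.card_sum]
    exact Nat.card_congr (Equiv.sumCompl _)
  omega

theorem mem_mobiusTrivial_of_koebeRate_eq_zero {δ : C.deformations}
    (h : ∀ u v s t, G.tri u v s → G.tri v u t → C.koebeRate δ u v s t = 0) :
    δ ∈ C.mobiusTrivial := by
  have hconst : ∀ {u v w u' v' w' : V}, G.tri u v w → G.tri u' v' w' →
      (C.quadCoeff δ u v w, C.linCoeff δ u v w, C.constCoeff δ u v w) =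
      (C.quadCoeff δ u' v' w', C.linCoeff δ u' v' w', C.constCoeff δ u' v' w') :=
    G.face_eq_of_adjacent
      (fun u v w => (C.quadCoeff δ u v w, C.linCoeff δ u v w, C.constCoeff δ u v w))
      (fun u v w ht => by
        rw [C.quadCoeff_rotate δ ht, C.linCoeff_rotate δ ht, C.constCoeff_rotate δ ht])
      (fun u v s t hs ht => by
        have h₁ := h u v s t hs ht
        rw [C.koebeRate_eq δ hs ht, mul_eq_zero, sub_eq_zero] at h₁
        have h₂ := h₁.resolve_left (C.omega_ne_zero hs ht)
        rw [linCoeff, constCoeff, linCoeff, constCoeff, h₂, C.fieldDeriv_swap,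
          Sym2.eq_swap (a := v)])
  obtain ⟨a, b, c, h₀⟩ := G.exists_tri
  -- The matrix of trace zero whose field is the common quadratic polynomial of all faces.
  refine ⟨!![C.linCoeff δ a b c / 2, C.constCoeff δ a b c;
    -C.quadCoeff δ a b c, -(C.linCoeff δ a b c / 2)], by simp [Matrix.trace_fin_two], ?_⟩
  rintro ⟨e, u, v, w, rfl, ht⟩
  obtain ⟨h₁, h₂⟩ := Prod.mk.inj (hconst h₀ ht)
  obtain ⟨h₂, h₃⟩ := Prod.mk.inj h₂
  rw [mobiusField_eq]
  simp only [Matrix.of_apply, Matrix.cons_val', Matrix.cons_val_zero, Matrix.cons_val_one,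
    Matrix.cons_val_fin_one]
  rw [h₁, h₂, h₃, linCoeff, constCoeff, dz, z]
  ring

theorem koebeRate_eq_zero_of_mem {δ : C.deformations} (hδ : δ ∈ C.mobiusTrivial) {u v s t : V}
    (h : G.tri u v s) (h' : G.tri v u t) : C.koebeRate δ u v s t = 0 := by
  obtain ⟨Φ, -, hΦ⟩ := hδ
  have hd : ∀ e, G.IsEdge e → C.dpt δ e = mobiusField Φ (C.pt e) := fun e he => hΦ ⟨e, he⟩
  have h₁ := C.pt_ne_of_tri h
  have h₂ := C.pt_ne_of_tri (G.rotate _ _ _ h)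
  have h₄ := C.pt_ne_of_tri h'
  have h₅ := C.pt_sub_ne (isEdge₂₃ h') (isEdge₃₁ h).symm (apex_ne h h').symm
  rw [Sym2.eq_swap (a := v) (b := u)] at h₄
  rw [Sym2.eq_swap (a := u) (b := s)] at h₅
  rw [koebeRate, hd _ (isEdge₁₂ h), hd _ (isEdge₂₃ h), hd _ (isEdge₃₁ h), hd _ (isEdge₂₃ h')]
  exact crossRatioRate_mobiusField Φ (sub_ne_zero.1 h₁).symm (sub_ne_zero.1 h₂).symm
    (sub_ne_zero.1 h₅) (sub_ne_zero.1 h₄)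

theorem exists_koebe_equiv :
    ∃ L : (C.deformations ⧸ C.mobiusTrivial) ≃ₗ[ℝ] C.koebeHQD,
      ∀ (δ : C.deformations) (e : G.toTriMesh.InteriorEdge) (u v s t : V),
        e.1 = s(u, v) → G.tri u v s → G.tri v u t →
        (((L (Submodule.Quotient.mk δ)).1 e : ℝ) : ℂ) = C.koebeRate δ u v s t := by
  obtain ⟨L, hL⟩ := C.exists_koebeMap
  obtain ⟨f, hf⟩ := C.exists_stress_of_koebeHQD
  have h₁ := LinearMap.finrank_le_finrank_of_injective hf
  have h₂ := C.finrank_stress_add_finrank_mobiusTrivial_le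
  obtain ⟨e, he⟩ := exists_quotient_equiv
    (L.codRestrict C.koebeHQD fun δ => C.koebe_mem (hL δ)) C.mobiusTrivial (by
      ext δ
      rw [LinearMap.mem_ker]
      constructor
      · intro h
        refine C.mem_mobiusTrivial_of_koebeRate_eq_zero fun u v s t hs ht => ?_
        rw [← hL δ ⟨s(u, v), u, v, s, t, rfl, hs, ht⟩ u v s t rfl hs ht]
        exact_mod_cast congrFun (congrArg Subtype.val h) _
      · intro h
        ext e
        obtain ⟨u, v, s, t, he, hs, ht⟩ := e.2
        have := hL δ e u v s t he hs ht
        rw [C.koebeRate_eq_zero_of_mem h hs ht] at this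
        exact_mod_cast this) (by omega)
  refine ⟨e, fun δ e' u v s t he' hs ht => ?_⟩
  rw [he]
  exact hL δ e' u v s t he' hs ht

end Disk

end CirclePacking

/-! ### Cyclic lists and the directed sides of a polygon. -/

section Lists

variable {α : Type*}

/-- `x` is immediately followed by `y` in the list. -/
def Consec : List α → α → α → Prop
  | a :: b :: l, x, y => (x = a ∧ y = b) ∨ Consec (b :: l) x y
  | _, _, _ => False

/-- `x` is the last and `y` the first element of the list. -/
def Closing (l : List α) (x y : α) : Prop := l.getLast? = some x ∧ l.head? = some y

/-- The directed sides of the polygon with the given list of vertices. -/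
def Side (l : List α) (x y : α) : Prop := Consec l x y ∨ Closing l x y

theorem consec_cons_cons {a b x y : α} {l : List α} :
    Consec (a :: b :: l) x y ↔ (x = a ∧ y = b) ∨ Consec (b :: l) x y := Iff.rfl

theorem not_consec_singleton {a x y : α} : ¬ Consec [a] x y := id

theorem consec_append {l r : List α} {b x y : α} :
    Consec (l ++ b :: r) x y ↔ Consec (l ++ [b]) x y ∨ Consec (b :: r) x y := by
  induction l with
  | nil => simp [not_consec_singleton]
  | cons a l ih =>
    cases l with
    | nil => simp [consec_cons_cons, not_consec_singleton]
    | cons c l =>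
      simp only [List.cons_append, consec_cons_cons] at ih ⊢
      rw [ih, or_assoc]

theorem Consec.mem {l : List α} {x y : α} (h : Consec l x y) : x ∈ l ∧ y ∈ l := by
  induction l with
  | nil => exact h.elim
  | cons a l ih =>
    cases l with
    | nil => exact h.elim
    | cons b l =>
      rcases h with ⟨rfl, rfl⟩ | h
      · simp
      · exact ⟨List.mem_cons_of_mem _ (ih h).1, List.mem_cons_of_mem _ (ih h).2⟩

theorem Consec.rel {R : α → α → Prop} {l : List α} {x y : α} (h : Consec l x y)
    (hl : l.IsChain R) : R x y := by
  induction l with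
  | nil => exact h.elim
  | cons a l ih =>
    cases l with
    | nil => exact h.elim
    | cons b l =>
      rw [List.isChain_cons_cons] at hl
      rcases h with ⟨rfl, rfl⟩ | h
      · exact hl.1
      · exact ih h hl.2

theorem Consec.head_ne {l : List α} {x y : α} (h : Consec l x y) (hl : l.Nodup) :
    l.head? ≠ some y := by
  cases l with
  | nil => exact h.elim
  | cons a l =>
    cases l with
    | nil => exact h.elim
    | cons b l =>
      have hy : y ∈ b :: l := by
        rcases h with ⟨rfl, rfl⟩ | h
        · simp
        · exact h.mem.2
      rw [List.head?_cons, Ne, Option.some_inj]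
      rintro rfl
      exact (List.nodup_cons.1 hl).1 hy

theorem Consec.last_ne {l : List α} {x y : α} (h : Consec l x y) (hl : l.Nodup) :
    l.getLast? ≠ some x := by
  induction l with
  | nil => exact h.elim
  | cons a l ih =>
    cases l with
    | nil => exact h.elim
    | cons b l =>
      rw [List.getLast?_cons_cons]
      rcases h with ⟨rfl, rfl⟩ | h
      · intro h'
        exact (List.nodup_cons.1 hl).1 (List.mem_of_getLast? h')
      · exact ih h (List.nodup_cons.1 hl).2

theorem exists_consec_left {l : List α} {y : α} (h : y ∈ l) :
    l.head? = some y ∨ ∃ x, Consec l x y := by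
  induction l with
  | nil => simp at h
  | cons a l ih =>
    rcases List.mem_cons.1 h with rfl | h
    · simp
    · right
      cases l with
      | nil => simp at h
      | cons b l =>
        rcases ih h with h | ⟨x, hx⟩
        · rw [List.head?_cons, Option.some_inj] at h
          exact ⟨a, Or.inl ⟨rfl, h.symm⟩⟩
        · exact ⟨x, Or.inr hx⟩

theorem exists_consec_right {l : List α} {x : α} (h : x ∈ l) :
    l.getLast? = some x ∨ ∃ y, Consec l x y := by
  induction l with
  | nil => simp at h
  | cons a l ih =>
    cases l with
    | nil =>
      obtain rfl := List.mem_singleton.1 h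
      simp
    | cons b l =>
      rw [List.getLast?_cons_cons]
      rcases List.mem_cons.1 h with rfl | h
      · exact Or.inr ⟨b, Or.inl ⟨rfl, rfl⟩⟩
      · rcases ih h with h | ⟨y, hy⟩
        · exact Or.inl h
        · exact Or.inr ⟨y, Or.inr hy⟩

theorem consec_map {β : Type*} (f : α → β) {l : List α} {x y : β} :
    Consec (l.map f) x y ↔ ∃ a b, x = f a ∧ y = f b ∧ Consec l a b := by
  induction l with
  | nil => exact ⟨False.elim, by rintro ⟨_, _, _, _, h⟩; exact h⟩
  | cons c l ih =>
    cases l with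
    | nil => exact ⟨False.elim, by rintro ⟨_, _, _, _, h⟩; exact h⟩
    | cons d l =>
      simp only [List.map_cons, consec_cons_cons] at ih ⊢
      rw [ih]
      constructor
      · rintro (⟨rfl, rfl⟩ | ⟨a, b, h₁, h₂, h₃⟩)
        · exact ⟨c, d, rfl, rfl, Or.inl ⟨rfl, rfl⟩⟩
        · exact ⟨a, b, h₁, h₂, Or.inr h₃⟩
      · rintro ⟨a, b, h₁, h₂, ⟨rfl, rfl⟩ | h₃⟩
        · exact Or.inl ⟨h₁, h₂⟩
        · exact Or.inr ⟨a, b, h₁, h₂, h₃⟩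

theorem closing_map {β : Type*} (f : α → β) {l : List α} {x y : β} :
    Closing (l.map f) x y ↔ ∃ a b, x = f a ∧ y = f b ∧ Closing l a b := by
  simp only [Closing, List.getLast?_map, List.head?_map, Option.map_eq_some_iff]
  constructor
  · rintro ⟨⟨a, ha, rfl⟩, ⟨b, hb, rfl⟩⟩
    exact ⟨a, b, rfl, rfl, ha, hb⟩
  · rintro ⟨a, b, rfl, rfl, ha, hb⟩
    exact ⟨⟨a, ha, rfl⟩, ⟨b, hb, rfl⟩⟩

theorem getLast?_cons_append {a b : α} {l : List α} : (a :: (l ++ [b])).getLast? = some b := by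
  simp [List.getLast?_cons]

theorem closing_cons_append {a b x y : α} {l : List α} :
    Closing (a :: (l ++ [b])) x y ↔ x = b ∧ y = a := by
  simp [Closing, List.getLast?_cons, eq_comm]

end Lists

/-! ### Triangulated polygons. -/

section Polygon

variable {α : Type*}

/-- `x, y` is a directed side of one of the triangles. -/
def IsDirectedSide (P : Set (α × α × α)) (x y : α) : Prop :=
  ∃ z, (x, y, z) ∈ P ∨ (y, z, x) ∈ P ∨ (z, x, y) ∈ P

theorem isDirectedSide_split {P₁ P₂ : Set (α × α × α)} {a b c x y : α} :
    IsDirectedSide (insert (a, b, c) (P₁ ∪ P₂)) x y ↔ IsDirectedSide P₁ x y ∨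
      IsDirectedSide P₂ x y ∨ (x = a ∧ y = b) ∨ (x = b ∧ y = c) ∨ (x = c ∧ y = a) := by
  simp only [IsDirectedSide, Set.mem_insert_iff, Set.mem_union, Prod.mk.injEq]
  constructor
  · rintro ⟨z, h⟩
    rcases h with (h | h | h) | (h | h | h) | (h | h | h)
    · tauto
    · exact Or.inl ⟨z, by tauto⟩
    · exact Or.inr (Or.inl ⟨z, by tauto⟩)
    · tauto
    · exact Or.inl ⟨z, by tauto⟩
    · exact Or.inr (Or.inl ⟨z, by tauto⟩)
    · tauto
    · exact Or.inl ⟨z, by tauto⟩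
    · exact Or.inr (Or.inl ⟨z, by tauto⟩)
  · rintro (⟨z, h⟩ | ⟨z, h⟩ | ⟨rfl, rfl⟩ | ⟨rfl, rfl⟩ | ⟨rfl, rfl⟩)
    · exact ⟨z, by tauto⟩
    · exact ⟨z, by tauto⟩
    · exact ⟨c, by tauto⟩
    · exact ⟨a, by tauto⟩
    · exact ⟨b, by tauto⟩

theorem not_isDirectedSide_empty {x y : α} : ¬ IsDirectedSide (∅ : Set (α × α × α)) x y := by
  simp [IsDirectedSide]

namespace PolygonTriangulation

variable {m : List α} {P : Set (α × α × α)}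

theorem mem_left {a b c x : α} {l₁ l₂ : List α} (h : x ∈ a :: (l₁ ++ [b])) :
    x ∈ a :: (l₁ ++ b :: (l₂ ++ [c])) := by
  have : a :: (l₁ ++ b :: (l₂ ++ [c])) = (a :: (l₁ ++ [b])) ++ (l₂ ++ [c]) := by simp
  rw [this]
  exact List.mem_append_left _ h

theorem mem_right {a b c x : α} {l₁ l₂ : List α} (h : x ∈ b :: (l₂ ++ [c])) :
    x ∈ a :: (l₁ ++ b :: (l₂ ++ [c])) :=
  List.mem_append_right (a :: l₁) h

theorem mem (h : PolygonTriangulation m P) {x y z : α} (hx : (x, y, z) ∈ P) :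
    x ∈ m ∧ y ∈ m ∧ z ∈ m := by
  induction h with
  | degenerate a b => simp at hx
  | split a b c l₁ l₂ P₁ P₂ _ _ ih₁ ih₂ =>
    rcases hx with hx | hx | hx
    · simp only [Prod.mk.injEq] at hx
      obtain ⟨rfl, rfl, rfl⟩ := hx
      simp
    · exact ⟨mem_left (ih₁ hx).1, mem_left (ih₁ hx).2.1, mem_left (ih₁ hx).2.2⟩
    · exact ⟨mem_right (ih₂ hx).1, mem_right (ih₂ hx).2.1, mem_right (ih₂ hx).2.2⟩

theorem mem_of_isDirectedSide (h : PolygonTriangulation m P) {x y : α}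
    (hx : IsDirectedSide P x y) : x ∈ m ∧ y ∈ m := by
  obtain ⟨z, hz | hz | hz⟩ := hx
  · exact ⟨(h.mem hz).1, (h.mem hz).2.1⟩
  · exact ⟨(h.mem hz).2.2, (h.mem hz).1⟩
  · exact ⟨(h.mem hz).2.1, (h.mem hz).2.2⟩

theorem consec_split {a b c x y : α} {l₁ l₂ : List α} :
    Consec (a :: (l₁ ++ b :: (l₂ ++ [c]))) x y ↔
      Consec (a :: (l₁ ++ [b])) x y ∨ Consec (b :: (l₂ ++ [c])) x y :=
  consec_append (l := a :: l₁)

theorem closing_split {a b c x y : α} {l₁ l₂ : List α} :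
    Closing (a :: (l₁ ++ b :: (l₂ ++ [c]))) x y ↔ x = c ∧ y = a := by
  have : a :: (l₁ ++ b :: (l₂ ++ [c])) = a :: ((l₁ ++ b :: l₂) ++ [c]) := by simp
  rw [this, closing_cons_append]

/-- A side of a triangle is glued to another triangle or lies on the polygon. The alternative in the
second half accommodates the polygon with two vertices, where each directed side is the reverse of
the other. -/
theorem isDirectedSide_or_side (h : PolygonTriangulation m P) :
    (∀ x y, IsDirectedSide P x y → IsDirectedSide P y x ∨ Side m x y) ∧
      ∀ x y, Side m x y → IsDirectedSide P x y ∨ Side m y x := by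
  induction h with
  | degenerate a b =>
    refine ⟨fun x y hxy => (not_isDirectedSide_empty hxy).elim, fun x y hxy => Or.inr ?_⟩
    rcases hxy with (⟨rfl, rfl⟩ | h) | h
    · exact Or.inr ⟨rfl, rfl⟩
    · exact h.elim
    · obtain ⟨rfl, rfl⟩ := (closing_cons_append (l := [])).1 h
      exact Or.inl (Or.inl ⟨rfl, rfl⟩)
  | split a b c l₁ l₂ P₁ P₂ _ _ ih₁ ih₂ =>
    simp only [isDirectedSide_split, Side, consec_split, closing_split,
      closing_cons_append] at ih₁ ih₂ ⊢
    obtain ⟨f₁, g₁⟩ := ih₁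
    obtain ⟨f₂, g₂⟩ := ih₂
    constructor
    · rintro x y (h | h | ⟨rfl, rfl⟩ | ⟨rfl, rfl⟩ | ⟨rfl, rfl⟩)
      · have := f₁ x y h
        tauto
      · have := f₂ x y h
        tauto
      · have := g₁ y x (Or.inr ⟨rfl, rfl⟩)
        rcases this with h | h | ⟨rfl, -⟩
        · tauto
        · tauto
        · tauto
      · have := g₂ y x (Or.inr ⟨rfl, rfl⟩)
        rcases this with h | h | ⟨rfl, -⟩
        · tauto
        · tauto
        · tauto
      · tauto
    · rintro x y ((h | h) | ⟨rfl, rfl⟩)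
      · have := g₁ x y (Or.inl h)
        tauto
      · have := g₂ x y (Or.inl h)
        tauto
      · tauto

theorem not_isDirectedSide_of_closing (h : PolygonTriangulation m P) (hm : m.Nodup) {x y : α}
    (hc : Closing m x y) : ¬ IsDirectedSide P y x := by
  cases h with
  | degenerate a b => exact not_isDirectedSide_empty
  | split a b c l₁ l₂ P₁ P₂ h₁ h₂ =>
    obtain ⟨rfl, rfl⟩ := closing_split.1 hc
    simp only [List.nodup_cons, List.nodup_append, List.mem_append, List.mem_cons,
      List.not_mem_nil, or_false, not_or] at hm
    rw [isDirectedSide_split]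
    rintro (h | h | ⟨-, rfl⟩ | ⟨rfl, -⟩ | ⟨rfl, -⟩)
    · have := (h₁.mem_of_isDirectedSide h).2
      simp only [List.mem_cons, List.mem_append, List.not_mem_nil, or_false] at this
      rcases this with rfl | h | rfl
      · tauto
      · exact hm.2.2.2 _ h _ (by simp) rfl
      · tauto
    · have := (h₂.mem_of_isDirectedSide h).1
      simp only [List.mem_cons, List.mem_append, List.not_mem_nil, or_false] at this
      tauto
    · tauto
    · tauto
    · tauto

/-- A function on the sides and diagonals of a triangulated polygon vanishes, except possibly on
the closing side, if at all other vertices it is orthogonal to the constants and to weights that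
separate the neighbours. -/
theorem eq_zero_of_sum_eq_zero [Fintype α] (h : PolygonTriangulation m P) (hm : m.Nodup)
    (q : α → α → ℝ) (w : α → α → ℂ) (hq : ∀ x y, q x y = q y x)
    (hw : ∀ x ∈ m, ∀ y ∈ m, ∀ z ∈ m, x ≠ y → x ≠ z → y ≠ z → w x y ≠ w x z)
    (hsum : ∀ x ∈ m, m.head? ≠ some x → m.getLast? ≠ some x →
      ∑ y, q x y = 0 ∧ ∑ y, (q x y : ℂ) * w x y = 0)
    (hsupp : ∀ x ∈ m, m.head? ≠ some x → m.getLast? ≠ some x → ∀ y, q x y ≠ 0 →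
      Consec m x y ∨ Consec m y x ∨ IsDirectedSide P x y ∨ IsDirectedSide P y x)
    {x y : α} (hxy : Consec m x y ∨ IsDirectedSide P x y) (h₁ : ¬ Closing m x y)
    (h₂ : ¬ Closing m y x) : q x y = 0 := by
  induction h generalizing x y with
  | degenerate a b =>
    rcases hxy with (⟨rfl, rfl⟩ | h) | h
    · exact (h₂ ⟨rfl, rfl⟩).elim
    · exact h.elim
    · exact (not_isDirectedSide_empty h).elim
  | split a b c l₁ l₂ P₁ P₂ t₁ t₂ ih₁ ih₂ =>
    have hm₁ : (a :: (l₁ ++ [b])).Nodup := by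
      have : a :: (l₁ ++ b :: (l₂ ++ [c])) = (a :: (l₁ ++ [b])) ++ (l₂ ++ [c]) := by simp
      rw [this] at hm
      exact (List.nodup_append.1 hm).1
    have hm₂ : (b :: (l₂ ++ [c])).Nodup := (List.nodup_append (l₁ := a :: l₁).1 hm).2.1
    have hdis : ∀ x ∈ a :: l₁, ∀ y ∈ b :: (l₂ ++ [c]), x ≠ y :=
      (List.nodup_append (l₁ := a :: l₁).1 hm).2.2
    have hdis' : ∀ x ∈ l₂ ++ [c], ∀ y ∈ a :: (l₁ ++ [b]), x ≠ y := by
      have : a :: (l₁ ++ b :: (l₂ ++ [c])) = (a :: (l₁ ++ [b])) ++ (l₂ ++ [c]) := by simp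
      rw [this] at hm
      exact fun x hx y hy h => (List.nodup_append.1 hm).2.2 y hy x hx h.symm
    have hlast : (a :: (l₁ ++ b :: (l₂ ++ [c]))).getLast? = some c := by
      have : a :: (l₁ ++ b :: (l₂ ++ [c])) = a :: ((l₁ ++ b :: l₂) ++ [c]) := by simp
      rw [this, getLast?_cons_append]
    have hab : a ≠ b := hdis a (by simp) b (by simp)
    have hac : a ≠ c := hdis a (by simp) c (by simp)
    have hbc : b ≠ c := fun h => hdis' c (by simp) b (by simp) h.symm
    simp only [closing_split] at h₁ h₂
    simp only [hlast, List.head?_cons, Ne, Option.some_inj] at hsum hsupp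
    simp only [consec_split, isDirectedSide_split] at hxy hsupp
    have in₁ : ∀ x ∈ a :: (l₁ ++ [b]), a ≠ x → b ≠ x → x ∈ l₁ := by
      intro x hx h h'
      simp only [List.mem_cons, List.mem_append, List.not_mem_nil, or_false] at hx
      exact (hx.resolve_left h.symm).resolve_right h'.symm
    have in₂ : ∀ x ∈ b :: (l₂ ++ [c]), b ≠ x → x ∈ l₂ ++ [c] := by
      intro x hx h
      exact (List.mem_cons.1 hx).resolve_left h.symm
    -- Strictly between `a` and `b` a vertex has neighbours in its own subpolygon only, so the
    -- hypotheses restrict to it. The induction leaves open just the closing side `ab`; likewise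
    -- `bc` for the other subpolygon.
    have key₁ : ∀ {x y : α}, Consec (a :: (l₁ ++ [b])) x y ∨ IsDirectedSide P₁ x y →
        ¬ (x = b ∧ y = a) → ¬ (y = b ∧ x = a) → q x y = 0 := by
      intro x y hxy h h'
      refine ih₁ hm₁ (fun x hx y hy z hz => hw x (mem_left hx) y (mem_left hy) z (mem_left hz))
        ?_ ?_ hxy (mt closing_cons_append.1 h) (mt closing_cons_append.1 h')
      · intro x hx hh hl
        rw [getLast?_cons_append, Ne, Option.some_inj] at hl
        rw [List.head?_cons, Ne, Option.some_inj] at hh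
        have hx' := in₁ x hx hh hl
        exact hsum x (mem_left hx) hh
          fun h => hdis x (List.mem_cons_of_mem _ hx') c (by simp) h.symm
      · intro x hx hh hl y hy
        rw [getLast?_cons_append, Ne, Option.some_inj] at hl
        rw [List.head?_cons, Ne, Option.some_inj] at hh
        have hx' := List.mem_cons_of_mem a (in₁ x hx hh hl)
        have hxc : ¬ c = x := fun h => hdis x hx' c (by simp) h.symm
        have n : ∀ y, x ∈ b :: (l₂ ++ [c]) → y := fun y h => (hdis x hx' x h rfl).elim
        rcases hsupp x (mem_left hx) hh hxc y hy with (h | h) | (h | h) | (h | h | h | h | h) |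
          (h | h | h | h | h)
        · exact Or.inl h
        · exact n _ h.mem.1
        · exact Or.inr (Or.inl h)
        · exact n _ h.mem.2
        · exact Or.inr (Or.inr (Or.inl h))
        · exact n _ (t₂.mem_of_isDirectedSide h).1
        · exact (hh h.1.symm).elim
        · exact (hl h.1.symm).elim
        · exact (hxc h.1.symm).elim
        · exact Or.inr (Or.inr (Or.inr h))
        · exact n _ (t₂.mem_of_isDirectedSide h).2
        · exact (hl h.2.symm).elim
        · exact (hxc h.2.symm).elim
        · exact (hh h.2.symm).elim
    have key₂ : ∀ {x y : α}, Consec (b :: (l₂ ++ [c])) x y ∨ IsDirectedSide P₂ x y →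
        ¬ (x = c ∧ y = b) → ¬ (y = c ∧ x = b) → q x y = 0 := by
      intro x y hxy h h'
      refine ih₂ hm₂ (fun x hx y hy z hz => hw x (mem_right hx) y (mem_right hy) z (mem_right hz))
        ?_ ?_ hxy (mt closing_cons_append.1 h) (mt closing_cons_append.1 h')
      · intro x hx hh hl
        rw [getLast?_cons_append, Ne, Option.some_inj] at hl
        rw [List.head?_cons, Ne, Option.some_inj] at hh
        exact hsum x (mem_right hx) (fun h => hdis' x (in₂ x hx hh) a (by simp) h.symm) hl
      · intro x hx hh hl y hy
        rw [getLast?_cons_append, Ne, Option.some_inj] at hl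
        rw [List.head?_cons, Ne, Option.some_inj] at hh
        have hx' := in₂ x hx hh
        have hxa : ¬ a = x := fun h => hdis' x hx' a (by simp) h.symm
        have n : ∀ y, x ∈ a :: (l₁ ++ [b]) → y := fun y h => (hdis' x hx' x h rfl).elim
        rcases hsupp x (mem_right hx) hxa hl y hy with (h | h) | (h | h) | (h | h | h | h | h) |
          (h | h | h | h | h)
        · exact n _ h.mem.1
        · exact Or.inl h
        · exact n _ h.mem.2
        · exact Or.inr (Or.inl h)
        · exact n _ (t₁.mem_of_isDirectedSide h).1
        · exact Or.inr (Or.inr (Or.inl h))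
        · exact (hxa h.1.symm).elim
        · exact (hh h.1.symm).elim
        · exact (hl h.1.symm).elim
        · exact n _ (t₁.mem_of_isDirectedSide h).2
        · exact Or.inr (Or.inr (Or.inr h))
        · exact (hh h.2.symm).elim
        · exact (hl h.2.symm).elim
        · exact (hxa h.2.symm).elim
    have hb : b ∈ a :: (l₁ ++ b :: (l₂ ++ [c])) := by simp
    -- At `b` only the values on `ba` and `bc` can survive. The two conditions there are a linear
    -- system with determinant `w b a - w b c`, up to sign.
    have hsub : ∀ y, y ≠ a ∧ y ≠ c → q b y = 0 := by
      rintro y ⟨hya, hyc⟩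
      by_contra hne
      have hne' : ¬ q y b = 0 := by rwa [hq]
      have k₁ : ∀ {x y : α}, x ≠ a → y ≠ a → ¬ (x = b ∧ y = a) ∧ ¬ (y = b ∧ x = a) :=
        fun hx hy => ⟨fun h => hy h.2, fun h => hx h.2⟩
      have k₂ : ∀ {x y : α}, x ≠ c → y ≠ c → ¬ (x = c ∧ y = b) ∧ ¬ (y = c ∧ x = b) :=
        fun hx hy => ⟨fun h => hx h.1, fun h => hy h.1⟩
      have a₁ := k₁ hab.symm hya
      have a₂ := k₁ hya hab.symm
      have c₁ := k₂ hbc hyc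
      have c₂ := k₂ hyc hbc
      rcases hsupp b hb hab hbc.symm y hne with (h | h) | (h | h) | (h | h | h | h | h) |
          (h | h | h | h | h)
      · exact hne (key₁ (Or.inl h) a₁.1 a₁.2)
      · exact hne (key₂ (Or.inl h) c₁.1 c₁.2)
      · exact hne' (key₁ (Or.inl h) a₂.1 a₂.2)
      · exact hne' (key₂ (Or.inl h) c₂.1 c₂.2)
      · exact hne (key₁ (Or.inr h) a₁.1 a₁.2)
      · exact hne (key₂ (Or.inr h) c₁.1 c₁.2)
      · exact hab h.1.symm
      · exact hyc h.2
      · exact hbc h.1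
      · exact hne' (key₁ (Or.inr h) a₂.1 a₂.2)
      · exact hne' (key₂ (Or.inr h) c₂.1 c₂.2)
      · exact hya h.1
      · exact hbc h.2
      · exact hyc h.1
    obtain ⟨s₁, s₂⟩ := hsum b hb hab hbc.symm
    rw [Fintype.sum_eq_add a c hac hsub] at s₁
    rw [Fintype.sum_eq_add a c hac fun y hy => by rw [hsub y hy]; simp] at s₂
    have hw' := sub_ne_zero.2 (hw b hb a (by simp) c (by simp) hab.symm hbc hac)
    have s₁' : (q b a : ℂ) + q b c = 0 := by exact_mod_cast s₁
    have hba' : (q b a : ℂ) = 0 := by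
      refine mul_right_cancel₀ hw' ?_
      linear_combination s₂ - w b c * s₁'
    have hba : q b a = 0 := by exact_mod_cast hba'
    have hbc' : q b c = 0 := by linarith
    have f₁ : ∀ {x y}, Consec (a :: (l₁ ++ [b])) x y ∨ IsDirectedSide P₁ x y → q x y = 0 := by
      intro x y h
      by_cases e₁ : x = b ∧ y = a
      · rw [e₁.1, e₁.2, hba]
      · by_cases e₂ : y = b ∧ x = a
        · rw [hq, e₂.1, e₂.2, hba]
        · exact key₁ h e₁ e₂
    have f₂ : ∀ {x y}, Consec (b :: (l₂ ++ [c])) x y ∨ IsDirectedSide P₂ x y → q x y = 0 := by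
      intro x y h
      by_cases e₁ : x = c ∧ y = b
      · rw [hq, e₁.1, e₁.2, hbc']
      · by_cases e₂ : y = c ∧ x = b
        · rw [e₂.1, e₂.2, hbc']
        · exact key₂ h e₁ e₂
    rcases hxy with (h | h) | h | h | ⟨rfl, rfl⟩ | ⟨rfl, rfl⟩ | h
    · exact f₁ (Or.inl h)
    · exact f₂ (Or.inl h)
    · exact f₁ (Or.inr h)
    · exact f₂ (Or.inr h)
    · rw [hq, hba]
    · exact hbc'
    · exact (h₁ h).elim

end PolygonTriangulation

end Polygon

section Lists

variable {α β : Type*} {f : α → β} {l : List α} {x y : α}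

theorem consec_map_iff (hf : Function.Injective f) :
    Consec (l.map f) (f x) (f y) ↔ Consec l x y := by
  rw [consec_map]
  constructor
  · rintro ⟨a, b, h₁, h₂, h⟩
    rwa [hf h₁, hf h₂]
  · exact fun h => ⟨x, y, rfl, rfl, h⟩

theorem closing_map_iff (hf : Function.Injective f) :
    Closing (l.map f) (f x) (f y) ↔ Closing l x y := by
  rw [closing_map]
  constructor
  · rintro ⟨a, b, h₁, h₂, h⟩
    rwa [hf h₁, hf h₂]
  · exact fun h => ⟨x, y, rfl, rfl, h⟩

theorem side_map_iff (hf : Function.Injective f) : Side (l.map f) (f x) (f y) ↔ Side l x y :=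
  or_congr (consec_map_iff hf) (closing_map_iff hf)

end Lists

theorem Sym2.eq_of_mem_of_mem {V : Type*} {e f : Sym2 V} {u v : V} (hne : e ≠ f) (hu : u ∈ e)
    (hu' : u ∈ f) (hv : v ∈ e) (hv' : v ∈ f) : u = v := by
  by_contra h
  exact hne (((Sym2.mem_and_mem_iff h).1 ⟨hu, hv⟩).trans
    ((Sym2.mem_and_mem_iff h).1 ⟨hu', hv'⟩).symm)

theorem Sym2.mk_left_injective {V : Type*} (u : V) : Function.Injective fun v => s(u, v) :=
  fun _ _ h => Sym2.congr_right.1 h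

/-! ### The star of a vertex as a polygon of the medial graph. -/

namespace TriMesh

variable {V : Type*} {G : TriMesh V} {u v w : V} {l : List V}

theorem IsStar.tri_of_consec (hl : G.IsStar u l) (h : Consec l v w) : G.tri u v w := h.rel hl.2.2

theorem IsStar.side_of_tri (hl : G.IsStar u l) (h : G.tri u v w) : Side l v w := by
  have hv := (hl.2.1 v).2 (isEdge₁₂ h)
  have hw := (hl.2.1 w).2 (isEdge₃₁ h).symm
  rcases exists_consec_left hw with hw | ⟨y, hy⟩
  · rcases exists_consec_right hv with hv | ⟨z, hz⟩
    · exact Or.inr ⟨hv, hw⟩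
    · rw [← G.unique _ _ _ _ h (hl.tri_of_consec hz)] at hz
      exact (hz.head_ne hl.1 hw).elim
  · rw [unique_middle (hl.tri_of_consec hy) h] at hy
    exact Or.inl hy

/-- Only the closing side is in question. An interior edge at one of its ends has a further face at
`u`, which the chain does not contain, so it must close the star. -/
theorem IsStar.tri_of_side (hl : G.IsStar u l) (h : Side l v w)
    (hi : G.IsInteriorEdge s(u, v) ∨ G.IsInteriorEdge s(u, w)) : G.tri u v w := by
  rcases h with h | h
  · exact hl.tri_of_consec h
  · rcases hi with hi | hi
    · obtain ⟨d, hd⟩ := (isInteriorEdge_iff.1 hi).1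
      rcases hl.side_of_tri hd with h' | h'
      · exact (h'.last_ne hl.1 h.1).elim
      · obtain rfl : w = d := Option.some_inj.1 (h.2.symm.trans h'.2)
        exact hd
    · obtain ⟨d, hd⟩ := (isInteriorEdge_iff.1 hi).2
      have hd := rotate' (rotate' hd)
      rcases hl.side_of_tri hd with h' | h'
      · exact (h'.head_ne hl.1 h.2).elim
      · obtain rfl : v = d := Option.some_inj.1 (h.1.symm.trans h'.1)
        exact hd

variable {m : List G.Edge}

theorem IsStar.side_iff (hm : m.map Subtype.val = l.map (fun v => s(u, v))) {i j : G.Edge}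
    (hi : i.1 = s(u, v)) (hj : j.1 = s(u, w)) : Side m i j ↔ Side l v w := by
  rw [← side_map_iff Subtype.val_injective, hm, hi, hj,
    side_map_iff (Sym2.mk_left_injective u)]

theorem IsStar.consec_iff (hm : m.map Subtype.val = l.map (fun v => s(u, v))) {i j : G.Edge}
    (hi : i.1 = s(u, v)) (hj : j.1 = s(u, w)) : Consec m i j ↔ Consec l v w := by
  rw [← consec_map_iff Subtype.val_injective, hm, hi, hj,
    consec_map_iff (Sym2.mk_left_injective u)]

theorem IsStar.mem_iff (hl : G.IsStar u l) (hm : m.map Subtype.val = l.map (fun v => s(u, v)))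
    {i : G.Edge} : i ∈ m ↔ u ∈ i.1 := by
  rw [← List.mem_map_of_injective Subtype.val_injective, hm, List.mem_map]
  constructor
  · rintro ⟨v, -, h⟩
    rw [← h]
    simp
  · intro h
    obtain ⟨v, hv⟩ := h
    exact ⟨v, (hl.2.1 v).2 (hv ▸ i.2), hv.symm⟩

theorem IsStar.nodup (hl : G.IsStar u l) (hm : m.map Subtype.val = l.map (fun v => s(u, v))) :
    m.Nodup := by
  refine List.Nodup.of_map Subtype.val ?_
  rw [hm]
  exact hl.1.map (Sym2.mk_left_injective u)

end TriMesh

/-! ### Interior edges and vertices of the triangulated medial graph. -/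

namespace IsMedialTriangulation

open TriMesh

variable {V : Type*} {G : TriMesh V} {T : TriMesh G.Edge}

theorem tri_of_tri (hT : IsMedialTriangulation G T)
    {u v w : V} (h : G.tri u v w) {i j k : G.Edge} (hi : i.1 = s(u, v))
    (hj : j.1 = s(v, w)) (hk : k.1 = s(w, u)) : T.tri i j k := by
  obtain ⟨P, -, htri⟩ := hT
  exact (htri i j k).2 (Or.inl ⟨u, v, w, h, hi, hj, hk⟩)

theorem face_or_common_vertex (hT : IsMedialTriangulation G T)
    {i j k : G.Edge} (h : T.tri i j k) :
    (∃ u v w, G.tri u v w ∧ i.1 = s(u, v) ∧ j.1 = s(v, w) ∧ k.1 = s(w, u)) ∨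
      ∃ u, u ∈ i.1 ∧ u ∈ j.1 ∧ u ∈ k.1 := by
  obtain ⟨P, hP, htri⟩ := hT
  rcases (htri i j k).1 h with h | ⟨u, h⟩
  · exact Or.inl h
  · obtain ⟨l, m, hl, hm, hPm⟩ := hP u
    have key : ∀ {i j k}, (i, j, k) ∈ P u → u ∈ i.1 ∧ u ∈ j.1 ∧ u ∈ k.1 := by
      intro i j k h
      simpa only [hl.mem_iff hm] using hPm.mem h
    refine Or.inr ⟨u, ?_⟩
    rcases h with h | h | h
    · exact key h
    · exact ⟨(key h).2.2, (key h).1, (key h).2.1⟩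
    · exact ⟨(key h).2.1, (key h).2.2, (key h).1⟩

theorem exists_common_vertex (hT : IsMedialTriangulation G T)
    {i j k : G.Edge} (h : T.tri i j k) : ∃ u, u ∈ i.1 ∧ u ∈ j.1 := by
  rcases hT.face_or_common_vertex h with ⟨u, v, w, -, hi, hj, -⟩ | ⟨u, hi, hj, -⟩
  · exact ⟨v, by simp [hi], by simp [hj]⟩
  · exact ⟨u, hi, hj⟩

/-- The medial triangle of a face is glued to the polygon of a vertex; a polygon triangle is glued
to another one or to the medial triangle of a face. Interiority of `i` excludes a polygon with two
vertices and the gap of an open star. -/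
theorem isInteriorEdge (hT : IsMedialTriangulation G T)
    {i j : G.Edge} (h : T.IsEdge s(i, j)) (hi : G.IsInteriorEdge i.1) :
    T.IsInteriorEdge s(i, j) := by
  have hface := @tri_of_tri _ _ _ hT
  obtain ⟨P, hP, htri⟩ := hT
  choose l m hl hm hPm using hP
  have hside : ∀ v i j, IsDirectedSide (P v) i j → ∃ k, T.tri i j k := fun v i j ⟨k, hk⟩ =>
    ⟨k, (htri i j k).2 (Or.inr ⟨v, hk⟩)⟩
  have key : ∀ {i j k : G.Edge}, G.IsInteriorEdge i.1 ∨ G.IsInteriorEdge j.1 → T.tri i j k →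
      ∃ k, T.tri j i k := by
    intro i j k hij h
    rcases (htri i j k).1 h with ⟨a, v, b, h, hi, hj, hk⟩ | ⟨v, h⟩
    · have h := G.rotate _ _ _ h
      rw [Sym2.eq_swap] at hi
      have h₁ := (IsStar.side_iff (hm v) hj hi).2 ((hl v).side_of_tri h)
      rcases (hPm v).isDirectedSide_or_side.2 _ _ h₁ with h₂ | h₂
      · exact hside _ _ _ h₂
      · rw [hi, hj] at hij
        have h₃ := (hl v).tri_of_side ((IsStar.side_iff (hm v) hi hj).1 h₂) hij
        exact (G.simplicial _ _ _ (G.rotate _ _ _ h) (G.rotate _ _ _ h₃)).elim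
    · rcases (hPm v).isDirectedSide_or_side.1 _ _ ⟨k, h⟩ with h₂ | h₂
      · exact hside _ _ _ h₂
      · obtain ⟨h₃, h₄⟩ := (hPm v).mem_of_isDirectedSide ⟨k, h⟩
        obtain ⟨a, ha⟩ := ((hl v).mem_iff (hm v)).1 h₃
        obtain ⟨b, hb⟩ := ((hl v).mem_iff (hm v)).1 h₄
        rw [ha, hb] at hij
        have h₅ := (hl v).tri_of_side ((IsStar.side_iff (hm v) ha hb).1 h₂) hij
        exact ⟨⟨s(a, b), isEdge₂₃ h₅⟩, hface (rotate' h₅) (hb.trans Sym2.eq_swap) ha rfl⟩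
  rw [isInteriorEdge_iff]
  rcases isEdge_iff.1 h with ⟨k, hk⟩ | ⟨k, hk⟩
  · exact ⟨⟨k, hk⟩, key (Or.inl hi) hk⟩
  · exact ⟨key (Or.inr hi) hk, ⟨k, hk⟩⟩

theorem isInteriorVertex (hT : IsMedialTriangulation G T)
    {i : G.Edge} (hi : G.IsInteriorEdge i.1) : T.IsInteriorVertex i :=
  fun _ hj => hT.isInteriorEdge hj hi

/-- Suppose `uv` has no face on the right. Turning about `i` then maps the neighbours of `i` that
contain `u` to themselves, injectively and so bijectively; but `su` is preceded by `vs`, which does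
not contain `u`. -/
theorem isInteriorEdge_of_isInteriorVertex [Finite V] (hT : IsMedialTriangulation G T)
    {i : G.Edge} (hi : T.IsInteriorVertex i) :
    G.IsInteriorEdge i.1 := by
  obtain ⟨e, u, v, s, rfl, h⟩ := i
  rw [isInteriorEdge_iff]
  refine ⟨⟨s, h⟩, ?_⟩
  by_contra hno
  set i : G.Edge := ⟨s(u, v), isEdge₁₂ h⟩
  let N := {j : G.Edge | T.IsEdge s(i, j) ∧ u ∈ j.1}
  have hmap : ∀ j ∈ N, ∃ k ∈ N, T.tri i j k := by
    rintro j ⟨hj, huj⟩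
    obtain ⟨k, hk⟩ := hi.tri_left hj
    refine ⟨k, ⟨(isEdge₃₁ hk).symm, ?_⟩, hk⟩
    have hne : i.1 ≠ j.1 := fun h => ne₁₂ hk (Subtype.ext h)
    rcases hT.face_or_common_vertex hk with ⟨a, b, c, ht, h₁, h₂, h₃⟩ | ⟨w, h₁, h₂, h₃⟩
    · exfalso
      have hbu : b = u := Sym2.eq_of_mem_of_mem hne (by simp [h₁]) (by simp [h₂])
        (Sym2.mem_mk_left u v) huj
      subst hbu
      have : a = v := by
        rcases Sym2.eq_iff.1 h₁ with ⟨rfl, rfl⟩ | ⟨-, rfl⟩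
        · exact (ne₁₂ ht rfl).elim
        · rfl
      exact hno ⟨c, this ▸ ht⟩
    · rwa [Sym2.eq_of_mem_of_mem hne (Sym2.mem_mk_left u v) huj h₁ h₂]
  let f : N → N := fun j => ⟨(hmap j.1 j.2).choose, (hmap j.1 j.2).choose_spec.1⟩
  have hf : ∀ j : N, T.tri i j.1 (f j).1 := fun j => (hmap j.1 j.2).choose_spec.2
  have hinj : Function.Injective f := fun j j' hjj' =>
    Subtype.ext (unique_middle (hf j) (hjj' ▸ hf j'))
  have hus := hT.tri_of_tri h (i := i) (j := ⟨s(v, s), isEdge₂₃ h⟩) (k := ⟨s(s, u), isEdge₃₁ h⟩)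
    rfl rfl rfl
  obtain ⟨j, hj⟩ := (Finite.injective_iff_surjective.1 hinj)
    ⟨⟨s(s, u), isEdge₃₁ h⟩, (isEdge₃₁ hus).symm, Sym2.mem_mk_right s u⟩
  have h₁ := hf j
  rw [hj] at h₁
  have h₂ := unique_middle h₁ hus
  have h₃ := j.2.2
  rw [h₂] at h₃
  rcases Sym2.mem_iff.1 h₃ with h₄ | h₄
  · exact ne₁₂ h h₄
  · exact ne₃₁ h h₄.symm

open Classical in
/-- A function on the interior edges vanishes if at all interior edges `i` of `G` and both ends `u`
of `i` the values on the edges from `i` to other edges at `u` are orthogonal to the constants and to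
the inverses of the edge vectors. -/
theorem eq_zero_of_fan_eq_zero [Finite V] (hT : IsMedialTriangulation G T) [Fintype G.Edge]
    {z : G.Edge → ℂ}
    (hz : ∀ (i j : G.Edge) (u : V), u ∈ i.1 → u ∈ j.1 → i ≠ j → z i ≠ z j)
    {q : T.InteriorEdge → ℝ} (hq : ∀ (i : G.Edge) (u : V), G.IsInteriorEdge i.1 → u ∈ i.1 →
      (∑ j, if u ∈ j.1 then T.extend q s(i, j) else 0) = 0 ∧
      (∑ j, if u ∈ j.1 then (T.extend q s(i, j) : ℂ) / (z j - z i) else 0) = 0) : q = 0 := by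
  have hcommon := @exists_common_vertex _ _ _ hT
  obtain ⟨P, hP, htri⟩ := hT
  choose l m hl hm hPm using hP
  have key : ∀ (u : V) (i j : G.Edge), u ∈ i.1 → u ∈ j.1 → T.extend q s(i, j) = 0 := by
    intro u
    set q' : G.Edge → G.Edge → ℝ := fun i j =>
      if u ∈ i.1 then if u ∈ j.1 then T.extend q s(i, j) else 0 else 0 with hq'
    have hq'_swap : ∀ i j, q' i j = q' j i := by
      intro i j
      simp only [hq']
      rw [Sym2.eq_swap]
      split_ifs <;> rfl
    have hmem : ∀ i, i ∈ m u ↔ u ∈ i.1 := fun i => (hl u).mem_iff (hm u)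
    have hq'_mem : ∀ {i j}, q' i j ≠ 0 → u ∈ i.1 ∧ u ∈ j.1 ∧ T.IsInteriorEdge s(i, j) := by
      intro i j h
      simp only [hq'] at h
      split_ifs at h with h₁ h₂
      · refine ⟨h₁, h₂, ?_⟩
        by_contra h₃
        exact h (extend_eq_zero q h₃)
      · exact (h rfl).elim
      · exact (h rfl).elim
    have hdir : ∀ i j k, T.tri i j k → u ∈ i.1 → u ∈ j.1 →
        (∃ a b, i.1 = s(u, a) ∧ j.1 = s(u, b) ∧ G.tri u b a) ∨ IsDirectedSide (P u) i j := by
      intro i j k hk hi hj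
      have hne : i.1 ≠ j.1 := fun h => ne₁₂ hk (Subtype.ext h)
      rcases (htri i j k).1 hk with ⟨a, v, b, h, h₁, h₂, h₃⟩ | ⟨v, h⟩
      · obtain rfl : v = u := Sym2.eq_of_mem_of_mem hne (by simp [h₁]) (by simp [h₂]) hi hj
        exact Or.inl ⟨a, b, h₁.trans Sym2.eq_swap, h₂, G.rotate _ _ _ h⟩
      · have hs : IsDirectedSide (P v) i j := ⟨k, h⟩
        have hv := (hPm v).mem_of_isDirectedSide hs
        rw [(hl v).mem_iff (hm v), (hl v).mem_iff (hm v)] at hv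
        obtain rfl : v = u := Sym2.eq_of_mem_of_mem hne hv.1 hv.2 hi hj
        exact Or.inr hs
    have hsupp : ∀ i j, q' i j ≠ 0 → Side (m u) j i ∨ IsDirectedSide (P u) i j := by
      intro i j h
      obtain ⟨hi, hj, hij⟩ := hq'_mem h
      obtain ⟨⟨k, hk⟩, -⟩ := isInteriorEdge_iff.1 hij
      rcases hdir i j k hk hi hj with ⟨a, b, ha, hb, h⟩ | h
      · exact Or.inl ((IsStar.side_iff (hm u) hb ha).2 ((hl u).side_of_tri h))
      · exact Or.inr h
    have hnd := (hl u).nodup (hm u)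
    have hint : ∀ i ∈ m u, (m u).head? ≠ some i → (m u).getLast? ≠ some i →
        G.IsInteriorEdge i.1 := by
      intro i hi hh hla
      obtain ⟨a, ha⟩ := (hmem i).1 hi
      obtain ⟨x, hx⟩ := (exists_consec_left hi).resolve_left hh
      obtain ⟨y, hy⟩ := (exists_consec_right hi).resolve_left hla
      obtain ⟨b, hb⟩ := (hmem x).1 hx.mem.1
      obtain ⟨c, hc⟩ := (hmem y).1 hy.mem.2
      rw [IsStar.consec_iff (hm u) hb ha] at hx
      rw [IsStar.consec_iff (hm u) ha hc] at hy
      rw [ha, isInteriorEdge_iff]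
      exact ⟨⟨c, (hl u).tri_of_consec hy⟩, ⟨b, rotate' ((hl u).tri_of_consec hx)⟩⟩
    have hsum : ∀ i, G.IsInteriorEdge i.1 → u ∈ i.1 →
        ∑ j, q' i j = 0 ∧ ∑ j, (q' i j : ℂ) * (z j - z i)⁻¹ = 0 := by
      intro i hi hui
      obtain ⟨h₁, h₂⟩ := hq i u hi hui
      refine ⟨?_, ?_⟩
      · rw [← h₁]
        exact Finset.sum_congr rfl fun j _ => if_pos hui
      · rw [← h₂]
        refine Finset.sum_congr rfl fun j _ => ?_
        simp only [hq', if_pos hui]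
        split_ifs
        · rw [div_eq_mul_inv]
        · simp
    have hmain : ∀ i j, ¬ Closing (m u) i j → ¬ Closing (m u) j i → q' i j = 0 := by
      intro i j h₁ h₂
      by_contra hne
      have hne' : ¬ q' j i = 0 := by rwa [hq'_swap]
      have peel : ∀ {i j}, Consec (m u) i j ∨ IsDirectedSide (P u) i j → ¬ Closing (m u) i j →
          ¬ Closing (m u) j i → q' i j = 0 := by
        refine (hPm u).eq_zero_of_sum_eq_zero hnd q' (fun i j => (z j - z i)⁻¹) hq'_swap
          ?_ ?_ ?_
        · intro x hx y hy w hw hxy hxw hyw h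
          rw [inv_inj, sub_left_inj] at h
          exact hz y w u ((hmem y).1 hy) ((hmem w).1 hw) hyw h
        · exact fun x hx hh hla => hsum x (hint x hx hh hla) ((hmem x).1 hx)
        · intro x hx hh hla y hy
          rcases hsupp x y hy with (h | h) | h
          · exact Or.inr (Or.inl h)
          · exact (hh h.2).elim
          · exact Or.inr (Or.inr (Or.inl h))
      rcases hsupp i j hne with (h | h) | h
      · exact hne' (peel (Or.inl h) h₂ h₁)
      · exact h₂ h
      · exact hne (peel (Or.inr h) h₁ h₂)
    -- If the closing side carries a value, the star closes up there, so its first edge `j` is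
    -- interior too. In the sum condition at `j` this value is the only remaining term.
    have hclose : ∀ i j, Closing (m u) i j → q' i j = 0 := by
      intro i j h
      by_contra hne
      obtain ⟨hi, hj, hij⟩ := hq'_mem hne
      have hijne : i ≠ j := hij.isEdge.ne
      have hcl : ∀ x y, Closing (m u) x y → x = i ∧ y = j := fun x y hxy =>
        ⟨Option.some_inj.1 (hxy.1.symm.trans h.1), Option.some_inj.1 (hxy.2.symm.trans h.2)⟩
      obtain ⟨k, hk⟩ := (isInteriorEdge_iff.1 hij).2
      rcases hdir j i k hk hj hi with ⟨a, b, ha, hb, ht⟩ | h'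
      · have hji : G.IsInteriorEdge j.1 := by
          obtain ⟨y, hy⟩ := (exists_consec_right ((hmem j).2 hj)).resolve_left
            fun h' => hijne (Option.some_inj.1 (h.1.symm.trans h'))
          obtain ⟨c, hc⟩ := (hmem y).1 hy.mem.2
          rw [IsStar.consec_iff (hm u) ha hc] at hy
          rw [ha, isInteriorEdge_iff]
          exact ⟨⟨c, (hl u).tri_of_consec hy⟩, ⟨b, rotate' ht⟩⟩
        have h₁ := (hsum j hji hj).1
        rw [Finset.sum_eq_single i] at h₁
        · exact hne (by rwa [hq'_swap])
        · intro y _ hy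
          refine hmain j y (fun h' => hijne (hcl _ _ h').1.symm) fun h' => hy (hcl _ _ h').1
        · simp
      · exact (hPm u).not_isDirectedSide_of_closing hnd h h'
    intro i j hi hj
    have : q' i j = T.extend q s(i, j) := by simp only [hq', if_pos hi, if_pos hj]
    rw [← this]
    by_cases h₁ : Closing (m u) i j
    · exact hclose i j h₁
    · by_cases h₂ : Closing (m u) j i
      · rw [hq'_swap]
        exact hclose j i h₂
      · exact hmain i j h₁ h₂
  funext e
  obtain ⟨i, j, k, d, he, h, -⟩ := e.2
  obtain ⟨u, hi, hj⟩ := hcommon h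
  have := key u i j hi hj
  rw [← he, extend_apply q e.2] at this
  exact this

end IsMedialTriangulation

/-! ### The cotangent Laplacian of the medial triangulation. -/

namespace CirclePacking

open Complex TriMesh

section Mesh

variable {V : Type*} {G : TriMesh V} (C : CirclePacking G) {T : TriMesh G.Edge}

theorem z_ne {i j : G.Edge} {u : V} (hi : u ∈ i.1) (hj : u ∈ j.1) (hne : i ≠ j) :
    C.z i ≠ C.z j := by
  obtain ⟨i, hi'⟩ := i
  obtain ⟨j, hj'⟩ := j
  obtain ⟨v, rfl⟩ := hi
  obtain ⟨w, rfl⟩ := hj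
  exact C.tangency_ne u v w hi' hj' fun h => hne (by simp [h])

theorem z_ne_of_tri (hT : IsMedialTriangulation G T) {i j k : G.Edge} (h : T.tri i j k) :
    C.z i ≠ C.z j := by
  obtain ⟨u, hi, hj⟩ := hT.exists_common_vertex h
  exact C.z_ne hi hj (ne₁₂ h)

/-- The triangle is either the medial triangle of a face or part of the polygon of `x`, whose
vertices lie on the circle of `x`, so that its angle is inscribed. -/
theorem cotAngle_eq (hT : IsMedialTriangulation G T) {i j k : G.Edge} (h : T.tri i j k)
    {x a b : V} (hi : i.1 = s(x, a)) (hj : j.1 = s(x, b)) :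
    (G.tri x b a ∧ cotAngle (C.z i) (C.z k) (C.z j) = C.inradius x b a / C.radius x) ∨
      (¬ G.tri x b a ∧ cotAngle (C.z i) (C.z k) (C.z j) = C.halfCot x a b) := by
  have hne : i.1 ≠ j.1 := fun h' => ne₁₂ h (Subtype.ext h')
  rcases hT.face_or_common_vertex h with ⟨a', x', b', ht, h₁, h₂, h₃⟩ | ⟨w, h₁, h₂, h₃⟩
  · left
    obtain rfl : x' = x := Sym2.eq_of_mem_of_mem hne (by simp [h₁]) (by simp [h₂]) (by simp [hi])
      (by simp [hj])
    obtain rfl : a' = a := Sym2.congr_right.1 ((Sym2.eq_swap.trans h₁.symm).trans hi)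
    obtain rfl : b' = b := Sym2.congr_right.1 (h₂.symm.trans hj)
    have ht := G.rotate _ _ _ ht
    refine ⟨ht, ?_⟩
    rw [z, z, z, h₁, h₂, h₃]
    exact C.cotAngle_medial ht
  · right
    obtain rfl : w = x := Sym2.eq_of_mem_of_mem hne h₁ h₂ (by simp [hi]) (by simp [hj])
    obtain ⟨c, hk⟩ := h₃
    have hab : a ≠ b := by rintro rfl; exact hne (hi.trans hj.symm)
    have hac : a ≠ c := by rintro rfl; exact ne₃₁ h (Subtype.ext (hk.trans hi.symm))
    have hbc : b ≠ c := by rintro rfl; exact ne₂₃ h (Subtype.ext (hj.trans hk.symm))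
    refine ⟨fun ht => ?_, ?_⟩
    · have h' := hT.tri_of_tri (rotate' ht) (k := ⟨s(b, a), isEdge₂₃ ht⟩)
        (hi.trans Sym2.eq_swap) hj rfl
      rw [T.unique _ _ _ _ h h'] at hk
      have : w ∈ s(b, a) := by
        rw [show s(b, a) = s(w, c) from hk]
        simp
      rcases Sym2.mem_iff.1 this with h | h
      · exact ne₁₂ ht h
      · exact ne₃₁ ht h.symm
    · rw [z, z, z, hi, hj, hk]
      exact C.halfCot_eq_cotAngle (hi ▸ i.2) (hj ▸ j.2) (hk ▸ k.2) hab hac hbc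

theorem cotWeight_swap {W : Type*} (T : TriMesh W) (z : W → ℂ) (i j : W) :
    T.cotWeight z i j = T.cotWeight z j i := add_comm _ _

theorem cotWeight_eq_of_tri (hT : IsMedialTriangulation G T) {i j : G.Edge}
    (h : T.IsInteriorEdge s(i, j)) {x a b : V} (hi : i.1 = s(x, a)) (hj : j.1 = s(x, b))
    (ht : G.tri x a b) : T.cotWeight C.z i j =
      C.radius x / C.inradius x a b + C.inradius x a b / C.radius x := by
  obtain ⟨⟨k, hk⟩, ⟨l, hl⟩⟩ := isInteriorEdge_iff.1 h
  rw [cotWeight, T.apex_eq hk, T.apex_eq hl]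
  have h₁ : ¬ G.tri x b a := fun h' => G.simplicial _ _ _ (G.rotate _ _ _ ht) (G.rotate _ _ _ h')
  rw [((C.cotAngle_eq hT hk hi hj).resolve_left fun h => h₁ h.1).2,
    ((C.cotAngle_eq hT hl hj hi).resolve_right fun h => h.1 ht).2, C.halfCot_of_tri ht]

/-- For a diagonal both opposite angles are inscribed over the same chord, traversed in opposite
directions. -/
theorem cotWeight_eq_zero (hT : IsMedialTriangulation G T) {i j : G.Edge}
    (h : T.IsInteriorEdge s(i, j)) {x a b : V} (hi : i.1 = s(x, a)) (hj : j.1 = s(x, b))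
    (ht : ¬ G.tri x a b) (ht' : ¬ G.tri x b a) : T.cotWeight C.z i j = 0 := by
  obtain ⟨⟨k, hk⟩, ⟨l, hl⟩⟩ := isInteriorEdge_iff.1 h
  rw [cotWeight, T.apex_eq hk, T.apex_eq hl,
    ((C.cotAngle_eq hT hk hi hj).resolve_left fun h => ht' h.1).2,
    ((C.cotAngle_eq hT hl hj hi).resolve_left fun h => ht h.1).2, C.halfCot_swap x a b,
    add_neg_cancel]

open Classical in
/-- Extension by zero of a function on the edges. -/
def extendEdge (α : G.Edge → ℝ) (e : Sym2 V) : ℝ := if h : G.IsEdge e then α ⟨e, h⟩ else 0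

theorem extendEdge_val (α : G.Edge → ℝ) (e : G.Edge) : extendEdge α e.1 = α e := dif_pos e.2

open Classical in
/-- The cotangent Laplacian at an interior vertex involves only the sides of the medial graph. -/
theorem sum_cotWeight [Fintype G.Edge] (hT : IsMedialTriangulation G T) (α : G.Edge → ℝ)
    {u v s t : V} (h : G.tri u v s) (h' : G.tri v u t) :
    (∑ j, if T.IsInteriorEdge s(⟨s(u, v), isEdge₁₂ h⟩, j) then
      T.cotWeight C.z ⟨s(u, v), isEdge₁₂ h⟩ j * (α j - α ⟨s(u, v), isEdge₁₂ h⟩) else 0) =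
    (extendEdge α s(s, u) - extendEdge α s(u, v)) *
      (C.radius u / C.inradius u v s + C.inradius u v s / C.radius u) +
    (extendEdge α s(v, s) - extendEdge α s(u, v)) *
      (C.radius v / C.inradius u v s + C.inradius u v s / C.radius v) +
    ((extendEdge α s(t, v) - extendEdge α s(u, v)) *
      (C.radius v / C.inradius v u t + C.inradius v u t / C.radius v) +
    (extendEdge α s(u, t) - extendEdge α s(u, v)) *
      (C.radius u / C.inradius v u t + C.inradius v u t / C.radius u)) := by
  have hint : G.IsInteriorEdge s(u, v) := ⟨u, v, s, t, rfl, h, h'⟩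
  set i : G.Edge := ⟨s(u, v), isEdge₁₂ h⟩ with hi
  set su : G.Edge := ⟨s(s, u), isEdge₃₁ h⟩ with hsu
  set vs : G.Edge := ⟨s(v, s), isEdge₂₃ h⟩ with hvs
  set tv : G.Edge := ⟨s(t, v), isEdge₃₁ h'⟩ with htv
  set ut : G.Edge := ⟨s(u, t), isEdge₂₃ h'⟩ with hut
  have t₁ : T.tri i vs su := hT.tri_of_tri h rfl rfl rfl
  have t₂ : T.tri i ut tv := hT.tri_of_tri h' Sym2.eq_swap rfl rfl
  have hV := hT.isInteriorVertex (i := i) hint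
  have i₁ : T.IsInteriorEdge s(i, su) := hV _ (isEdge₃₁ t₁).symm
  have i₂ : T.IsInteriorEdge s(i, vs) := hV _ (isEdge₁₂ t₁)
  have i₃ : T.IsInteriorEdge s(i, tv) := hV _ (isEdge₃₁ t₂).symm
  have i₄ : T.IsInteriorEdge s(i, ut) := hV _ (isEdge₁₂ t₂)
  have hst := apex_ne h h'
  have n₁ := ne₁₂ h
  have n₂ := ne₂₃ h
  have n₃ := ne₃₁ h
  have n₄ := ne₂₃ h'
  have n₅ := ne₃₁ h'
  have w₁ : T.cotWeight C.z i su = _ :=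
    C.cotWeight_eq_of_tri hT i₁ (x := u) (a := v) (b := s) rfl Sym2.eq_swap h
  have w₂ : T.cotWeight C.z i vs = _ := (cotWeight_swap T C.z i vs).trans
    (C.cotWeight_eq_of_tri hT i₂.symm (x := v) (a := s) (b := u) rfl Sym2.eq_swap (G.rotate _ _ _ h))
  have w₃ : T.cotWeight C.z i tv = _ :=
    C.cotWeight_eq_of_tri hT i₃ (x := v) (a := u) (b := t) Sym2.eq_swap Sym2.eq_swap h'
  have w₄ : T.cotWeight C.z i ut = _ := (cotWeight_swap T C.z i ut).trans
    (C.cotWeight_eq_of_tri hT i₄.symm (x := u) (a := t) (b := v) rfl rfl (G.rotate _ _ _ h'))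
  rw [inradius_rotate] at w₂ w₄
  have hsub : (∑ j, if T.IsInteriorEdge s(i, j) then T.cotWeight C.z i j * (α j - α i) else 0) =
      ∑ j ∈ {su, vs, tv, ut},
        if T.IsInteriorEdge s(i, j) then T.cotWeight C.z i j * (α j - α i) else 0 := by
    symm
    refine Finset.sum_subset (Finset.subset_univ _) fun j _ hj => ?_
    simp only [Finset.mem_insert, Finset.mem_singleton, not_or] at hj
    split_ifs with hij
    · have hc : ∃ x, x ∈ i.1 ∧ x ∈ j.1 := by
        obtain ⟨⟨k, hk⟩, -⟩ := isInteriorEdge_iff.1 hij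
        exact hT.exists_common_vertex hk
      obtain ⟨x, hx, b, hb⟩ := hc
      rw [mul_eq_zero]
      left
      rcases Sym2.mem_iff.1 hx with rfl | rfl
      · refine C.cotWeight_eq_zero hT hij (x := x) (a := v) (b := b) rfl hb (fun ht => ?_)
          fun ht => ?_
        · obtain rfl := G.unique _ _ _ _ h ht
          exact hj.1 (Subtype.ext (hb.trans Sym2.eq_swap))
        · obtain rfl := G.unique _ _ _ _ h' (rotate' ht)
          exact hj.2.2.2 (Subtype.ext hb)
      · refine C.cotWeight_eq_zero hT hij (x := x) (a := u) (b := b) Sym2.eq_swap hb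
          (fun ht => ?_) fun ht => ?_
        · obtain rfl := G.unique _ _ _ _ h' ht
          exact hj.2.2.1 (Subtype.ext (hb.trans Sym2.eq_swap))
        · obtain rfl := G.unique _ _ _ _ h (rotate' ht)
          exact hj.2.1 (Subtype.ext hb)
    · rfl
  rw [hsub, Finset.sum_insert, Finset.sum_insert, Finset.sum_insert, Finset.sum_singleton,
    if_pos i₁, if_pos i₂, if_pos i₃, if_pos i₄, w₁, w₂, w₃, w₄, ← extendEdge_val α i,
    ← extendEdge_val α su, ← extendEdge_val α vs, ← extendEdge_val α tv, ← extendEdge_val α ut]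
  · ring
  · simp [htv, hut, n₁.symm, n₄.symm]
  · simp [hvs, htv, hut, n₁.symm, n₅.symm, hst, n₂.symm]
  · simp [hsu, hvs, htv, hut, n₁, n₄, n₃, hst, n₂.symm]

end Mesh

section Disk

variable {V : Type*} [Fintype V] {G : TriangulatedDisk V} (C : CirclePacking G.toTriMesh)
  {T : TriMesh G.toTriMesh.Edge}

/-- By the maximum principle a harmonic function is determined by its values on the boundary edges.
-/
theorem finrank_cotHarmonic_le (hT : IsMedialTriangulation G.toTriMesh T) :
    Module.finrank ℝ (T.cotHarmonic C.z) + Nat.card G.toTriMesh.InteriorEdge ≤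
      Nat.card G.toTriMesh.Edge := by
  classical
  let B := {e : G.toTriMesh.Edge // ¬ G.IsInteriorEdge e.1}
  let f : T.cotHarmonic C.z →ₗ[ℝ] (B → ℝ) :=
    LinearMap.funLeft ℝ ℝ Subtype.val ∘ₗ (T.cotHarmonic C.z).subtype
  have hf : Function.Injective f := by
    rw [injective_iff_map_eq_zero]
    rintro ⟨α, hα⟩ h0
    have hm : C.MedialHarmonic (extendEdge α) := by
      intro u v s t h h'
      rw [← C.sum_cotWeight hT α h h']
      exact hα _ (hT.isInteriorVertex ⟨u, v, s, t, rfl, h, h'⟩)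
    have hz := fun e he => hm.eq_zero C (fun e he hi => by
      have : α ⟨e, he⟩ = 0 := congrFun h0 ⟨⟨e, he⟩, hi⟩
      rw [← this]
      exact extendEdge_val α ⟨e, he⟩) (e := e) he
    ext e
    change α e = 0
    rw [← extendEdge_val α e]
    exact hz e.1 e.2
  have h₁ := LinearMap.finrank_le_finrank_of_injective hf
  rw [Module.finrank_pi, ← Nat.card_eq_fintype_card] at h₁
  have h₂ : Nat.card B + Nat.card G.toTriMesh.InteriorEdge ≤ Nat.card G.toTriMesh.Edge := by
    rw [← Nat.card_sum]
    refine Nat.card_le_card_of_injective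
      (Sum.elim (fun e : B => e.1) (fun e => ⟨e.1, e.2.isEdge⟩)) ?_
    rintro (e | e) (e' | e') h
    · exact congrArg Sum.inl (Subtype.ext h)
    · exact (e.2 ((congrArg Subtype.val h) ▸ e'.2)).elim
    · exact (e'.2 ((congrArg Subtype.val h) ▸ e.2)).elim
    · exact congrArg Sum.inr (Subtype.ext (congrArg (fun x : G.toTriMesh.Edge => x.1) h))
  omega

/-- The count is `(|E| - |E_int|) + 3 ≤ 3|V| - |E| ≤ dim 𝒟`. -/
theorem exists_cotHarmonic_equiv (hT : IsMedialTriangulation G.toTriMesh T) :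
    ∃ A : (C.deformations ⧸ C.similarityTrivial) ≃ₗ[ℝ] T.cotHarmonic C.z,
      ∀ (δ : C.deformations) (i j : G.toTriMesh.Edge) (u : V),
        u ∈ i.1 → u ∈ j.1 → i ≠ j →
        ((C.dz δ j - C.dz δ i) / (C.z j - C.z i)).im =
          (A (Submodule.Quotient.mk δ)).1 i + (A (Submodule.Quotient.mk δ)).1 j := by
  have h₁ := C.finrank_cotHarmonic_le hT
  have h₂ := C.finrank_similarityTrivial_le
  have h₃ := C.three_mul_card_le
  have h₄ := G.two_mul_card_edge_le
  obtain ⟨A, hA⟩ := exists_quotient_equiv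
    ((LinearMap.funLeft ℝ ℝ Subtype.val ∘ₗ C.spinMap).codRestrict (T.cotHarmonic C.z) (by
      rintro δ ⟨e, he⟩ hi
      have hi' := hT.isInteriorEdge_of_isInteriorVertex hi
      obtain ⟨u, v, s, t, rfl, h, h'⟩ := hi'
      rw [C.sum_cotWeight hT _ h h']
      have := C.medialHarmonic_spinMap δ u v s t h h'
      have hext : ∀ e : G.toTriMesh.Edge, extendEdge
          ((LinearMap.funLeft ℝ ℝ Subtype.val ∘ₗ C.spinMap : C.deformations →ₗ[ℝ] _) δ) e.1 =
          C.spinMap δ e.1 := fun e => extendEdge_val _ e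
      rw [hext ⟨_, isEdge₁₂ h⟩, hext ⟨_, isEdge₂₃ h⟩, hext ⟨_, isEdge₃₁ h⟩, hext ⟨_, isEdge₂₃ h'⟩,
        hext ⟨_, isEdge₃₁ h'⟩]
      exact this)) C.similarityTrivial (by
      ext δ
      rw [LinearMap.mem_ker, C.mem_similarityTrivial_iff]
      constructor
      · exact fun h e he => congrFun (congrArg Subtype.val h) ⟨e, he⟩
      · exact fun h => Subtype.ext (funext fun e => h e.1 e.2)) (by omega)
  refine ⟨A, fun δ i j u hi hj hne => ?_⟩
  rw [hA]
  refine (C.quot_im δ j.2 i.2 hj hi fun h => hne (Subtype.ext h.symm)).trans ?_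
  exact add_comm _ _

end Disk

end CirclePacking

/-! ### Differentials of general type. -/

namespace CirclePacking

open Complex TriMesh

section Mesh

variable {V : Type*} {G : TriMesh V} (C : CirclePacking G) {T : TriMesh G.Edge}

theorem crossRate_apply (e₁ e₂ e₃ e₄ : Sym2 V) (δ : C.deformations) :
    C.crossRate e₁ e₂ e₃ e₄ δ =
      C.quot δ e₁ e₂ - C.quot δ e₂ e₃ + C.quot δ e₃ e₄ - C.quot δ e₄ e₁ := rfl

theorem crossRate_im (hT : IsMedialTriangulation G T) (δ : C.deformations) {i j k l : G.Edge}
    (h : T.tri i j k) (h' : T.tri j i l) : (C.crossRate j.1 k.1 i.1 l.1 δ).im = 0 := by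
  have key : ∀ {i j k : G.Edge}, T.tri i j k → (C.quot δ i.1 j.1).im =
      Sym2.lift ⟨C.spin δ, fun a b => C.spin_swap δ b a⟩ i.1 +
        Sym2.lift ⟨C.spin δ, fun a b => C.spin_swap δ b a⟩ j.1 := by
    intro i j k h
    obtain ⟨u, hi, hj⟩ := hT.exists_common_vertex h
    exact C.quot_im δ i.2 j.2 hi hj fun h' => ne₁₂ h (Subtype.ext h')
  rw [crossRate_apply, sub_im, add_im, sub_im, key (T.rotate _ _ _ h), key (rotate' h),
    key (T.rotate _ _ _ h'), key (rotate' h')]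
  ring

/-- The relative rates of change of the cross ratios of the interior edges of the medial
triangulation. -/
theorem exists_generalMap (hT : IsMedialTriangulation G T) :
    ∃ Q : C.deformations →ₗ[ℝ] (T.InteriorEdge → ℝ),
      ∀ (δ : C.deformations) (e : T.InteriorEdge) (i j k l : G.Edge),
        e.1 = s(i, j) → T.tri i j k → T.tri j i l →
          (Q δ e : ℂ) = C.crossRate j.1 k.1 i.1 l.1 δ := by
  obtain ⟨f, hf⟩ := T.exists_interiorEdge_function
    (fun i j k l => reLm ∘ₗ C.crossRate j.1 k.1 i.1 l.1) (by
      intro i j k l _ _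
      ext δ
      refine congrArg re ?_
      rw [crossRate_apply, crossRate_apply]
      ring)
  refine ⟨LinearMap.pi f, fun δ e i j k l he h h' => ?_⟩
  rw [LinearMap.pi_apply, hf e i j k l he h h']
  exact Complex.ext rfl (C.crossRate_im hT δ h h').symm

/-- The quadratic coefficient of the vector field of a face of the medial triangulation. -/
def medialCoeff (δ : C.deformations) (i j k : G.Edge) : ℂ :=
  (C.quot δ j.1 k.1 - C.quot δ k.1 i.1) / (C.z j - C.z i)

theorem medialCoeff_eq (hT : IsMedialTriangulation G T) (δ : C.deformations) {i j k : G.Edge}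
    (h : T.tri i j k) : C.medialCoeff δ i j k =
      (C.quot δ j.1 k.1 - C.quot δ i.1 j.1) / (C.z k - C.z i) := by
  have h₁ := sub_ne_zero.2 (C.z_ne_of_tri hT h)
  have h₂ := sub_ne_zero.2 (C.z_ne_of_tri hT (T.rotate _ _ _ h))
  have h₃ := sub_ne_zero.2 (C.z_ne_of_tri hT (rotate' h))
  have h₄ : C.z j - C.z i ≠ 0 := by rwa [← neg_ne_zero, neg_sub]
  rw [medialCoeff, div_eq_div_iff h₄ h₃]
  have e : ∀ {i j : G.Edge}, C.z i - C.z j ≠ 0 →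
      C.quot δ i.1 j.1 * (C.z i - C.z j) = C.dz δ i - C.dz δ j := fun h => div_mul_cancel₀ _ h
  linear_combination -(e h₁ + e h₂ + e h₃)

/-- The alternating sum splits into two halves, one for each face at `ij`, and each half is a second
divided difference. -/
theorem crossRate_div (hT : IsMedialTriangulation G T) (δ : C.deformations) {i j l : G.Edge}
    (h : T.tri j i l) (k : G.Edge) :
    C.crossRate j.1 k.1 i.1 l.1 δ / (C.z j - C.z i) =
      C.medialCoeff δ i j k - C.medialCoeff δ i l j := by
  rw [C.medialCoeff_eq hT δ (T.rotate _ _ _ h), medialCoeff, crossRate_apply]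
  ring

end Mesh

section FiniteMesh

variable {V : Type*} [Fintype V] {G : TriMesh V} (C : CirclePacking G) {T : TriMesh G.Edge}

/-- Both sums telescope: the rate is a difference of the derivatives at `z_i` of the fields of the
two triangles, and the rate over `z_j - z_i` is a difference of their quadratic coefficients. -/
theorem general_mem (hT : IsMedialTriangulation G T) {q : T.InteriorEdge → ℝ}
    {δ : C.deformations} (hq : ∀ (e : T.InteriorEdge) (i j k l : G.Edge),
      e.1 = s(i, j) → T.tri i j k → T.tri j i l → (q e : ℂ) = C.crossRate j.1 k.1 i.1 l.1 δ) :
    q ∈ T.generalHQD C.z := by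
  intro i hi
  have hterm : ∀ j k l, T.tri i j k → T.tri j i l →
      (T.extend q s(i, j) : ℂ) = C.crossRate j.1 k.1 i.1 l.1 δ := by
    intro j k l h h'
    have he : T.IsInteriorEdge s(i, j) := ⟨i, j, k, l, rfl, h, h'⟩
    rw [extend_apply _ he, hq ⟨_, he⟩ i j k l rfl h h']
  have hzero : ∀ j, ¬ T.IsEdge s(i, j) → T.extend q s(i, j) = 0 :=
    fun j hj => extend_eq_zero _ fun he => hj he.isEdge
  constructor
  · have : ∑ j, (T.extend q s(i, j) : ℂ) = 0 := by
      refine hi.sum_sub_eq_zero _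
        (fun j k => C.quot δ i.1 j.1 + C.quot δ i.1 k.1 - C.quot δ j.1 k.1)
        (fun j k l h h' => ?_) fun j hj => by rw [hzero j hj, ofReal_zero]
      rw [hterm j k l h h', crossRate_apply, C.quot_swap δ k.1 i.1]
      ring
    exact_mod_cast this
  · refine hi.sum_sub_eq_zero _ (fun j k => -C.medialCoeff δ i j k) (fun j k l h h' => ?_)
      fun j hj => by rw [hzero j hj, ofReal_zero, zero_div]
    rw [hterm j k l h h', C.crossRate_div hT δ h' k]
    ring

open Classical in
/-- The part of the second condition on a holomorphic quadratic differential that comes from the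
edges from `i` to other edges of `G` at `u`. -/
def fan (u : V) (i : G.Edge) : (T.InteriorEdge → ℝ) →ₗ[ℝ] ℂ where
  toFun q := ∑ j, if u ∈ j.1 then (T.extend q s(i, j) : ℂ) / (C.z j - C.z i) else 0
  map_add' q q' := by
    rw [← Finset.sum_add_distrib]
    refine Finset.sum_congr rfl fun j _ => ?_
    split_ifs
    · rw [extend_add, ofReal_add, add_div]
    · rw [add_zero]
  map_smul' r q := by
    rw [RingHom.id_apply, Finset.smul_sum]
    refine Finset.sum_congr rfl fun j _ => ?_
    split_ifs
    · rw [extend_smul, ofReal_mul, mul_div_assoc, real_smul]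
    · rw [smul_zero]

open Classical in
/-- The part of the first condition on a holomorphic quadratic differential that comes from the
edges from `i` to other edges of `G` at `u`. -/
def fanSum (T : TriMesh G.Edge) (q : T.InteriorEdge → ℝ) (u : V) (i : G.Edge) : ℝ :=
  ∑ j, if u ∈ j.1 then T.extend q s(i, j) else 0

/-- The sum telescopes through the polygon of `u` and leaves the medial triangles of the two faces
at `uv`. Hence zero rates on the medial triangulation force zero Koebe rates. -/
theorem fan_eq_quadCoeff_sub (hT : IsMedialTriangulation G T) {q : T.InteriorEdge → ℝ}
    {δ : C.deformations} (hq : ∀ (e : T.InteriorEdge) (i j k l : G.Edge),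
      e.1 = s(i, j) → T.tri i j k → T.tri j i l → (q e : ℂ) = C.crossRate j.1 k.1 i.1 l.1 δ)
    {u v s t : V} (h : G.tri u v s) (h' : G.tri v u t) :
    C.fan u ⟨s(u, v), isEdge₁₂ h⟩ q = C.quadCoeff δ v u t - C.quadCoeff δ u v s := by
  classical
  set i : G.Edge := ⟨s(u, v), isEdge₁₂ h⟩ with hi
  set su : G.Edge := ⟨s(s, u), isEdge₃₁ h⟩ with hsu
  set vs : G.Edge := ⟨s(v, s), isEdge₂₃ h⟩ with hvs
  set tv : G.Edge := ⟨s(t, v), isEdge₃₁ h'⟩ with htv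
  set ut : G.Edge := ⟨s(u, t), isEdge₂₃ h'⟩ with hut
  have t₁ : T.tri i vs su := hT.tri_of_tri h rfl rfl rfl
  have t₂ : T.tri i ut tv := hT.tri_of_tri h' Sym2.eq_swap rfl rfl
  have hV : T.IsInteriorVertex i := hT.isInteriorVertex ⟨u, v, s, t, rfl, h, h'⟩
  have n₁ := ne₁₂ h
  have n₃ := ne₃₁ h
  have n₅ := ne₂₃ h'
  have h₁ : C.quadCoeff δ v u t = C.medialCoeff δ i ut tv := by
    rw [← C.quadCoeff_rotate δ h', ← C.quadCoeff_rotate δ (G.rotate _ _ _ h'), quadCoeff,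
      medialCoeff, C.quot_swap δ s(v, u)]
    simp only [hi, z, Sym2.eq_swap (a := v) (b := u)]
    rfl
  have h₂ : C.quadCoeff δ u v s = C.medialCoeff δ i vs su := by
    rw [← C.quadCoeff_rotate δ h, ← C.quadCoeff_rotate δ (G.rotate _ _ _ h), quadCoeff,
      medialCoeff, C.quot_swap δ s(u, v)]
    rfl
  -- The indicator of the edges at `u` changes between `j` and `k` only in the two medial triangles
  -- that bound the fan.
  have hsides : ∀ j k, T.tri i j k →
      ((if u ∈ j.1 then 1 else 0) - (if u ∈ k.1 then 1 else 0) : ℂ) * C.medialCoeff δ i j k =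
      (if j = ut then C.quadCoeff δ v u t else 0) -
        if j = vs then C.quadCoeff δ u v s else 0 := by
    intro j k hk
    have hutvs : ut ≠ vs := by simp [hut, hvs, n₁, n₃.symm]
    by_cases hj₁ : j = ut
    · subst hj₁
      obtain rfl := T.unique _ _ _ _ t₂ hk
      rw [if_pos rfl, if_neg hutvs, h₁, if_pos (by simp [hut]),
        if_neg (by simp [htv, n₁, n₅])]
      ring
    by_cases hj₂ : j = vs
    · subst hj₂
      obtain rfl := T.unique _ _ _ _ t₁ hk
      rw [if_pos rfl, if_neg hj₁, h₂, if_neg (by simp [hvs, n₁, n₃.symm]),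
        if_pos (by simp [hsu])]
      ring
    rw [if_neg hj₁, if_neg hj₂, sub_zero]
    have hij : i.1 ≠ j.1 := fun h => ne₁₂ hk (Subtype.ext h)
    have hik : i.1 ≠ k.1 := fun h => ne₃₁ hk (Subtype.ext h.symm)
    rcases hT.face_or_common_vertex hk with ⟨a, b, c, ht, e₁, e₂, e₃⟩ | ⟨w, e₁, e₂, e₃⟩
    · exfalso
      rcases Sym2.eq_iff.1 e₁ with ⟨rfl, rfl⟩ | ⟨rfl, rfl⟩
      · obtain rfl := G.unique _ _ _ _ h ht
        exact hj₂ (Subtype.ext e₂)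
      · obtain rfl := G.unique _ _ _ _ h' ht
        exact hj₁ (Subtype.ext e₂)
    · have huj : u ∈ j.1 ↔ u = w :=
        ⟨fun hu => Sym2.eq_of_mem_of_mem hij (Sym2.mem_mk_left u v) hu e₁ e₂, fun hu => hu ▸ e₂⟩
      have huk : u ∈ k.1 ↔ u = w :=
        ⟨fun hu => Sym2.eq_of_mem_of_mem hik (Sym2.mem_mk_left u v) hu e₁ e₃, fun hu => hu ▸ e₃⟩
      simp only [huj, huk, sub_self, zero_mul]
  have hsum : ∑ j, ((if u ∈ j.1 then (T.extend q s(i, j) : ℂ) / (C.z j - C.z i) else 0) -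
      ((if j = ut then C.quadCoeff δ v u t else 0) -
        if j = vs then C.quadCoeff δ u v s else 0)) = 0 := by
    refine hV.sum_sub_eq_zero _
      (fun j k => -((if u ∈ k.1 then 1 else 0) * C.medialCoeff δ i j k)) (fun j k l hk hl => ?_)
      fun j hj => ?_
    · have he : T.IsInteriorEdge s(i, j) := ⟨i, j, k, l, rfl, hk, hl⟩
      rw [← hsides j k hk, extend_apply _ he, hq ⟨_, he⟩ i j k l rfl hk hl,
        C.crossRate_div hT δ hl k]
      split_ifs <;> ring
    · have e₁ : j ≠ ut := by rintro rfl; exact hj (isEdge₁₂ t₂)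
      have e₂ : j ≠ vs := by rintro rfl; exact hj (isEdge₁₂ t₁)
      rw [if_neg e₁, if_neg e₂, extend_eq_zero _ fun he => hj he.isEdge]
      simp
  rw [Finset.sum_sub_distrib, Finset.sum_sub_distrib, Finset.sum_ite_eq' Finset.univ ut,
    Finset.sum_ite_eq' Finset.univ vs, if_pos (Finset.mem_univ _), if_pos (Finset.mem_univ _),
    sub_eq_zero] at hsum
  exact hsum

-- A neighbour of `uv` in `T` contains exactly one of `u` and `v`.
open Classical in
theorem sum_eq_fan_add_fan (hT : IsMedialTriangulation G T) {M : Type*} [AddCommMonoid M]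
    {i : G.Edge} {u v : V} (hi : i.1 = s(u, v)) (f : G.Edge → M)
    (hf : ∀ j, ¬ T.IsEdge s(i, j) → f j = 0) :
    ∑ j, f j = (∑ j, if u ∈ j.1 then f j else 0) + ∑ j, if v ∈ j.1 then f j else 0 := by
  rw [← Finset.sum_add_distrib]
  refine Finset.sum_congr rfl fun j _ => ?_
  by_cases hj : T.IsEdge s(i, j)
  · have huv : u ≠ v := (hi ▸ i.2 : G.IsEdge s(u, v)).ne
    have hij : i.1 ≠ j.1 := fun h => hj.ne (Subtype.ext h)
    have hmem : u ∈ j.1 → v ∈ j.1 → False := fun h₁ h₂ => huv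
      (Sym2.eq_of_mem_of_mem hij (by simp [hi]) h₁ (by simp [hi]) h₂)
    have hex : ∃ x, x ∈ i.1 ∧ x ∈ j.1 := by
      rcases isEdge_iff.1 hj with ⟨k, hk⟩ | ⟨k, hk⟩
      · exact hT.exists_common_vertex hk
      · obtain ⟨x, hx, hx'⟩ := hT.exists_common_vertex hk
        exact ⟨x, hx', hx⟩
    obtain ⟨x, hx, hx'⟩ := hex
    rw [hi, Sym2.mem_iff] at hx
    rcases hx with rfl | rfl
    · rw [if_pos hx', if_neg fun h => hmem hx' h, add_zero]
    · rw [if_pos hx', if_neg fun h => hmem h hx', zero_add]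
  · rw [hf j hj]
    simp

/-- By `inv_pt_sub`, all real parts in the frame of the edge have the common factor `-1/(2R_u)`. -/
theorem exists_fan_eq (q : T.InteriorEdge → ℝ) {i : G.Edge} {u v : V} (hi : i.1 = s(u, v)) :
    ∃ κ : ℝ, C.fan u i q =
      conj (C.dir u v) * (-(fanSum T q u i : ℂ) / (2 * C.radius u) - I * κ) := by
  classical
  have hterm : ∀ j : G.Edge, ∃ κ : ℝ,
      (if u ∈ j.1 then (T.extend q s(i, j) : ℂ) / (C.z j - C.z i) else 0) =
      conj (C.dir u v) * (-((if u ∈ j.1 then T.extend q s(i, j) else 0 : ℝ) : ℂ) /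
        (2 * C.radius u) - I * κ) := by
    intro j
    by_cases hj : u ∈ j.1
    · rw [if_pos hj, if_pos hj]
      by_cases hij : i = j
      · subst hij
        exact ⟨0, by simp [extend_eq_zero q fun h : T.IsInteriorEdge s(i, i) => h.isEdge.ne rfl]⟩
      · obtain ⟨w, hw⟩ := hj
        have hvw : v ≠ w := by rintro rfl; exact hij (Subtype.ext (hi.trans hw.symm))
        refine ⟨T.extend q s(i, j) * C.halfCot u v w / (2 * C.radius u), ?_⟩
        have := C.radius_ne' u
        rw [z, z, hi, hw, div_eq_mul_inv, C.inv_pt_sub (hi ▸ i.2) (hw ▸ j.2) hvw]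
        push_cast
        field_simp
    · rw [if_neg hj, if_neg hj]
      exact ⟨0, by simp⟩
  choose κ hκ using hterm
  refine ⟨∑ j, κ j, ?_⟩
  change ∑ j, _ = _
  simp only [hκ]
  rw [← Finset.mul_sum, Finset.sum_sub_distrib, ← Finset.mul_sum, ← Finset.sum_div,
    Finset.sum_neg_distrib, fanSum]
  push_cast
  rfl

/-- With `s` the sum of the fan at `u`, the fan at `v` has sum `-s` and the reversed direction. The
real part of the total is therefore `-s/(2R_u) - s/(2R_v)`, and its vanishing forces `s = 0`. -/
theorem fan_of_mem (hT : IsMedialTriangulation G T) {q : T.InteriorEdge → ℝ}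
    (hq : q ∈ T.generalHQD C.z) {i : G.Edge} {u v : V} (hi : i.1 = s(u, v))
    (hint : G.IsInteriorEdge i.1) :
    fanSum T q u i = 0 ∧ C.fan v i q = -C.fan u i q ∧
      ∃ κ : ℝ, C.fan u i q = -I * κ * conj (C.dir u v) := by
  classical
  obtain ⟨h₁, h₂⟩ := hq i (hT.isInteriorVertex hint)
  rw [sum_eq_fan_add_fan hT hi _ fun j hj => extend_eq_zero q fun h => hj h.isEdge] at h₁
  rw [sum_eq_fan_add_fan hT hi _ fun j hj => by
    rw [extend_eq_zero q fun h => hj h.isEdge, ofReal_zero, zero_div]] at h₂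
  change fanSum T q u i + fanSum T q v i = 0 at h₁
  change C.fan u i q + C.fan v i q = 0 at h₂
  obtain ⟨κ, hκ⟩ := C.exists_fan_eq q hi
  obtain ⟨κ', hκ'⟩ := C.exists_fan_eq q (hi.trans Sym2.eq_swap)
  have hd := (map_ne_zero (starRingEnd ℂ)).2 (C.dir_ne_zero (hi ▸ i.2 : G.IsEdge s(u, v)))
  have hpu := C.radius_pos u
  have hpv := C.radius_pos v
  have hv : fanSum T q v i = -fanSum T q u i := by linarith
  have h₃ : ((-fanSum T q u i / (2 * C.radius u) - fanSum T q u i / (2 * C.radius v) : ℝ) : ℂ) +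
      ((κ' - κ : ℝ) : ℂ) * I = 0 := by
    refine (mul_eq_zero.1 ?_).resolve_left hd
    rw [hκ, hκ', hv, C.dir_swap u v, map_neg] at h₂
    rw [← h₂]
    push_cast
    ring
  have h₄ := congrArg re h₃
  rw [← mk_eq_add_mul_I] at h₄
  have h₅ : fanSum T q u i = 0 := by
    have h₆ : fanSum T q u i * (1 / (2 * C.radius u) + 1 / (2 * C.radius v)) = 0 := by
      rw [show (0 : ℂ).re = 0 from rfl] at h₄
      linear_combination -h₄
    exact (mul_eq_zero.1 h₆).resolve_right (by positivity)
  refine ⟨h₅, by linear_combination h₂, κ, ?_⟩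
  rw [hκ, h₅]
  simp
  ring

open Classical in
theorem sum_eq_sum_edge {M : Type*} [AddCommMonoid M] (u : V) (H : V → M) (F : G.Edge → M)
    (h₁ : ∀ v (h : G.IsEdge s(u, v)), H v = F ⟨s(u, v), h⟩)
    (h₀ : ∀ v, ¬ G.IsEdge s(u, v) → H v = 0) :
    ∑ v, H v = ∑ i : G.Edge, if u ∈ i.1 then F i else 0 := by
  rw [← Finset.sum_filter, ← Finset.sum_filter_of_ne (p := fun v => G.IsEdge s(u, v))
    fun v _ hv => by_contra fun h => hv (h₀ v h)]
  refine Finset.sum_bij (fun v hv => ⟨s(u, v), (Finset.mem_filter.1 hv).2⟩) ?_ ?_ ?_ ?_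
  · intro v hv
    simp
  · intro v _ w _ h
    exact Sym2.congr_right.1 (congrArg Subtype.val h)
  · rintro ⟨e, he⟩ hi
    obtain ⟨v, rfl⟩ := (Finset.mem_filter.1 hi).2
    exact ⟨v, by simpa using he, rfl⟩
  · exact fun v hv => h₁ v _

-- The terms are antisymmetric under exchange of `i` and `j`.
open Classical in
theorem sum_fan_eq_zero (q : T.InteriorEdge → ℝ) (u : V) :
    (∑ i : G.Edge, if u ∈ i.1 then C.fan u i q else 0) = 0 := by
  set S := ∑ i : G.Edge, if u ∈ i.1 then C.fan u i q else 0 with hS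
  have h₁ : S = ∑ i : G.Edge, ∑ j : G.Edge, if u ∈ i.1 then if u ∈ j.1 then
      (T.extend q s(i, j) : ℂ) / (C.z j - C.z i) else 0 else 0 := by
    refine Finset.sum_congr rfl fun i _ => ?_
    split_ifs
    · rfl
    · simp
  have h₂ : S = -S := by
    conv_lhs => rw [h₁, Finset.sum_comm]
    rw [h₁, ← Finset.sum_neg_distrib]
    refine Finset.sum_congr rfl fun i _ => ?_
    rw [← Finset.sum_neg_distrib]
    refine Finset.sum_congr rfl fun j _ => ?_
    rw [Sym2.eq_swap, ← neg_sub (C.z j), div_neg]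
    split_ifs <;> simp
  exact self_eq_neg.1 h₂

-- Symmetrization in `i` and `j` replaces `q_ij z_i / (z_j - z_i)` by `-q_ij`, and the sums of these
-- over each fan vanish.
open Classical in
theorem sum_fan_mul_z_eq_zero (q : T.InteriorEdge → ℝ)
    (u : V) (hu : ∀ i : G.Edge, u ∈ i.1 → fanSum T q u i = 0) :
    (∑ i : G.Edge, if u ∈ i.1 then C.fan u i q * C.z i else 0) = 0 := by
  set S := ∑ i : G.Edge, if u ∈ i.1 then C.fan u i q * C.z i else 0 with hS
  have h₁ : S = ∑ i : G.Edge, ∑ j : G.Edge, if u ∈ i.1 then if u ∈ j.1 then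
      (T.extend q s(i, j) : ℂ) / (C.z j - C.z i) * C.z i else 0 else 0 := by
    refine Finset.sum_congr rfl fun i _ => ?_
    split_ifs
    · rw [fan, LinearMap.coe_mk, AddHom.coe_mk, Finset.sum_mul]
      refine Finset.sum_congr rfl fun j _ => ?_
      split_ifs <;> simp
    · simp
  have h₂ : S + S = -∑ i : G.Edge, ∑ j : G.Edge, if u ∈ i.1 then if u ∈ j.1 then
      (T.extend q s(i, j) : ℂ) else 0 else 0 := by
    conv_lhs => enter [2]; rw [h₁, Finset.sum_comm]
    rw [h₁, ← Finset.sum_add_distrib, ← Finset.sum_neg_distrib]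
    refine Finset.sum_congr rfl fun i _ => ?_
    rw [← Finset.sum_add_distrib, ← Finset.sum_neg_distrib]
    refine Finset.sum_congr rfl fun j _ => ?_
    by_cases hi : u ∈ i.1
    · by_cases hj : u ∈ j.1
      · simp only [if_pos hi, if_pos hj]
        rw [Sym2.eq_swap (a := j)]
        by_cases hij : i = j
        · subst hij
          simp [extend_eq_zero q fun h : T.IsInteriorEdge s(i, i) => h.isEdge.ne rfl]
        · have h₃ := sub_ne_zero.2 (C.z_ne hi hj hij)
          have h₄ : C.z j - C.z i ≠ 0 := by rwa [← neg_ne_zero, neg_sub]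
          field_simp
          ring
      · simp [hj]
    · simp [hi]
  have h₃ : (∑ i : G.Edge, ∑ j : G.Edge, if u ∈ i.1 then if u ∈ j.1 then
      (T.extend q s(i, j) : ℂ) else 0 else 0) = 0 := by
    refine Finset.sum_eq_zero fun i _ => ?_
    by_cases hi : u ∈ i.1
    · have := hu i hi
      simp only [if_pos hi]
      rw [fanSum] at this
      have := congrArg ofReal this
      rw [ofReal_sum, ofReal_zero] at this
      refine (Finset.sum_congr rfl fun j _ => ?_).trans this
      split_ifs <;> simp
    · simp [hi]
  rw [h₃, neg_zero] at h₂
  exact self_eq_neg.1 (eq_neg_of_add_eq_zero_left h₂)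

/-- The stress is `i · dir · fan`, real by `fan_of_mem` and independent of the chosen end, as
direction and fan both change sign. `sum_fan_eq_zero` and `sum_fan_mul_z_eq_zero` yield its
equilibrium. Zero stress means zero fans, and then peeling the triangulated polygons gives `q = 0`.
-/
theorem exists_stress_of_generalHQD (hT : IsMedialTriangulation G T) :
    ∃ f : T.generalHQD C.z →ₗ[ℝ] C.stress, Function.Injective f := by
  classical
  have hends : ∀ e : G.InteriorEdge, ∃ a b, e.1 = s(a, b) := fun e =>
    e.2.elim fun a ⟨b, _, _, he, _⟩ => ⟨a, b, he⟩
  choose a b hab using hends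
  let μ : (T.InteriorEdge → ℝ) →ₗ[ℝ] (G.InteriorEdge → ℝ) := LinearMap.pi fun e =>
    reLm ∘ₗ LinearMap.mulLeft ℝ (I * C.dir (a e) (b e)) ∘ₗ C.fan (a e) ⟨e.1, e.2.isEdge⟩
  have hμ : ∀ q ∈ T.generalHQD C.z, ∀ u v (h : G.IsInteriorEdge s(u, v)),
      (μ q ⟨s(u, v), h⟩ : ℂ) = I * C.dir u v * C.fan u ⟨s(u, v), h.isEdge⟩ q := by
    intro q hq u v h
    have h₁ : ∀ x y, (s(u, v) : Sym2 V) = s(x, y) →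
        ∃ κ : ℝ, I * C.dir x y * C.fan x ⟨s(u, v), h.isEdge⟩ q = κ := by
      intro x y hxy
      obtain ⟨-, -, κ, hκ⟩ := C.fan_of_mem hT hq (i := ⟨s(u, v), h.isEdge⟩) hxy h
      refine ⟨κ, ?_⟩
      rw [hκ]
      have := C.dir_mul_conj (hxy ▸ h.isEdge : G.IsEdge s(x, y))
      linear_combination (κ : ℂ) * this - C.dir x y * κ * conj (C.dir x y) * I_mul_I
    have h₂ : (μ q ⟨s(u, v), h⟩ : ℂ) = I * C.dir (a ⟨s(u, v), h⟩) (b ⟨s(u, v), h⟩) *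
        C.fan (a ⟨s(u, v), h⟩) ⟨s(u, v), h.isEdge⟩ q := by
      obtain ⟨κ, hκ⟩ := h₁ _ _ (hab ⟨s(u, v), h⟩)
      rw [hκ]
      exact congrArg ofReal (congrArg re hκ)
    rw [h₂]
    rcases Sym2.eq_iff.1 (hab ⟨s(u, v), h⟩) with ⟨e₁, e₂⟩ | ⟨e₁, e₂⟩
    · rw [← e₁, ← e₂]
    · rw [← e₁, ← e₂, (C.fan_of_mem hT hq (i := ⟨s(u, v), h.isEdge⟩) rfl h).2.1, C.dir_swap u v]
      ring
  have hmem : ∀ q ∈ T.generalHQD C.z, μ q ∈ C.stress := by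
    intro q hq u hu
    have hterm : ∀ v (h : G.IsEdge s(u, v)), (G.extend (μ q) s(u, v) : ℂ) =
        I * C.dir u v * C.fan u ⟨s(u, v), h⟩ q := by
      intro v h
      rw [extend_apply _ (hu v h), hμ q hq]
    have hzero : ∀ v, ¬ G.IsEdge s(u, v) → G.extend (μ q) s(u, v) = 0 :=
      fun v h => extend_eq_zero _ fun h' => h h'.isEdge
    have hd : ∑ v, (G.extend (μ q) s(u, v) : ℂ) * conj (C.dir u v) = 0 := by
      have h₁ := C.sum_fan_eq_zero q u
      rw [← sum_eq_sum_edge u (fun v => -I * ((G.extend (μ q) s(u, v) : ℂ) * conj (C.dir u v))),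
        ← Finset.mul_sum] at h₁
      · exact (mul_eq_zero.1 h₁).resolve_left (neg_ne_zero.2 I_ne_zero)
      · intro v h
        rw [hterm v h]
        linear_combination C.fan u ⟨s(u, v), h⟩ q * C.dir_mul_conj h -
          C.dir u v * conj (C.dir u v) * C.fan u ⟨s(u, v), h⟩ q * I_mul_I
      · intro v h
        rw [hzero v h]
        simp
    have hs : ∑ v, (G.extend (μ q) s(u, v) : ℂ) = 0 := by
      have h₁ := C.sum_fan_mul_z_eq_zero q u fun i hi => by
        obtain ⟨v, hv⟩ := hi
        exact (C.fan_of_mem hT hq hv (hv ▸ hu v (hv ▸ i.2))).1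
      rw [← sum_eq_sum_edge u (fun v => -I * C.center u *
        ((G.extend (μ q) s(u, v) : ℂ) * conj (C.dir u v)) +
          -I * C.radius u * (G.extend (μ q) s(u, v) : ℂ))] at h₁
      · rw [Finset.sum_add_distrib, ← Finset.mul_sum, ← Finset.mul_sum, hd, mul_zero,
          zero_add] at h₁
        exact (mul_eq_zero.1 h₁).resolve_left
          (mul_ne_zero (neg_ne_zero.2 I_ne_zero) (C.radius_ne' u))
      · intro v h
        rw [hterm v h, z, C.pt_eq]
        linear_combination C.center u * C.fan u ⟨s(u, v), h⟩ q * C.dir_mul_conj h -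
          (C.center u * conj (C.dir u v) + C.radius u) *
            (C.dir u v * C.fan u ⟨s(u, v), h⟩ q) * I_mul_I
      · intro v h
        rw [hzero v h]
        simp
    refine ⟨by exact_mod_cast hs, ?_⟩
    have := congrArg conj hd
    simpa only [map_sum, map_mul, conj_ofReal, conj_conj, map_zero] using this
  refine ⟨(μ ∘ₗ (T.generalHQD C.z).subtype).codRestrict C.stress fun q => hmem q.1 q.2, ?_⟩
  rw [injective_iff_map_eq_zero]
  rintro ⟨q, hq⟩ h0
  refine Subtype.ext (hT.eq_zero_of_fan_eq_zero (z := C.z)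
    (fun i j u hi hj hne => C.z_ne hi hj hne) fun i u hint hu => ?_)
  obtain ⟨e, he⟩ := i
  obtain ⟨v, rfl⟩ := hu
  refine ⟨(C.fan_of_mem hT hq (i := ⟨s(u, v), he⟩) rfl hint).1, ?_⟩
  have h₁ := hμ q hq u v hint
  have h₂ : μ q ⟨s(u, v), hint⟩ = 0 := congrFun (congrArg Subtype.val h0) _
  rw [h₂, ofReal_zero] at h₁
  exact (mul_eq_zero.1 h₁.symm).resolve_left (mul_ne_zero I_ne_zero (C.dir_ne_zero he))

end FiniteMesh

section Disk

variable {V : Type*} [Fintype V] {G : TriangulatedDisk V} (C : CirclePacking G.toTriMesh)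
  {T : TriMesh G.toTriMesh.Edge}

theorem exists_general_equiv (hT : IsMedialTriangulation G.toTriMesh T) :
    ∃ Q : (C.deformations ⧸ C.mobiusTrivial) ≃ₗ[ℝ] T.generalHQD C.z,
      ∀ (δ : C.deformations) (e : T.InteriorEdge) (i j k l : G.toTriMesh.Edge),
        e.1 = s(i, j) → T.tri i j k → T.tri j i l →
        (((Q (Submodule.Quotient.mk δ)).1 e : ℝ) : ℂ) = C.crossRate j.1 k.1 i.1 l.1 δ := by
  obtain ⟨Q, hQ⟩ := C.exists_generalMap hT
  obtain ⟨f, hf⟩ := C.exists_stress_of_generalHQD hT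
  have h₁ := LinearMap.finrank_le_finrank_of_injective hf
  have h₂ := C.finrank_stress_add_finrank_mobiusTrivial_le
  obtain ⟨e, he⟩ := exists_quotient_equiv
    (Q.codRestrict (T.generalHQD C.z) fun δ => C.general_mem hT (hQ δ)) C.mobiusTrivial (by
      ext δ
      rw [LinearMap.mem_ker]
      constructor
      · intro h
        refine C.mem_mobiusTrivial_of_koebeRate_eq_zero fun u v s t hs ht => ?_
        have h₃ : Q δ = 0 := congrArg Subtype.val h
        rw [C.koebeRate_eq δ hs ht, ← C.fan_eq_quadCoeff_sub hT (hQ δ) hs ht, h₃, map_zero,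
          mul_zero]
      · rintro ⟨Φ, -, hΦ⟩
        ext e
        obtain ⟨i, j, k, l, he, h, h'⟩ := e.2
        have h₃ := hQ δ e i j k l he h h'
        have h₄ : C.crossRate j.1 k.1 i.1 l.1 δ = 0 := by
          change crossRatioRate (C.z j) (C.z k) (C.z i) (C.z l) (C.dz δ j) (C.dz δ k) (C.dz δ i)
            (C.dz δ l) = 0
          rw [hΦ, hΦ, hΦ, hΦ]
          exact crossRatioRate_mobiusField Φ (C.z_ne_of_tri hT (T.rotate _ _ _ h))
            (C.z_ne_of_tri hT (rotate' h)) (C.z_ne_of_tri hT (T.rotate _ _ _ h'))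
            (C.z_ne_of_tri hT (rotate' h'))
        rw [h₄] at h₃
        exact_mod_cast h₃) (by omega)
  refine ⟨e, fun δ e' i j k l he' h h' => ?_⟩
  rw [he]
  exact hQ δ e' i j k l he' h h'

end Disk

end CirclePacking

end

/-- Infinitesimal deformations of a circle packing up to trivial motions are parametrized by
(1) holomorphic quadratic differentials of general type on a triangulation of the medial graph,
(2) holomorphic quadratic differentials of Koebe type, and
(3) functions on the medial graph that are harmonic for the cotangent Laplacian. -/
theorem corollary7p6 {V : Type*} [Fintype V] (G : TriangulatedDisk V)
    (C : CirclePacking G.toTriMesh) (T : TriMesh G.toTriMesh.Edge)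
    (hT : IsMedialTriangulation G.toTriMesh T) :
    (∃ Q : (C.deformations ⧸ C.mobiusTrivial) ≃ₗ[ℝ] T.generalHQD C.z,
      ∀ (δ : C.deformations) (e : T.InteriorEdge) (i j k l : G.toTriMesh.Edge),
        e.1 = s(i, j) → T.tri i j k → T.tri j i l →
        (((Q (Submodule.Quotient.mk δ)).1 e : ℝ) : ℂ) =
          crossRatioRate (C.z j) (C.z k) (C.z i) (C.z l)
            (C.dz δ j) (C.dz δ k) (C.dz δ i) (C.dz δ l)) ∧
    (∃ L : (C.deformations ⧸ C.mobiusTrivial) ≃ₗ[ℝ] C.koebeHQD,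
      ∀ (δ : C.deformations) (e : G.toTriMesh.InteriorEdge) (u v s t : V),
        e.1 = s(u, v) → G.tri u v s → G.tri v u t →
        (((L (Submodule.Quotient.mk δ)).1 e : ℝ) : ℂ) =
          crossRatioRate (C.pt s(u, v)) (C.pt s(v, s)) (C.pt s(s, u)) (C.pt s(u, t))
            (C.dpt δ s(u, v)) (C.dpt δ s(v, s)) (C.dpt δ s(s, u)) (C.dpt δ s(u, t))) ∧
    (∃ A : (C.deformations ⧸ C.similarityTrivial) ≃ₗ[ℝ] T.cotHarmonic C.z,
      ∀ (δ : C.deformations) (i j : G.toTriMesh.Edge) (u : V),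
        u ∈ i.1 → u ∈ j.1 → i ≠ j →
        ((C.dz δ j - C.dz δ i) / (C.z j - C.z i)).im =
          (A (Submodule.Quotient.mk δ)).1 i + (A (Submodule.Quotient.mk δ)).1 j) := by
  refine ⟨C.exists_general_equiv hT, C.exists_koebe_equiv, C.exists_cotHarmonic_equiv hT⟩
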